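/- **Setting.** Let $\mathcal N=\{1,\dots,n\}$ be a set of agents, $(\mathcal X,d)$ a metric space, $\mathcal Y_i$ sets of internal states, $\mathcal A_i$ sets of actions, $\mathcal S_i=\mathcal X\times\mathcal Y_i$, $\mathcal S=\prod_i\mathcal S_i$, $\mathcal A=\prod_i\mathcal A_i$, and let $d$ also denote the distance of the positions of two states. For $K\in\mathbb R$, $g\subset\mathcal N$ and a group state $s_g$, agents of $g$ are equivalent if they are joined by a chain of agents of $g$ in which consecutive agents are at distance at most $K$; the resulting partition of $g$ is $D(s_g)$ for $K=\mathcal R>0$, $Z_{exec}(s_g)$ for $K=\mathcal V_{exec}$ and $Z_{comp}(s_g)$ for $K=\mathcal V_{comp}$, where $\mathcal V_{exec}>\mathcal R$, $\mathcal V_{comp}=\mathcal V_{exec}+\xi$ and $\xi\ge 0$. A partition $\mathcal P'$ is finer than $\mathcal P$ if each block of $\mathcal P'$ lies in a block of $\mathcal P$, and $\mathcal P\cap\mathcal P'$ is the partition into the nonempty intersections of their blocks. A *Generalized Locally Interdependent Multi-Agent MDP* consists of probability mass functions $P_i(\cdot\mid s_g,a_g)$ on $\mathcal S_i$ ($i\in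 g$) with $P_i(s_i'\mid s_g,a_g)=0$ if $d(s_i,s_i')>1$, of bounded functions $\overline r_{i,j}(s_i,a_i,s_j,a_j)$, and of a discount $\gamma\in[0,1)$. Put $P_g(s'_g\mid s_g,a_g)=\prod_{i\in g}P_i(s_i'\mid s_g,a_g)$, $P(s'\mid s,a)=\prod_{g\in D(s)}P_g(s_g'\mid s_g,a_g)$, $r_p(s_p,a_p)=\sum_{g\in D(s_p)}\sum_{i,j\in g}\overline r_{i,j}(s_i,a_i,s_j,a_j)$, $r(s,a)=r_{\mathcal N}(s,a)$ and $\tilde r=\sum_{i,j\in\mathcal N}\sup|\overline r_{i,j}|$. It is *standard* if $P_i(\cdot\mid s_g,a_g)$ depends only on $(s_i,a_i)$, and $\overline r_{i,j}(s_i,a_i,s_j,a_j)=0$ whenever $d(s_i,s_j)>\mathcal R$. The *extended Cutoff Multi-Agent MDP* has the states $(s,\mathcal P)$ with $s\in\mathcal S$ and $\mathcal P$ finer than $Z_{comp}(s)$; from $(s,\mathcal P)$ under the action $a$ it moves to $(s',Z_{comp}(s')\cap\mathcal P)$ with probability $\prod_{p\in\mathcal P}\prod_{g\in D(s_p)}P_g(s'_g\mid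 s_g,a_g)$, and its reward is $r^{\mathcal C}((s,\mathcal P),a)=\sum_{p\in\mathcal P}r_p(s_p,a_p)$. A stationary *proper cutoff policy* has the form $\pi(a\mid(s,\mathcal P))=\prod_{p\in\mathcal P}[\pi]_p(a_p\mid s_p)$. For a sequence $\pi=(\pi_t)$ of such policies, $g\subset\mathcal N$, $\mathcal P$ finer than $Z_{comp}(s)$, and $\mathcal P'$ finer or coarser than $\mathcal P$, let $$[V^{\pi|^{\mathcal P'}}_{h,h'}]_g(s,\mathcal P)=\mathbb E\Big[\sum_{t=h}^{h'}\gamma^{t-h}\sum_{p\in\mathcal P(t),\,p\cap g\ne\varnothing}r_{p\cap g}(s_{p\cap g}(t),a_{p\cap g}(t))\Big],$$ where $(s(t),\mathcal P(t))$ is the Cutoff Multi-Agent MDP started at $(s(h),\mathcal P(h))=(s,\mathcal P)$ and $a(t)\sim\pi_t(\cdot\mid(s(t),\mathcal P'(t)))$ with $\mathcal P'(h)=\mathcal P'$, $\mathcal P'(t+1)=\mathcal P'(t)\cap Z_{comp}(s(t+1))$. An empty sum is $0$. Write $V^\pi$ for $V^{\pi|^{\mathcal P}}$, and omit $g$ if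 $g=\mathcal N$. For a policy $(\pi_0,\dots,\pi_H)$, an omitted $h'$ is $H$. Let $c=\lfloor(\mathcal V_{exec}-\mathcal R)/2\rfloor$, $\eta\in\{0,1,\dots\}$, $H=c+\eta$. The sequence $\pi=(\pi_0,\dots,\pi_H)$ of stationary proper cutoff policies is a *Consistent Performance Policy* if there is a stationary proper cutoff policy $\pi_{H+1}$ such that, with $\pi'=(\pi_0,\dots,\pi_{H+1})$, for all $s\in\mathcal S$, all $\mathcal P$ finer than $Z_{comp}(s)$ and all $\mathcal P'$ finer than $\mathcal P$: - $[V_h^{\pi|^{\mathcal P'}}]_p(s,\mathcal P)\le[V_h^{\pi}]_p(s,\mathcal P)$ for $h\in\{0,1\}$, $p\in\mathcal P$; - $[V_h^{\pi|^{\mathcal P}}]_{p'}(s,\mathcal P')\le[V_h^{\pi}]_{p'}(s,\mathcal P')$ for $h\in\{0,1\}$, $p'\in\mathcal P'$; - $[V^{\pi'}_{1,H+1}]_p(s,\mathcal P)\le[V_0^{\pi}]_p(s,\mathcal P)$ for $p\in\mathcal P$; - $[V^{\pi}_{0,H-1}]_p(s,\mathcal P)\le[V_1^{\pi}]_p(s,\mathcal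 P)$ for $p\in\mathcal P$. For a history $\tau^t=(s(0),\dots,s(t))$ and $z\in Z_{exec}(s(t))$, let $I(\tau^t,z)$ be the set of all $(s_{z'}(t'),t')$, $t'\le t$, for which there are $z'=z_{t'},z_{t'+1},\dots,z_t=z$ with $z_u\in Z_{exec}(s(u))$ and $z_u\cap z_{u+1}\ne\varnothing$. A *valid extraction method* $\rho$ assigns to $I(\tau^t,z)$ a random group state $(s'_p,\{p\})$, where $p\in\mathcal P$ and $s'_p$ is the restriction of $s'$ to $p$ for some state $(s',\mathcal P)$ of the extended Cutoff Multi-Agent MDP, such that always $z\in Z_{exec}(s'_p)$ and $[s'_p]_z=s_z(t)$. The extracted policy is $\pi_{exec}(a\mid\tau^t)=\prod_{z\in Z_{exec}(s(t))}[\pi_0]_z(a_z\mid\rho(I(\tau^t,z)))$: independently, each group $z\in Z_{exec}(s(t))$ draws $(s'_p,\{p\})$ from $\rho(I(\tau^t,z))$, draws $a_p$ from $[\pi_0]_p(\cdot\mid s'_p)$ and plays $a_z$. Its value is $V^{\pi_{exec}}(s)=\mathbb E\big[\sum_{t\ge 0}\gamma^t r(s(t),a(t))\big]$ with $s(0)=s$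 and transitions $P$. **Theorem.** Let $\pi_{comp}=(\pi_0,\dots,\pi_{c+\eta})$ be a Consistent Performance Policy and $\pi_{exec}$ its extracted policy under a valid extraction method. Assume $c\ge 1$ if $\gamma=0$ (so that $\gamma^{c-1}$ is defined; $0^0=1$). Then for every $s\in\mathcal S$ $$\big|V_0^{\pi_{comp}}(s,Z_{comp}(s))-V^{\pi_{exec}}(s)\big|\le\beta'\,\frac{\gamma^{c-1}}{1-\gamma}\,\tilde r,$$ where $\beta'=\gamma^2+\gamma^{\eta+1}+\dfrac{4+\gamma+5\gamma^2}{1-\gamma}$ in the standard setting and $\beta'=2\gamma^2+\gamma^{\eta+1}+\dfrac{2\gamma(1+\gamma)+4n(1+\gamma^2)}{1-\gamma}$ in the generalized setting. -/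

import Mathlib

open scoped ENNReal BigOperators

universe u v w

noncomputable section

/-! ### Probability mass functions: finite products and expectations -/

theorem tsum_pi_fin_prod : ∀ (n : ℕ) (α : Fin n → Type v) (p : ∀ i, PMF (α i)),
    ∑' f : ∀ i, α i, ∏ i, p i (f i) = 1
  | 0, α, p => by
      rw [tsum_eq_single (fun i => i.elim0)]
      · simp
      · intro f hf
        exact absurd (funext fun i => i.elim0) hf
  | n + 1, α, p => by
      rw [← (Fin.consEquiv α).tsum_eq, ENNReal.tsum_prod']
      have h : ∀ (x : α 0) (f : ∀ i : Fin n, α i.succ),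
          ∏ i, p i (Fin.consEquiv α (x, f) i) = p 0 x * ∏ i : Fin n, p i.succ (f i) := by
        intro x f
        rw [Fin.prod_univ_succ]
        simp [Fin.consEquiv]
      simp_rw [h, ENNReal.tsum_mul_left, tsum_pi_fin_prod n (fun i => α i.succ) fun i => p i.succ]
      simp [PMF.tsum_coe]

theorem tsum_pi_prod {κ : Type u} [Fintype κ] {α : κ → Type v} (p : ∀ k, PMF (α k)) :
    ∑' f : ∀ k, α k, ∏ k, p k (f k) = 1 := by
  classical
  let e := (Fintype.equivFin κ).symm
  rw [← tsum_pi_fin_prod _ (fun i => α (e i)) (fun i => p (e i)),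
    ← (Equiv.piCongrLeft α e).tsum_eq]
  refine tsum_congr fun f => ?_
  rw [← e.prod_comp]
  refine Finset.prod_congr rfl fun i _ => ?_
  rw [Equiv.piCongrLeft_apply_apply]

/-- The law of independent random variables with laws `p k`: `f` has mass `∏ k, p k (f k)`. -/
def piPMF {κ : Type u} [Fintype κ] {α : κ → Type v} (p : ∀ k, PMF (α k)) : PMF (∀ k, α k) :=
  ⟨fun f => ∏ k, p k (f k), tsum_pi_prod p ▸ ENNReal.summable.hasSum⟩

/-- The expectation of `f` under the law `μ`. -/
def PMF.mean {Ω : Type u} (μ : PMF Ω) (f : Ω → ℝ) : ℝ := ∑' x, (μ x).toReal * f x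

/-! ### Agents, group states, distance partitions -/

/-- States of the agents in the group `g`: agent `i` has a position in `X` and an internal
state in `Y i`. -/
abbrev GroupState {n : ℕ} (X : Type u) (Y : Fin n → Type v) (g : Finset (Fin n)) :=
  ∀ i : g, X × Y i

/-- Actions of the agents in the group `g`. -/
abbrev GroupAction {n : ℕ} (A : Fin n → Type w) (g : Finset (Fin n)) := ∀ i : g, A i

abbrev JointState {n : ℕ} (X : Type u) (Y : Fin n → Type v) := ∀ i : Fin n, X × Y i

abbrev JointAction {n : ℕ} (A : Fin n → Type w) := ∀ i : Fin n, A i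

/-- Partitions of the set of all agents. `P ≤ Q` means that `P` is finer than `Q`, and `P ⊓ Q`
consists of the nonempty intersections of a block of `P` and a block of `Q`. -/
abbrev AgentPartition (n : ℕ) := Finpartition (Finset.univ : Finset (Fin n))

/-- The restriction `s_g` of a joint state or action to the group `g`. -/
abbrev restr {n : ℕ} {B : Fin n → Type v} (g : Finset (Fin n)) (s : ∀ i, B i) : ∀ i : g, B i :=
  fun i => s i

/-- The partition of the group `g` in state `x` into classes of agents joined by a chain of agents
of `g`, in which consecutive agents are at distance at most `K`. -/
def distPartition {n : ℕ} {X : Type u} [MetricSpace X] {Y : Fin n → Type v} (K : ℝ)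
    (g : Finset (Fin n)) (x : GroupState X Y g) : Finpartition g := by
  classical
  exact Finpartition.ofSetSetoid
    (Relation.EqvGen.setoid fun i j : Fin n =>
      ∃ (hi : i ∈ g) (hj : j ∈ g), dist (x ⟨i, hi⟩).1 (x ⟨j, hj⟩).1 ≤ K) g

/-- The distance partition of all agents: `D(s)` if `K` is the dependence radius and `Z(s)` if
`K` is the visibility. -/
def jointPartition {n : ℕ} {X : Type u} [MetricSpace X] {Y : Fin n → Type v} (K : ℝ)
    (s : JointState X Y) : AgentPartition n :=
  distPartition K Finset.univ (restr Finset.univ s)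

/-! ### (Generalized) Locally Interdependent Multi-Agent MDPs -/

/-- The data of a Generalized Locally Interdependent Multi-Agent MDP with `n` agents:
`move g i s_g a_g` is the law `P_i(· ∣ s_g, a_g)` of the next state of agent `i` of the dependence
group `g`, and `pairReward i j` is the pairwise reward of agents `i` and `j`. -/
structure LocallyInterdependentMDP (n : ℕ) (X : Type u) [MetricSpace X] (Y : Fin n → Type v)
    (A : Fin n → Type w) where
  move : ∀ (g : Finset (Fin n)) (i : g), GroupState X Y g → GroupAction A g → PMF (X × Y i)
  pairReward : ∀ i j : Fin n, X × Y i → A i → X × Y j → A j → ℝ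
  discount : ℝ
  radius : ℝ
  discount_nonneg : 0 ≤ discount
  discount_lt_one : discount < 1
  radius_pos : 0 < radius
  /-- No agent moves more than a unit distance in one step. -/
  speed_limit : ∀ g i s a s', 1 < dist (s i).1 s'.1 → move g i s a s' = 0
  /-- The quantities `max |r_{ij}|` are finite. -/
  reward_bounded : ∀ i j, BddAbove (Set.range
    fun q : (X × Y i) × A i × (X × Y j) × A j => |pairReward i j q.1 q.2.1 q.2.2.1 q.2.2.2|)

/-- A stationary proper cutoff policy: a family `π_p(a_p ∣ s_p)` over the groups `p`. -/
abbrev CutoffPolicy {n : ℕ} (X : Type u) (Y : Fin n → Type v) (A : Fin n → Type w) :=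
  ∀ p : Finset (Fin n), GroupState X Y p → PMF (GroupAction A p)

/-- A group of agents, together with the states of these agents. -/
abbrev Belief {n : ℕ} (X : Type u) (Y : Fin n → Type v) :=
  Σ p : Finset (Fin n), GroupState X Y p

/-- The joint action with given restrictions to the blocks of a partition. -/
def glue {n : ℕ} {A : Fin n → Type w} (P : AgentPartition n)
    (f : ∀ p : P.parts, GroupAction A p.1) : JointAction A :=
  fun i => f ⟨P.part i, P.part_mem.2 (Finset.mem_univ i)⟩ ⟨i, P.mem_part (Finset.mem_univ i)⟩

/-- The law of the joint action if the blocks of `P` act independently with the given laws. -/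
def blockLaw {n : ℕ} {A : Fin n → Type w} (P : AgentPartition n)
    (μ : ∀ p : P.parts, PMF (GroupAction A p.1)) : PMF (JointAction A) :=
  (piPMF μ).map (glue P)

/-- The law `∏_{p ∈ P} π_p(a_p ∣ s_p)` of the action of a proper cutoff policy at `(s, P)`. -/
def CutoffPolicy.act {n : ℕ} {X : Type u} {Y : Fin n → Type v} {A : Fin n → Type w}
    (π : CutoffPolicy X Y A) (s : JointState X Y) (P : AgentPartition n) : PMF (JointAction A) :=
  blockLaw P fun p => π p.1 (restr p.1 s)

namespace LocallyInterdependentMDP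

variable {n : ℕ} {X : Type u} [MetricSpace X] {Y : Fin n → Type v} {A : Fin n → Type w}

/-- The standard (non-generalized) setting: agent `i` moves with a law `P_i(· ∣ s_i, a_i)`, and
pairs of agents at distance greater than the dependence radius yield no reward. -/
def IsStandard (M : LocallyInterdependentMDP n X Y A) : Prop :=
  (∃ Q : ∀ i : Fin n, X × Y i → A i → PMF (X × Y i),
    ∀ (g : Finset (Fin n)) (i : g) (s : GroupState X Y g) (a : GroupAction A g),
      M.move g i s a = Q i (s i) (a i)) ∧
  ∀ i j si ai sj aj, M.radius < dist si.1 sj.1 → M.pairReward i j si ai sj aj = 0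

/-- `r̃ = ∑_{i,j} max |r_{ij}|`. -/
def rewardBound (M : LocallyInterdependentMDP n X Y A) : ℝ :=
  ∑ i, ∑ j, ⨆ q : (X × Y i) × A i × (X × Y j) × A j,
    |M.pairReward i j q.1 q.2.1 q.2.2.1 q.2.2.2|

/-- `r_p(s_p, a_p) = ∑_{g ∈ D(s_p)} ∑_{i, j ∈ g} r_{ij}(s_i, a_i, s_j, a_j)`. -/
def groupReward (M : LocallyInterdependentMDP n X Y A) (p : Finset (Fin n)) (s : JointState X Y)
    (a : JointAction A) : ℝ :=
  ∑ g ∈ (distPartition M.radius p (restr p s)).parts, ∑ i ∈ g, ∑ j ∈ g,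
    M.pairReward i j (s i) (a i) (s j) (a j)

/-- The reward `r(s, a) = ∑_{g ∈ D(s)} r_g(s_g, a_g)`. -/
def reward (M : LocallyInterdependentMDP n X Y A) (s : JointState X Y) (a : JointAction A) : ℝ :=
  ∑ g ∈ (jointPartition M.radius s).parts, ∑ i ∈ g, ∑ j ∈ g,
    M.pairReward i j (s i) (a i) (s j) (a j)

/-- The law `∏_{g ∈ G} ∏_{i ∈ g} P_i(s'_i ∣ s_g, a_g)` of the next joint state. -/
def stepBy (M : LocallyInterdependentMDP n X Y A) (G : AgentPartition n) (s : JointState X Y)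
    (a : JointAction A) : PMF (JointState X Y) :=
  piPMF fun i => M.move (G.part i) ⟨i, G.mem_part (Finset.mem_univ i)⟩
    (restr (G.part i) s) (restr (G.part i) a)

/-- The transition law `P(s' ∣ s, a) = ∏_{g ∈ D(s)} P_g(s'_g ∣ s_g, a_g)`. -/
def trans (M : LocallyInterdependentMDP n X Y A) (s : JointState X Y) (a : JointAction A) :
    PMF (JointState X Y) :=
  M.stepBy (jointPartition M.radius s) s a

/-! ### The Cutoff Multi-Agent MDP with visibility `V` -/

/-- The states of the Cutoff Multi-Agent MDP: pairs `(s, P)` with `P` finer than `Z(s)`. -/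
def IsCutoffState (V : ℝ) (s : JointState X Y) (P : AgentPartition n) : Prop :=
  P ≤ jointPartition V s

/-- The transition law of the Cutoff Multi-Agent MDP: `(s, P)` moves to `(s', Z(s') ∩ P)` with
probability `∏_{p ∈ P} ∏_{g ∈ D(s_p)} P_g(s'_g ∣ s_g, a_g)`. -/
def cutoffTrans (M : LocallyInterdependentMDP n X Y A) (V : ℝ)
    (σ : JointState X Y × AgentPartition n) (a : JointAction A) :
    PMF (JointState X Y × AgentPartition n) :=
  (M.stepBy (σ.2.bind fun p _ => distPartition M.radius p (restr p σ.1)) σ.1 a).map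
    fun s' => (s', jointPartition V s' ⊓ σ.2)

/-- `r^C_g((s, P), a) = ∑_{p ∈ P ∩ {g}} r_p(s_p, a_p)`; the full reward of the Cutoff Multi-Agent
MDP is the case where `g` is the set of all agents. -/
def cutoffReward (M : LocallyInterdependentMDP n X Y A) (g : Finset (Fin n))
    (σ : JointState X Y × AgentPartition n) (a : JointAction A) : ℝ :=
  ∑ p ∈ (σ.2.parts.image (· ∩ g)).erase ∅, M.groupReward p σ.1 a

/-- The law of the trajectory of `k` steps in the Cutoff Multi-Agent MDP that starts at time `h`
in the state `σ = (s, P)`. At time `t` actions are chosen by `π t`, which acts as if the current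
partition were the one obtained from the initial partition `Q` instead of `P`. -/
def cutoffTraj (M : LocallyInterdependentMDP n X Y A) (V : ℝ) (π : ℕ → CutoffPolicy X Y A) :
    ℕ → ℕ → JointState X Y × AgentPartition n → AgentPartition n →
      PMF (List ((JointState X Y × AgentPartition n) × JointAction A))
  | 0, _, _, _ => PMF.pure []
  | k + 1, h, σ, Q =>
      ((π h).act σ.1 Q).bind fun a =>
        (M.cutoffTrans V σ a).bind fun σ' =>
          (cutoffTraj M V π k (h + 1) σ' (jointPartition V σ'.1 ⊓ Q)).map fun τ => (σ, a) :: τ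

/-- `∑_m γ^m r^C_g(τ_m)` along a finite trajectory `τ`. -/
def discountedReward (M : LocallyInterdependentMDP n X Y A) (g : Finset (Fin n)) :
    List ((JointState X Y × AgentPartition n) × JointAction A) → ℝ
  | [] => 0
  | x :: τ => M.cutoffReward g x.1 x.2 + M.discount * discountedReward M g τ

/-- The value `[V^{π∣^Q}_{h, h'}]_g(s, P)`, where `k = h' - h + 1` is the number of time steps in
`{h, …, h'}`. For `Q = P` this is `[V^π_{h, h'}]_g(s, P)`. -/
def cutoffValueAs (M : LocallyInterdependentMDP n X Y A) (V : ℝ) (π : ℕ → CutoffPolicy X Y A)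
    (h k : ℕ) (g : Finset (Fin n)) (s : JointState X Y) (P Q : AgentPartition n) : ℝ :=
  (M.cutoffTraj V π k h (s, P) Q).mean (M.discountedReward g)

/-- The value `[V^π_{h, h'}]_g(s, P)`, where `k = h' - h + 1`. -/
def cutoffValue (M : LocallyInterdependentMDP n X Y A) (V : ℝ) (π : ℕ → CutoffPolicy X Y A)
    (h k : ℕ) (g : Finset (Fin n)) (s : JointState X Y) (P : AgentPartition n) : ℝ :=
  M.cutoffValueAs V π h k g s P P

/-- The finite sequence `π 0, …, π H` of stationary proper cutoff policies is a Consistent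
Performance Policy of the Cutoff Multi-Agent MDP with visibility `V`. (Values of `π` beyond `H`
play no role. The numbers of time steps in `{0, …, H}`, `{1, …, H}`, `{1, …, H + 1}` and
`{0, …, H - 1}` are `H + 1`, `H`, `H + 1` and `H`.) -/
def IsConsistentPerformance (M : LocallyInterdependentMDP n X Y A) (V : ℝ) (H : ℕ)
    (π : ℕ → CutoffPolicy X Y A) : Prop :=
  ∃ ρ : CutoffPolicy X Y A, ∀ (s : JointState X Y) (P P' : AgentPartition n),
    IsCutoffState V s P → P' ≤ P →
      (∀ h ≤ 1, ∀ p ∈ P.parts,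
        M.cutoffValueAs V π h (H + 1 - h) p s P P' ≤ M.cutoffValue V π h (H + 1 - h) p s P) ∧
      (∀ h ≤ 1, ∀ p' ∈ P'.parts,
        M.cutoffValueAs V π h (H + 1 - h) p' s P' P ≤ M.cutoffValue V π h (H + 1 - h) p' s P') ∧
      (∀ p ∈ P.parts,
        M.cutoffValue V (Function.update π (H + 1) ρ) 1 (H + 1) p s P ≤
          M.cutoffValue V π 0 (H + 1) p s P) ∧
      (∀ p ∈ P.parts, M.cutoffValue V π 0 H p s P ≤ M.cutoffValue V π 1 H p s P)

/-! ### Extraction and execution -/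

/-- The information `I(τ^t, z)` available to the group `z` at time `t`: all `(t', s_{z'}(t'))` such
that there are `z' = z_{t'}, …, z_t = z` with `z_{t''} ∈ Z(s(t''))` in which consecutive groups
intersect. Here `V` is the visibility and `τ = (s(0), …, s(t))`. -/
def information (V : ℝ) {t : ℕ} (τ : Fin (t + 1) → JointState X Y) (z : Finset (Fin n)) :
    Set (ℕ × Belief X Y) :=
  {o | ∃ (t' : Fin (t + 1)) (ζ : Fin (t + 1) → Finset (Fin n)),
    ζ (Fin.last t) = z ∧
    (∀ u, t' ≤ u → ζ u ∈ (jointPartition V (τ u)).parts) ∧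
    (∀ u : Fin t, t' ≤ u.castSucc → (ζ u.castSucc ∩ ζ u.succ).Nonempty) ∧
    o = ((t' : ℕ), ⟨ζ t', restr (ζ t') (τ t')⟩)}

/-- `S_comp`: the group states `(s_p, {p})` with `p ∈ P` for a state `(s, P)` of the Cutoff
Multi-Agent MDP with visibility `V`. -/
def compStates (V : ℝ) : Set (Belief X Y) :=
  {b | ∃ (s : JointState X Y) (P : AgentPartition n), IsCutoffState V s P ∧ b.1 ∈ P.parts ∧
    restr b.1 s = b.2}

end LocallyInterdependentMDP

open LocallyInterdependentMDP in
/-- A valid extraction method, from the Cutoff Multi-Agent MDP with visibility `Vcomp` to execution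
with visibility `Vexec`: `rho I` is the law of the belief of a group with information `I`, and
every possible belief `(s_p, {p})` of a group `z` is in `S_comp`, has `z` as one of its visibility
groups, and agrees with the true state of `z`. -/
structure ValidExtraction {n : ℕ} (X : Type u) [MetricSpace X] (Y : Fin n → Type v)
    (Vexec Vcomp : ℝ) where
  rho : Set (ℕ × Belief X Y) → PMF (Belief X Y)
  mem_compStates : ∀ {t : ℕ} (τ : Fin (t + 1) → JointState X Y) (z : Finset (Fin n)),
    z ∈ (jointPartition Vexec (τ (Fin.last t))).parts →
      ∀ b ∈ (rho (information Vexec τ z)).support, b ∈ compStates Vcomp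
  mem_parts : ∀ {t : ℕ} (τ : Fin (t + 1) → JointState X Y) (z : Finset (Fin n)),
    z ∈ (jointPartition Vexec (τ (Fin.last t))).parts →
      ∀ b ∈ (rho (information Vexec τ z)).support, z ∈ (distPartition Vexec b.1 b.2).parts
  agrees : ∀ {t : ℕ} (τ : Fin (t + 1) → JointState X Y) (z : Finset (Fin n)),
    z ∈ (jointPartition Vexec (τ (Fin.last t))).parts →
      ∀ b ∈ (rho (information Vexec τ z)).support,
        ∀ i ∈ z, ∀ hi : i ∈ b.1, b.2 ⟨i, hi⟩ = τ (Fin.last t) i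

namespace LocallyInterdependentMDP

variable {n : ℕ} {X : Type u} [MetricSpace X] {Y : Fin n → Type v} {A : Fin n → Type w}

/-- The extracted policy
`π_exec(a ∣ s(t)) = ∏_{z ∈ Z_exec(s(t))} [π_0]_z(a_z ∣ ρ(I(τ^t, z)))` after the history
`τ = (s(0), …, s(t))`: each group `z` draws a belief `(s_p, {p})`, draws `a_p` from `π_0` at this
belief, and plays the part `a_z`. -/
def execAct {Vexec Vcomp : ℝ} (ρ : ValidExtraction X Y Vexec Vcomp) (π₀ : CutoffPolicy X Y A)
    {t : ℕ} (τ : Fin (t + 1) → JointState X Y) : PMF (JointAction A) :=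
  blockLaw (jointPartition Vexec (τ (Fin.last t))) fun z =>
    (ρ.rho (information Vexec τ z.1)).bindOnSupport fun b hb =>
      (π₀ b.1 b.2).map fun a i =>
        a ⟨i.1, (distPartition Vexec b.1 b.2).le (ρ.mem_parts τ z.1 z.2 b hb) i.2⟩

/-- The law of the history `(s(0), …, s(t))` under the extracted policy, started at `s`. -/
def execHistory (M : LocallyInterdependentMDP n X Y A) {Vexec Vcomp : ℝ}
    (ρ : ValidExtraction X Y Vexec Vcomp) (π₀ : CutoffPolicy X Y A) (s : JointState X Y) :
    (t : ℕ) → PMF (Fin (t + 1) → JointState X Y)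
  | 0 => PMF.pure fun _ => s
  | t + 1 =>
      (execHistory M ρ π₀ s t).bind fun τ => (execAct ρ π₀ τ).bind fun a =>
        (M.trans (τ (Fin.last t)) a).map fun s' =>
          Fin.snoc (α := fun _ : Fin (t + 2) => JointState X Y) τ s'

/-- The expected reward `E[r(s(t), a(t))]` at time `t` under the extracted policy. -/
def execReward (M : LocallyInterdependentMDP n X Y A) {Vexec Vcomp : ℝ}
    (ρ : ValidExtraction X Y Vexec Vcomp) (π₀ : CutoffPolicy X Y A) (s : JointState X Y)
    (t : ℕ) : ℝ :=
  (M.execHistory ρ π₀ s t).mean fun τ =>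
    (execAct ρ π₀ τ).mean fun a => M.reward (τ (Fin.last t)) a

/-- The value `V^{π_exec}(s) = ∑_t γ^t E[r(s(t), a(t))]` of the extracted policy. As rewards are
bounded, this is the expected total discounted reward. -/
def execValue (M : LocallyInterdependentMDP n X Y A) {Vexec Vcomp : ℝ}
    (ρ : ValidExtraction X Y Vexec Vcomp) (π₀ : CutoffPolicy X Y A) (s : JointState X Y) : ℝ :=
  ∑' t : ℕ, M.discount ^ t * M.execReward ρ π₀ s t

/-- `c = ⌊(V - R) / 2⌋`. -/
def cutoffTime (M : LocallyInterdependentMDP n X Y A) (V : ℝ) : ℕ := ⌊(V - M.radius) / 2⌋₊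

end LocallyInterdependentMDP

end

/-! Write γ for the discount, R for the dependence radius and w(g) for the total weight of the pairs
in g.

Speed limit: agents move at most 1 per step, so groups farther apart than R + 2(c - 1) neither
influence nor reward one another for c steps. Tearing them apart in the partition, with the policy
inputs kept, costs only a tail of order γ^c / (1 - γ) (`abs_cutoffValueAs_sub_le`,
`abs_cutoffValueAs_sub_le_of_isStandard`). Consistent performance turns this into a bound for the
policy's own values, although it acts differently on the torn partition (`abs_planValue_sub_le_cut`,
`planValue_sub_mem_Icc_cut`). It also keeps the values from times 0 and 1 within γ^H w(g) of each
other (`abs_planValue_one_sub_zero_le`).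

Locality: the value of a block q feels the other agents only through visibility chains that leave q
and return, since these decide when q splits. Cutting q along its internal chains instead costs
little, so the value is nearly a function of the states of q alone (`planValue_le_add_loc`). The
supremum over the other agents, `localValue`, is the common currency in which different beliefs are
compared.

Execution: let Φ(t), the `potential`, be the expected sum of the values that the visibility groups
attach to their beliefs. For one step a group acts and moves exactly as in its belief, so its belief
value is the expected reward plus γ times a value from time 1. Split each old group z after the step
into the classes of chains inside z. These parts are more than Vexec - 2 away from one another and
from all other agents, both in truth and in the belief, and Vexec - 2 ≥ R + 2(c - 1). Hence the
continuations of the old beliefs and the new potential are both close to the sum of the local values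
of these parts (`mean_groupStep_mem_Icc`, `potential_mem_Icc`). So E[r + γ Φ(t+1)] ≈ Φ(t);
telescoping (`abs_tsum_discounted_sub_le`) compares Φ(0) with the value of the extracted policy, and
`abs_planValue_sub_meanPotential_zero_le` compares Φ(0) with the plan.

The argument uses few properties of the errors. They are collected in `ErrorBudget`, with one
instance for each of the two settings. -/

noncomputable section

/-! ### Expectations of bounded functions -/

/-- Real functions that are bounded in absolute value. -/
def BddFun {Ω : Type*} (f : Ω → ℝ) : Prop := ∃ C, ∀ x, |f x| ≤ C

namespace BddFun

variable {Ω : Type*} {Ω' : Type*} {f g : Ω → ℝ}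

theorem const (r : ℝ) : BddFun fun _ : Ω => r := ⟨|r|, fun _ => le_rfl⟩

theorem add (hf : BddFun f) (hg : BddFun g) : BddFun fun x => f x + g x := by
  obtain ⟨C, hC⟩ := hf
  obtain ⟨D, hD⟩ := hg
  exact ⟨C + D, fun x => (abs_add_le _ _).trans (add_le_add (hC x) (hD x))⟩

theorem const_mul (r : ℝ) (hf : BddFun f) : BddFun fun x => r * f x := by
  obtain ⟨C, hC⟩ := hf
  exact ⟨|r| * C, fun x => by rw [abs_mul]; exact mul_le_mul_of_nonneg_left (hC x) (abs_nonneg r)⟩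

theorem sum {ι : Type*} (s : Finset ι) {F : ι → Ω → ℝ} (h : ∀ i ∈ s, BddFun (F i)) :
    BddFun fun x => ∑ i ∈ s, F i x := by
  classical
  induction s using Finset.induction_on with
  | empty => simpa using const 0
  | insert i s hi ih =>
    simp_rw [Finset.sum_insert hi]
    exact (h i (by simp)).add (ih fun j hj => h j (by simp [hj]))

theorem comp (hf : BddFun f) (φ : Ω' → Ω) : BddFun fun x => f (φ x) := by
  obtain ⟨C, hC⟩ := hf
  exact ⟨C, fun x => hC _⟩

end BddFun

namespace PMF

variable {Ω : Type*} {Ω' : Type*} {f g : Ω → ℝ}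

theorem summable_toReal (μ : PMF Ω) : Summable fun x => (μ x).toReal :=
  ENNReal.summable_toReal μ.tsum_coe_ne_top

theorem tsum_toReal (μ : PMF Ω) : ∑' x, (μ x).toReal = 1 := by
  rw [← ENNReal.tsum_toReal_eq fun x => μ.apply_ne_top x, μ.tsum_coe, ENNReal.toReal_one]

theorem summable_mean (μ : PMF Ω) (hf : BddFun f) : Summable fun x => (μ x).toReal * f x := by
  obtain ⟨C, hC⟩ := hf
  refine Summable.of_norm_bounded (μ.summable_toReal.mul_right C) fun x => ?_
  rw [Real.norm_eq_abs, abs_mul, abs_of_nonneg ENNReal.toReal_nonneg]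
  exact mul_le_mul_of_nonneg_left (hC x) ENNReal.toReal_nonneg

theorem mean_const (μ : PMF Ω) (r : ℝ) : μ.mean (fun _ => r) = r := by
  rw [PMF.mean, tsum_mul_right, tsum_toReal, one_mul]

theorem mean_add (μ : PMF Ω) (hf : BddFun f) (hg : BddFun g) :
    μ.mean (fun x => f x + g x) = μ.mean f + μ.mean g := by
  simp_rw [PMF.mean, mul_add]
  exact (μ.summable_mean hf).tsum_add (μ.summable_mean hg)

theorem mean_const_mul (μ : PMF Ω) (r : ℝ) (f : Ω → ℝ) :
    μ.mean (fun x => r * f x) = r * μ.mean f := by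
  simp_rw [PMF.mean, mul_left_comm _ r]
  exact tsum_mul_left

theorem mean_sum (μ : PMF Ω) {ι : Type*} (s : Finset ι) {F : ι → Ω → ℝ}
    (h : ∀ i ∈ s, BddFun (F i)) :
    μ.mean (fun x => ∑ i ∈ s, F i x) = ∑ i ∈ s, μ.mean (F i) := by
  simp_rw [PMF.mean, Finset.mul_sum]
  exact Summable.tsum_finsetSum fun i hi => μ.summable_mean (h i hi)

theorem mean_mono (μ : PMF Ω) (hf : BddFun f) (hg : BddFun g)
    (h : ∀ x ∈ μ.support, f x ≤ g x) : μ.mean f ≤ μ.mean g := by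
  refine (μ.summable_mean hf).tsum_le_tsum (fun x => ?_) (μ.summable_mean hg)
  by_cases hx : x ∈ μ.support
  · exact mul_le_mul_of_nonneg_left (h x hx) ENNReal.toReal_nonneg
  · rw [(μ.apply_eq_zero_iff x).2 hx]
    simp

theorem mean_congr (μ : PMF Ω) (h : ∀ x ∈ μ.support, f x = g x) : μ.mean f = μ.mean g := by
  refine tsum_congr fun x => ?_
  by_cases hx : x ∈ μ.support
  · rw [h x hx]
  · rw [(μ.apply_eq_zero_iff x).2 hx]
    simp

theorem mean_le (μ : PMF Ω) {C : ℝ} (hf : BddFun f) (h : ∀ x ∈ μ.support, f x ≤ C) :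
    μ.mean f ≤ C :=
  (μ.mean_mono hf (.const C) h).trans_eq (μ.mean_const C)

theorem le_mean (μ : PMF Ω) {C : ℝ} (hf : BddFun f) (h : ∀ x ∈ μ.support, C ≤ f x) :
    C ≤ μ.mean f :=
  (μ.mean_const C).symm.trans_le (μ.mean_mono (.const C) hf h)

theorem abs_mean_le (μ : PMF Ω) {C : ℝ} (h : ∀ x, |f x| ≤ C) : |μ.mean f| ≤ C :=
  abs_le.2 ⟨μ.le_mean ⟨C, h⟩ fun x _ => (abs_le.1 (h x)).1,
    μ.mean_le ⟨C, h⟩ fun x _ => (abs_le.1 (h x)).2⟩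

theorem abs_mean_sub_mean_le (μ : PMF Ω) {C : ℝ} (hf : BddFun f) (hg : BddFun g)
    (h : ∀ x ∈ μ.support, |f x - g x| ≤ C) : |μ.mean f - μ.mean g| ≤ C := by
  have h1 := μ.mean_mono hf (hg.add (.const C)) fun x hx => by
    linarith [(abs_le.1 (h x hx)).2]
  have h2 := μ.mean_mono hg (hf.add (.const C)) fun x hx => by
    linarith [(abs_le.1 (h x hx)).1]
  rw [μ.mean_add hg (.const C), mean_const] at h1
  rw [μ.mean_add hf (.const C), mean_const] at h2
  exact abs_le.2 ⟨by linarith, by linarith⟩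

theorem bddFun_mean {f : Ω → Ω' → ℝ} (μ : Ω → PMF Ω') (h : BddFun fun x : Ω × Ω' => f x.1 x.2) :
    BddFun fun x => (μ x).mean (f x) := by
  obtain ⟨C, hC⟩ := h
  exact ⟨C, fun x => (μ x).abs_mean_le fun y => hC (x, y)⟩

theorem mean_pure (a : Ω) (f : Ω → ℝ) : (PMF.pure a).mean f = f a := by
  rw [PMF.mean, tsum_eq_single a]
  · simp
  · intro b hb
    simp [PMF.pure_apply, hb]

theorem mean_bind (μ : PMF Ω) (ν : Ω → PMF Ω') {f : Ω' → ℝ} (hf : BddFun f) :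
    (μ.bind ν).mean f = μ.mean fun x => (ν x).mean f := by
  obtain ⟨C, hC⟩ := hf
  have hs : Summable fun p : Ω × Ω' => (μ p.1).toReal * (ν p.1 p.2).toReal := by
    have h := ENNReal.summable_toReal (f := fun p : Ω × Ω' => μ p.1 * ν p.1 p.2) (by
      rw [ENNReal.tsum_prod']
      simp [ENNReal.tsum_mul_left, PMF.tsum_coe])
    simpa [ENNReal.toReal_mul] using h
  have hs' : Summable fun p : Ω × Ω' => (μ p.1).toReal * (ν p.1 p.2).toReal * f p.2 := by
    refine Summable.of_norm_bounded (hs.mul_right C) fun p => ?_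
    have h0 : 0 ≤ (μ p.1).toReal * (ν p.1 p.2).toReal := by positivity
    rw [Real.norm_eq_abs, abs_mul, abs_of_nonneg h0]
    exact mul_le_mul_of_nonneg_left (hC _) h0
  calc (μ.bind ν).mean f = ∑' y, ∑' x, (μ x).toReal * (ν x y).toReal * f y := by
        refine tsum_congr fun y => ?_
        rw [tsum_mul_right, PMF.bind_apply, ENNReal.tsum_toReal_eq fun x =>
          ENNReal.mul_ne_top (μ.apply_ne_top x) ((ν x).apply_ne_top y)]
        simp only [ENNReal.toReal_mul]
    _ = ∑' x, ∑' y, (μ x).toReal * (ν x y).toReal * f y :=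
        Summable.tsum_comm (f := fun x y => (μ x).toReal * (ν x y).toReal * f y) hs'
    _ = μ.mean fun x => (ν x).mean f := by
        refine tsum_congr fun x => ?_
        simp_rw [mul_assoc]
        exact tsum_mul_left

theorem mean_map (μ : PMF Ω) (φ : Ω → Ω') {f : Ω' → ℝ} (hf : BddFun f) :
    (μ.map φ).mean f = μ.mean fun x => f (φ x) := by
  rw [PMF.map, mean_bind _ _ hf]
  simp [mean_pure]

/-- If two laws have a common image, then a pointwise bound over the fibers bounds the
expectations. -/
theorem mean_le_of_map_eq {Ω₁ Ω₂ Z : Type*} (μ : PMF Ω₁) (ν : PMF Ω₂) (r₁ : Ω₁ → Z) (r₂ : Ω₂ → Z)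
    (hr : μ.map r₁ = ν.map r₂) {f : Ω₁ → ℝ} {g : Ω₂ → ℝ} (hf : BddFun f) (hg : BddFun g)
    (h : ∀ x ∈ μ.support, ∀ y ∈ ν.support, r₁ x = r₂ y → f x ≤ g y) : μ.mean f ≤ ν.mean g := by
  classical
  obtain ⟨C, hC⟩ := hf
  have hC0 : 0 ≤ C := by
    obtain ⟨x, -⟩ := μ.support_nonempty
    exact (abs_nonneg _).trans (hC x)
  -- The best value of `f` on each fiber, within the support. It is a function on the common image,
  -- so both laws give it the same mean. Fibers that miss the support get the default value 0, which
  -- still satisfies the bound because `0 ≤ C`.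
  let F : Z → ℝ := fun z => ⨆ x : {x : Ω₁ // x ∈ μ.support ∧ r₁ x = z}, f x.1
  have hb : ∀ z, BddAbove (Set.range fun x : {x : Ω₁ // x ∈ μ.support ∧ r₁ x = z} => f x.1) :=
    fun z => ⟨C, by rintro _ ⟨x, rfl⟩; exact (abs_le.1 (hC _)).2⟩
  have hF : BddFun F := by
    refine ⟨C, fun z => ?_⟩
    rcases isEmpty_or_nonempty {x : Ω₁ // x ∈ μ.support ∧ r₁ x = z} with h0 | h0
    · simpa [F] using hC0
    · refine abs_le.2 ⟨?_, ciSup_le fun x => (abs_le.1 (hC _)).2⟩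
      obtain ⟨x⟩ := h0
      exact (abs_le.1 (hC x.1)).1.trans (le_ciSup (hb z) x)
  calc μ.mean f ≤ μ.mean fun x => F (r₁ x) :=
        μ.mean_mono ⟨C, hC⟩ (hF.comp r₁) fun x hx => le_ciSup (hb (r₁ x)) ⟨x, hx, rfl⟩
    _ = ν.mean fun y => F (r₂ y) := by rw [← mean_map _ _ hF, hr, mean_map _ _ hF]
    _ ≤ ν.mean g := by
        refine ν.mean_mono (hF.comp r₂) hg fun y hy => ?_
        have hy' : r₂ y ∈ (μ.map r₁).support := by
          rw [hr, PMF.mem_support_map_iff]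
          exact ⟨y, hy, rfl⟩
        obtain ⟨x, hx, hxy⟩ := (PMF.mem_support_map_iff _ _ _).1 hy'
        have : Nonempty {x : Ω₁ // x ∈ μ.support ∧ r₁ x = r₂ y} := ⟨⟨x, hx, hxy⟩⟩
        exact ciSup_le fun x => h x.1 x.2.1 y hy x.2.2

/-- Outside the support the kernel is irrelevant and may be copied from any point of the support;
this makes the lemmas on `bind` available for the extracted policy. -/
theorem exists_bindOnSupport_eq_bind (μ : PMF Ω) (ν : ∀ x ∈ μ.support, PMF Ω') :
    ∃ ν' : Ω → PMF Ω', (∀ x hx, ν' x = ν x hx) ∧ μ.bindOnSupport ν = μ.bind ν' := by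
  classical
  obtain ⟨x₀, h₀⟩ := μ.support_nonempty
  refine ⟨fun x => if h : x ∈ μ.support then ν x h else ν x₀ h₀, fun x hx => dif_pos hx, ?_⟩
  ext y
  rw [PMF.bindOnSupport_apply, PMF.bind_apply]
  refine tsum_congr fun x => ?_
  by_cases h : μ x = 0
  · simp [h]
  · rw [dif_neg h, dif_pos ((μ.mem_support_iff x).2 h)]

end PMF

/-! ### Marginals of finite products -/

theorem piPMF_apply {κ : Type*} [Fintype κ] {α : κ → Type*} (p : ∀ k, PMF (α k)) (f : ∀ k, α k) :
    piPMF p f = ∏ k, p k (f k) := rfl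

theorem mem_support_piPMF {κ : Type*} [Fintype κ] {α : κ → Type*} (p : ∀ k, PMF (α k))
    (f : ∀ k, α k) : f ∈ (piPMF p).support ↔ ∀ k, f k ∈ (p k).support := by
  simp only [PMF.mem_support_iff, piPMF_apply, ne_eq, Finset.prod_eq_zero_iff, Finset.mem_univ,
    true_and, not_exists]

theorem piPMF_map_subtype {κ : Type*} [Fintype κ] {α : κ → Type*} (p : ∀ k, PMF (α k))
    (S : κ → Prop) [DecidablePred S] :
    (piPMF p).map (fun f (k : {k // S k}) => f k) = piPMF fun k : {k // S k} => p k := by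
  classical
  ext b
  rw [PMF.map_apply, ← (Equiv.piEquivPiSubtypeProd S α).symm.tsum_eq, ENNReal.tsum_prod',
    tsum_eq_single b]
  · refine (tsum_congr (g := fun c => (∏ k : {k // S k}, p k (b k)) *
      ∏ k : {k // ¬ S k}, p k (c k)) fun c => ?_).trans ?_
    · rw [if_pos, piPMF_apply, ← Fintype.prod_subtype_mul_prod_subtype S]
      · congr 1 <;> refine Finset.prod_congr rfl fun k _ => ?_ <;>
          simp [Equiv.piEquivPiSubtypeProd, k.2]
      · ext k
        simp [Equiv.piEquivPiSubtypeProd, k.2]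
    · rw [ENNReal.tsum_mul_left, tsum_pi_prod fun k : {k // ¬ S k} => p k, mul_one, piPMF_apply]
  · intro b' hb'
    refine ENNReal.tsum_eq_zero.2 fun c => if_neg fun h => hb' ?_
    rw [h]
    ext k
    simp [Equiv.piEquivPiSubtypeProd, k.2]

theorem piPMF_map_eval {κ : Type*} [Fintype κ] {α : κ → Type*} (p : ∀ k, PMF (α k)) (k : κ) :
    (piPMF p).map (fun f => f k) = p k := by
  classical
  obtain ⟨S, hS⟩ : ∃ S : κ → Prop, ∀ j, S j ↔ j = k := ⟨(· = k), fun _ => Iff.rfl⟩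
  have h := congrArg (PMF.map fun f : ∀ j : {j // S j}, α j => f ⟨k, (hS k).2 rfl⟩)
    (piPMF_map_subtype p S)
  rw [PMF.map_comp] at h
  refine h.trans ?_
  ext b
  -- The index type has the single element `k`, so exactly one family takes the value `b` there; it
  -- is written down by transport along `j = k`.
  rw [PMF.map_apply, tsum_eq_single fun j : {j // S j} =>
    ((hS j.1).1 j.2).symm.rec (motive := fun i _ => α i) b]
  · rw [if_pos rfl, piPMF_apply, Finset.prod_eq_single ⟨k, (hS k).2 rfl⟩]
    · exact fun j _ hj => absurd (Subtype.ext ((hS j.1).1 j.2)) hj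
    · exact fun h => absurd (Finset.mem_univ _) h
  · intro f hf
    refine if_neg fun hb => hf ?_
    ext ⟨j, hj⟩
    obtain rfl := (hS j).1 hj
    exact hb.symm

/-! ### Partitions of the agents -/

namespace AgentPartition

variable {n : ℕ} {P Q R : AgentPartition n} {i j k : Fin n}

theorem mem_part_self (P : AgentPartition n) (i : Fin n) : i ∈ P.part i :=
  P.mem_part (Finset.mem_univ i)

theorem part_mem (P : AgentPartition n) (i : Fin n) : P.part i ∈ P.parts :=
  Finpartition.part_mem P |>.2 (Finset.mem_univ i)

theorem part_eq (h : j ∈ P.part i) : P.part j = P.part i :=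
  P.part_eq_of_mem (part_mem P i) h

theorem mem_part_comm : j ∈ P.part i ↔ i ∈ P.part j :=
  ⟨fun h => part_eq h ▸ mem_part_self P i, fun h => part_eq h ▸ mem_part_self P j⟩

theorem exists_part_eq {p : Finset (Fin n)} (hp : p ∈ P.parts) : ∃ i ∈ p, P.part i = p := by
  obtain ⟨i, hi⟩ := P.nonempty_of_mem_parts hp
  exact ⟨i, hi, P.part_eq_of_mem hp hi⟩

theorem le_iff : P ≤ Q ↔ ∀ i, P.part i ⊆ Q.part i := by
  constructor
  · intro h i
    obtain ⟨q, hq, hpq⟩ := h (part_mem P i)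
    rw [Q.part_eq_of_mem hq (hpq (mem_part_self P i))]
    exact hpq
  · intro h p hp
    obtain ⟨i, -, rfl⟩ := exists_part_eq hp
    exact ⟨Q.part i, part_mem Q i, h i⟩

theorem ext_part (h : ∀ i, P.part i = Q.part i) : P = Q :=
  le_antisymm (le_iff.2 fun i => (h i).subset) (le_iff.2 fun i => (h i).superset)

theorem part_inf (P Q : AgentPartition n) (i : Fin n) : (P ⊓ Q).part i = P.part i ∩ Q.part i := by
  refine (P ⊓ Q).part_eq_of_mem ?_ (Finset.mem_inter.2 ⟨mem_part_self P i, mem_part_self Q i⟩)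
  rw [Finpartition.parts_inf, Finset.mem_erase, Finset.mem_image]
  refine ⟨Finset.ne_empty_of_mem (a := i)
    (Finset.mem_inter.2 ⟨mem_part_self P i, mem_part_self Q i⟩), (P.part i, Q.part i), ?_, rfl⟩
  exact Finset.mem_product.2 ⟨part_mem P i, part_mem Q i⟩

/-- A sum over the blocks of a finer partition, grouped by the blocks of the coarser one. -/
theorem sum_parts_of_le (h : P ≤ Q) (f : Finset (Fin n) → ℝ) :
    ∑ q ∈ Q.parts, ∑ p ∈ P.parts with p ⊆ q, f p = ∑ p ∈ P.parts, f p := by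
  rw [← Finset.sum_biUnion]
  · refine Finset.sum_congr ?_ fun _ _ => rfl
    ext p
    simp only [Finset.mem_biUnion, Finset.mem_filter]
    exact ⟨fun ⟨_, _, hp, _⟩ => hp, fun hp => by
      obtain ⟨q, hq, hpq⟩ := h hp
      exact ⟨q, hq, hp, hpq⟩⟩
  · intro q hq q' hq' hne
    refine Finset.disjoint_left.2 fun p hp hp' => hne ?_
    simp only [Finset.mem_filter] at hp hp'
    obtain ⟨i, hi⟩ := P.nonempty_of_mem_parts hp.1
    exact Q.eq_of_mem_parts hq hq' (hp.2 hi) (hp'.2 hi)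

/-- The partition that coincides with `S` on `z` and does not split the complement of `z`. -/
def splitAt (S : AgentPartition n) (z : Finset (Fin n)) : AgentPartition n := by
  classical
  exact Finpartition.ofSetoid
    { r := fun i j => (i ∈ z ∧ j ∈ z ∧ S.part i = S.part j) ∨ (i ∉ z ∧ j ∉ z)
      iseqv := ⟨fun i => by tauto, fun h => by
        rcases h with ⟨h1, h2, h3⟩ | h
        · exact Or.inl ⟨h2, h1, h3.symm⟩
        · exact Or.inr h.symm, fun h h' => by
        rcases h with ⟨h1, h2, h3⟩ | h <;> rcases h' with ⟨h1', h2', h3'⟩ | h'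
        · exact Or.inl ⟨h1, h2', h3.trans h3'⟩
        · exact absurd h2 h'.1
        · exact absurd h1' h.2
        · exact Or.inr ⟨h.1, h'.2⟩⟩ }

theorem mem_part_splitAt {S : AgentPartition n} {z : Finset (Fin n)} :
    j ∈ (splitAt S z).part i ↔ (i ∈ z ∧ j ∈ z ∧ S.part i = S.part j) ∨ (i ∉ z ∧ j ∉ z) := by
  classical
  exact Finpartition.mem_part_ofSetoid_iff_rel

end AgentPartition

theorem Finpartition.sum_sum_parts {α : Type*} [DecidableEq α] {s : Finset α} (P : Finpartition s)
    (f : α → α → ℝ) :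
    ∑ g ∈ P.parts, ∑ i ∈ g, ∑ j ∈ g, f i j = ∑ i ∈ s, ∑ j ∈ P.part i, f i j := by
  have h := Finset.sum_biUnion (f := fun i => ∑ j ∈ P.part i, f i j) P.disjoint
  rw [P.biUnion_parts] at h
  rw [h]
  refine Finset.sum_congr rfl fun g hg => Finset.sum_congr rfl fun i hi => ?_
  rw [P.part_eq_of_mem hg hi]

/-! ### Chains of agents -/

section Chains

open AgentPartition

variable {n : ℕ} {X : Type u} [MetricSpace X] {Y : Fin n → Type v}

/-- The agents `i` and `j` are joined by a chain of agents of `g` with steps at most `K`. -/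
def Conn (K : ℝ) (g : Finset (Fin n)) (s : JointState X Y) : Fin n → Fin n → Prop :=
  Relation.EqvGen fun i j => i ∈ g ∧ j ∈ g ∧ dist (s i).1 (s j).1 ≤ K

variable {K L : ℝ} {g h : Finset (Fin n)} {s s' : JointState X Y} {i j k : Fin n}

theorem Conn.mono (hK : K ≤ L) (hg : g ⊆ h) (c : Conn K g s i j) : Conn L h s i j :=
  Relation.EqvGen.mono (fun _ _ ⟨h1, h2, h3⟩ => ⟨hg h1, hg h2, h3.trans hK⟩) _ _ c

theorem Conn.congr (hs : ∀ i ∈ g, s i = s' i) (c : Conn K g s i j) : Conn K g s' i j :=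
  Relation.EqvGen.mono (fun a b ⟨h1, h2, h3⟩ => ⟨h1, h2, by rwa [← hs a h1, ← hs b h2]⟩) _ _ c

theorem conn_of_dist_le (hi : i ∈ g) (hj : j ∈ g) (h : dist (s i).1 (s j).1 ≤ K) :
    Conn K g s i j := Relation.EqvGen.rel _ _ ⟨hi, hj, h⟩

theorem conn_congr (hs : ∀ i ∈ g, s i = s' i) : Conn K g s i j ↔ Conn K g s' i j :=
  ⟨.congr hs, .congr fun i hi => (hs i hi).symm⟩

/-- Chains cannot leave a set that is closed under steps. -/
theorem Conn.of_closed (hcl : ∀ a ∈ h, ∀ b ∈ g, dist (s a).1 (s b).1 ≤ K → b ∈ h)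
    (c : Conn K g s i j) : (i ∈ h ↔ j ∈ h) ∧ (i ∈ h → Conn K h s i j) := by
  induction c with
  | rel a b hab =>
    obtain ⟨ha, hb, hd⟩ := hab
    exact ⟨⟨fun h' => hcl a h' b hb hd, fun h' => hcl b h' a ha (by rwa [dist_comm])⟩,
      fun h' => conn_of_dist_le h' (hcl a h' b hb hd) hd⟩
  | refl a => exact ⟨Iff.rfl, fun _ => Relation.EqvGen.refl a⟩
  | symm a b _ ih => exact ⟨ih.1.symm, fun h' => (ih.2 (ih.1.2 h')).symm⟩
  | trans a b c _ _ ih1 ih2 =>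
    exact ⟨ih1.1.trans ih2.1, fun h' => (ih1.2 h').trans _ _ _ (ih2.2 (ih1.1.1 h'))⟩

theorem mem_part_distPartition : j ∈ (distPartition K g (restr g s)).part i ↔
    i ∈ g ∧ j ∈ g ∧ Conn K g s i j := by
  classical
  rw [distPartition, Finpartition.mem_part_ofSetSetoid_iff_rel]
  refine and_congr_right fun _ => and_congr_right fun _ => ?_
  have : (fun a b : Fin n => ∃ (hi : a ∈ g) (hj : b ∈ g),
      dist (restr g s ⟨a, hi⟩).1 (restr g s ⟨b, hj⟩).1 ≤ K) =
      fun a b => a ∈ g ∧ b ∈ g ∧ dist (s a).1 (s b).1 ≤ K :=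
    funext₂ fun a b => propext ⟨fun ⟨ha, hb, h⟩ => ⟨ha, hb, h⟩, fun ⟨ha, hb, h⟩ => ⟨ha, hb, h⟩⟩
  change Relation.EqvGen _ i j ↔ _
  rw [this]
  rfl

theorem mem_part_jointPartition : j ∈ (jointPartition K s).part i ↔ Conn K Finset.univ s i j := by
  rw [jointPartition, mem_part_distPartition]
  simp

/-- The partition into the classes of agents joined by chains within a block of `P`. -/
def refineBy (K : ℝ) (P : AgentPartition n) (s : JointState X Y) : AgentPartition n :=
  P.bind fun p _ => distPartition K p (restr p s)

theorem part_refineBy (P : AgentPartition n) :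
    (refineBy K P s).part i = (distPartition K (P.part i) (restr (P.part i) s)).part i := by
  refine (refineBy K P s).part_eq_of_mem ?_ (Finpartition.mem_part _ (mem_part_self P i))
  rw [refineBy, Finpartition.mem_bind]
  exact ⟨P.part i, part_mem P i, Finpartition.part_mem _ |>.2 (mem_part_self P i)⟩

theorem mem_part_refineBy {P : AgentPartition n} : j ∈ (refineBy K P s).part i ↔
    j ∈ P.part i ∧ Conn K (P.part i) s i j := by
  rw [part_refineBy, mem_part_distPartition]
  simp

theorem refineBy_le (P : AgentPartition n) : refineBy K P s ≤ P :=
  le_iff.2 fun _ _ h => (mem_part_refineBy.1 h).1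

theorem refineBy_le_jointPartition (hK : K ≤ L) (P : AgentPartition n) :
    refineBy K P s ≤ jointPartition L s :=
  le_iff.2 fun _ _ h => mem_part_jointPartition.2
    ((mem_part_refineBy.1 h).2.mono hK (Finset.subset_univ _))

theorem jointPartition_mono (hK : K ≤ L) : jointPartition K s ≤ jointPartition L s :=
  le_iff.2 fun _ _ h => mem_part_jointPartition.2
    ((mem_part_jointPartition.1 h).mono hK (Finset.Subset.refl _))

theorem lt_dist_of_notMem_refineBy {P : AgentPartition n} (hj : j ∈ P.part i)
    (h : j ∉ (refineBy K P s).part i) : K < dist (s i).1 (s j).1 := by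
  by_contra! hd
  exact h (mem_part_refineBy.2 ⟨hj, conn_of_dist_le (mem_part_self P i) hj hd⟩)

theorem lt_dist_of_notMem_jointPartition (h : j ∉ (jointPartition K s).part i) :
    K < dist (s i).1 (s j).1 := by
  by_contra! hd
  exact h (mem_part_jointPartition.2
    (conn_of_dist_le (Finset.mem_univ _) (Finset.mem_univ _) hd))

/-- The part of `refineBy` is local: it depends only on the block and its states. -/
theorem part_refineBy_congr {P P' : AgentPartition n} (hP : P.part i = P'.part i)
    (hs : ∀ j ∈ P.part i, s j = s' j) : (refineBy K P s).part i = (refineBy K P' s').part i := by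
  ext j
  rw [mem_part_refineBy, mem_part_refineBy, ← hP, conn_congr hs]

/-- Partitions with far apart blocks within the blocks of a coarser partition have the same
dependence classes. -/
theorem refineBy_congr_of_le {P P' : AgentPartition n} (hle : P' ≤ P)
    (hsep : ∀ i j, j ∈ P.part i → j ∉ P'.part i → K < dist (s i).1 (s j).1) :
    refineBy K P s = refineBy K P' s := by
  refine ext_part fun i => Finset.ext fun j => ?_
  rw [mem_part_refineBy, mem_part_refineBy]
  constructor
  · rintro ⟨-, hc⟩
    -- A step of length at most `K` cannot leave a block of `P'`, because `hsep` makes every exit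
    -- longer than `K`.
    have := hc.of_closed (h := P'.part i) fun a ha b hb hd => by
      by_contra hb'
      have hPa : P.part a = P.part i := part_eq (le_iff.1 hle i ha)
      have := hsep a b (hPa ▸ hb) (part_eq ha ▸ hb')
      exact absurd hd (not_le.2 this)
    exact ⟨this.1.1 (mem_part_self P' i), this.2 (mem_part_self P' i)⟩
  · rintro ⟨hj, hc⟩
    exact ⟨le_iff.1 hle i hj, hc.mono le_rfl (le_iff.1 hle i)⟩

end Chains

namespace LocallyInterdependentMDP

open AgentPartition

variable {n : ℕ} {X : Type u} [MetricSpace X] {Y : Fin n → Type v} {A : Fin n → Type w}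

/-! ### Pairwise weights and rewards -/

section Rewards

variable (M : LocallyInterdependentMDP n X Y A)

/-- The bound `max |r_{ij}|` of the reward of the pair `(i, j)`. -/
def pairWeight (i j : Fin n) : ℝ :=
  ⨆ q : (X × Y i) × A i × (X × Y j) × A j, |M.pairReward i j q.1 q.2.1 q.2.2.1 q.2.2.2|

theorem pairWeight_nonneg (i j : Fin n) : 0 ≤ M.pairWeight i j :=
  Real.iSup_nonneg fun _ => abs_nonneg _

theorem abs_pairReward_le (i j : Fin n) (si : X × Y i) (ai : A i) (sj : X × Y j) (aj : A j) :
    |M.pairReward i j si ai sj aj| ≤ M.pairWeight i j :=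
  le_ciSup (M.reward_bounded i j) (si, ai, sj, aj)

/-- The sum of `f i j` over the pairs of agents with property `S`. -/
def pairSum (S : Fin n → Fin n → Prop) (f : Fin n → Fin n → ℝ) : ℝ := by
  classical
  exact ∑ i, ∑ j, if S i j then f i j else 0

/-- The total weight of the pairs of agents in `g`. -/
def weight (g : Finset (Fin n)) : ℝ := pairSum (fun i j => i ∈ g ∧ j ∈ g) M.pairWeight

variable {M} {S S' S'' : Fin n → Fin n → Prop} {f f' f'' : Fin n → Fin n → ℝ}

theorem pairSum_congr (h : ∀ i j, S i j ↔ S' i j) (hf : ∀ i j, S i j → f i j = f' i j) :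
    pairSum S f = pairSum S' f' := by
  classical
  refine Finset.sum_congr rfl fun i _ => Finset.sum_congr rfl fun j _ => ?_
  by_cases hS : S i j
  · rw [if_pos hS, if_pos ((h i j).1 hS), hf i j hS]
  · rw [if_neg hS, if_neg fun h' => hS ((h i j).2 h')]

theorem pairSum_nonneg (hf : ∀ i j, 0 ≤ f i j) : 0 ≤ pairSum S f := by
  classical
  exact Finset.sum_nonneg fun i _ => Finset.sum_nonneg fun j _ => by
    split_ifs
    exacts [hf i j, le_rfl]

theorem pairSum_mono (h : ∀ i j, S i j → S' i j) (hf : ∀ i j, 0 ≤ f i j) :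
    pairSum S f ≤ pairSum S' f := by
  classical
  refine Finset.sum_le_sum fun i _ => Finset.sum_le_sum fun j _ => ?_
  by_cases hS : S i j
  · rw [if_pos hS, if_pos (h i j hS)]
  · rw [if_neg hS]
    split_ifs
    exacts [hf i j, le_rfl]

theorem abs_pairSum_sub_le (h : ∀ i j, S' i j → S i j) (hf : ∀ i j, |f i j| ≤ f' i j)
    (hS : ∀ i j, S i j → ¬ S' i j → ¬ S'' i j → f i j = 0) :
    |pairSum S f - pairSum S' f| ≤ pairSum S'' f' := by
  classical
  simp only [pairSum, ← Finset.sum_sub_distrib]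
  refine (Finset.abs_sum_le_sum_abs _ _).trans (Finset.sum_le_sum fun i _ =>
    (Finset.abs_sum_le_sum_abs _ _).trans (Finset.sum_le_sum fun j _ => ?_))
  have h0 : 0 ≤ f' i j := (abs_nonneg _).trans (hf i j)
  by_cases h1 : S i j <;> by_cases h2 : S' i j <;> by_cases h3 : S'' i j <;>
    simp_all [hf i j]

theorem abs_pairSum_le (h : ∀ i j, S i j → S' i j) (hf : ∀ i j, |f i j| ≤ f' i j) :
    |pairSum S f| ≤ pairSum S' f' := by
  have h := abs_pairSum_sub_le (S := S) (S' := fun _ _ => False) (S'' := S') (f := f) (f' := f')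
    (fun _ _ h => h.elim) hf fun i j h1 _ h3 => absurd (h i j h1) h3
  simpa [pairSum] using h

/-- A sum over pairs, split according to which block of `Q` contains the agent `φ i j`. -/
theorem sum_pairSum_parts (Q : AgentPartition n) (φ : Fin n → Fin n → Fin n)
    (F : Finset (Fin n) → Fin n → Fin n → Prop) (hF : ∀ q ∈ Q.parts, ∀ i j, F q i j → φ i j ∈ q)
    (hS : ∀ i j, S i j ↔ F (Q.part (φ i j)) i j) :
    ∑ q ∈ Q.parts, pairSum (F q) f = pairSum S f := by
  classical
  simp only [pairSum]
  rw [Finset.sum_comm]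
  refine Finset.sum_congr rfl fun i _ => ?_
  rw [Finset.sum_comm]
  refine Finset.sum_congr rfl fun j _ => ?_
  rw [Finset.sum_eq_single (Q.part (φ i j))]
  · exact if_congr (hS i j).symm rfl rfl
  · intro q hq hne
    exact if_neg fun h => hne (Q.part_eq_of_mem hq (hF q hq i j h)).symm
  · exact fun h => absurd (part_mem Q _) h

theorem pairSum_add_le (h : ∀ i j, 0 ≤ f i j) (hd : ∀ i j, S i j → ¬ S' i j)
    (h1 : ∀ i j, S i j → S'' i j) (h2 : ∀ i j, S' i j → S'' i j) :
    pairSum S f + pairSum S' f ≤ pairSum S'' f := by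
  classical
  simp only [pairSum, ← Finset.sum_add_distrib]
  refine Finset.sum_le_sum fun i _ => Finset.sum_le_sum fun j _ => ?_
  have := h i j
  have := hd i j
  have := h1 i j
  have := h2 i j
  by_cases h1 : S i j <;> by_cases h2 : S' i j <;> by_cases h3 : S'' i j <;> simp_all

theorem pairSum_or_add_and (S S' : Fin n → Fin n → Prop) (f : Fin n → Fin n → ℝ) :
    pairSum (fun i j => S i j ∨ S' i j) f + pairSum (fun i j => S i j ∧ S' i j) f =
      pairSum S f + pairSum S' f := by
  classical
  simp only [pairSum, ← Finset.sum_add_distrib]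
  refine Finset.sum_congr rfl fun i _ => Finset.sum_congr rfl fun j _ => ?_
  by_cases h1 : S i j <;> by_cases h2 : S' i j <;> simp [h1, h2]

variable (M)

theorem weight_nonneg (g : Finset (Fin n)) : 0 ≤ M.weight g := pairSum_nonneg M.pairWeight_nonneg

theorem weight_univ : M.weight Finset.univ = M.rewardBound := by
  simp [weight, pairSum, rewardBound, pairWeight]

theorem sum_weight_inter_le (Q : AgentPartition n) (z : Finset (Fin n)) :
    ∑ q ∈ Q.parts, M.weight (z ∩ q) ≤ M.weight z := by
  simp only [weight]
  rw [sum_pairSum_parts (S := fun i j => i ∈ z ∩ Q.part i ∧ j ∈ z ∩ Q.part i) Q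
    (fun i _ => i) (fun q i j => i ∈ z ∩ q ∧ j ∈ z ∩ q) (fun q _ i j h => Finset.mem_of_mem_inter_right h.1)
    fun i j => Iff.rfl]
  exact pairSum_mono (fun i j h => ⟨Finset.mem_of_mem_inter_left h.1,
    Finset.mem_of_mem_inter_left h.2⟩) M.pairWeight_nonneg

theorem sum_weight_filter_le_sum (Q : AgentPartition n) (z : Finset (Fin n)) :
    ∑ q ∈ Q.parts with q ⊆ z, M.weight q ≤ ∑ q ∈ Q.parts, M.weight (z ∩ q) := by
  rw [Finset.sum_filter]
  refine Finset.sum_le_sum fun q _ => ?_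
  split_ifs with hq
  · rw [Finset.inter_eq_right.2 hq]
  · exact M.weight_nonneg _

theorem sum_weight_filter_le (Q : AgentPartition n) (z : Finset (Fin n)) :
    ∑ q ∈ Q.parts with q ⊆ z, M.weight q ≤ M.weight z :=
  (M.sum_weight_filter_le_sum Q z).trans (M.sum_weight_inter_le Q z)

theorem sum_weight_le (Q : AgentPartition n) : ∑ q ∈ Q.parts, M.weight q ≤ M.rewardBound := by
  rw [← weight_univ]
  simpa using M.sum_weight_inter_le Q Finset.univ

/-- The pairs of agents of `g` that contribute to `r^C_g((s, P), ·)`. -/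
def Linked (g : Finset (Fin n)) (P : AgentPartition n) (s : JointState X Y) (i j : Fin n) : Prop :=
  i ∈ g ∧ j ∈ g ∧ j ∈ P.part i ∧ Conn M.radius (P.part i ∩ g) s i j

theorem groupReward_eq_pairSum (p : Finset (Fin n)) (s : JointState X Y) (a : JointAction A) :
    M.groupReward p s a = pairSum (fun i j => i ∈ p ∧ j ∈ p ∧ Conn M.radius p s i j)
      fun i j => M.pairReward i j (s i) (a i) (s j) (a j) := by
  classical
  rw [groupReward, Finpartition.sum_sum_parts, pairSum, ← Finset.sum_subset (Finset.subset_univ p)]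
  · refine Finset.sum_congr rfl fun i hi => ?_
    rw [← Finset.sum_subset (Finset.subset_univ ((distPartition M.radius p (restr p s)).part i))]
    · exact Finset.sum_congr rfl fun j hj => (if_pos (mem_part_distPartition.1 hj)).symm
    · exact fun j _ hj => if_neg fun h => hj (mem_part_distPartition.2 h)
  · intro i _ hi
    simp [hi]

theorem cutoffReward_eq_sum (g : Finset (Fin n)) (σ : JointState X Y × AgentPartition n)
    (a : JointAction A) :
    M.cutoffReward g σ a = ∑ q ∈ σ.2.parts, M.groupReward (q ∩ g) σ.1 a :=
  σ.2.sum_restrict (Finset.subset_univ g) (fun p => M.groupReward p σ.1 a) (by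
    rw [groupReward_eq_pairSum]
    simp [pairSum])

theorem cutoffReward_eq_pairSum (g : Finset (Fin n)) (s : JointState X Y) (P : AgentPartition n)
    (a : JointAction A) :
    M.cutoffReward g (s, P) a = pairSum (M.Linked g P s)
      fun i j => M.pairReward i j (s i) (a i) (s j) (a j) := by
  rw [cutoffReward_eq_sum]
  simp only [groupReward_eq_pairSum]
  refine sum_pairSum_parts P (fun i _ => i) (fun q i j => i ∈ q ∩ g ∧ j ∈ q ∩ g ∧ Conn M.radius (q ∩ g) s i j)
    (fun q _ i j h => Finset.mem_of_mem_inter_left h.1) fun i j => ?_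
  simp only [Linked, Finset.mem_inter, mem_part_self, true_and]
  tauto

theorem abs_cutoffReward_le (g : Finset (Fin n)) (σ : JointState X Y × AgentPartition n)
    (a : JointAction A) : |M.cutoffReward g σ a| ≤ M.weight g := by
  rw [← Prod.mk.eta (p := σ), cutoffReward_eq_pairSum]
  exact abs_pairSum_le (fun i j h => ⟨h.1, h.2.1⟩) fun i j => M.abs_pairReward_le i j _ _ _ _

/-- As `P` does not join agents of `g` from different blocks of `Q`, every chain that links two
agents of `g` lies in a single `g ∩ q`. -/
theorem sum_cutoffReward_inter {g : Finset (Fin n)} {P : AgentPartition n} (Q : AgentPartition n)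
    (h : ∀ i ∈ g, P.part i ∩ g ⊆ Q.part i) (s : JointState X Y) (a : JointAction A) :
    ∑ q ∈ Q.parts, M.cutoffReward (g ∩ q) (s, P) a = M.cutoffReward g (s, P) a := by
  simp only [cutoffReward_eq_pairSum]
  refine sum_pairSum_parts Q (fun i _ => i) (fun q => M.Linked (g ∩ q) P s)
    (fun q _ i j h => Finset.mem_of_mem_inter_right h.1) fun i j => ?_
  simp only [Linked, Finset.mem_inter, mem_part_self, and_true]
  constructor
  · rintro ⟨h1, h2, h3, h4⟩
    refine ⟨h1, ⟨h2, h i h1 (Finset.mem_inter.2 ⟨h3, h2⟩)⟩, h3, ?_⟩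
    rwa [← Finset.inter_assoc, Finset.inter_eq_left.2 (h i h1)]
  · rintro ⟨h1, ⟨h2, -⟩, h3, h4⟩
    exact ⟨h1, h2, h3, h4.mono le_rfl
      (Finset.inter_subset_inter_left Finset.inter_subset_left |>.trans (by
        intro x hx
        simp only [Finset.mem_inter] at hx ⊢
        tauto))⟩

theorem cutoffReward_congr {g : Finset (Fin n)} {P P' : AgentPartition n}
    {s s' : JointState X Y} {a a' : JointAction A} (hP : ∀ i ∈ g, P.part i ∩ g = P'.part i ∩ g)
    (hs : ∀ i ∈ g, s i = s' i) (ha : ∀ i ∈ g, a i = a' i) :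
    M.cutoffReward g (s, P) a = M.cutoffReward g (s', P') a' := by
  simp only [cutoffReward_eq_pairSum]
  refine pairSum_congr (fun i j => ?_) fun i j h => ?_
  · refine and_congr_right fun hi => and_congr_right fun hj => and_congr ?_ ?_
    · have := congrArg (j ∈ ·) (hP i hi)
      simpa [hj] using this
    · rw [hP i hi]
      exact conn_congr fun k hk => hs k (Finset.mem_of_mem_inter_right hk)
  · rw [hs i h.1, hs j h.2.1, ha i h.1, ha j h.2.1]

theorem reward_eq_groupReward (s : JointState X Y) (a : JointAction A) :
    M.reward s a = M.groupReward Finset.univ s a := rfl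

end Rewards

/-! ### One step of the dynamics -/

section Steps

variable (M : LocallyInterdependentMDP n X Y A)

/-- The joint law of the action and of the next state. -/
def stepLaw (μ : PMF (JointAction A)) (G : AgentPartition n) (s : JointState X Y) :
    PMF (JointAction A × JointState X Y) :=
  μ.bind fun a => (M.stepBy G s a).map (Prod.mk a)

variable {M}

theorem mean_stepLaw {μ : PMF (JointAction A)} {G : AgentPartition n} {s : JointState X Y}
    {f : JointAction A × JointState X Y → ℝ} (hf : BddFun f) :
    (M.stepLaw μ G s).mean f = μ.mean fun a => (M.stepBy G s a).mean fun s' => f (a, s') := by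
  rw [stepLaw, PMF.mean_bind _ _ hf]
  simp_rw [PMF.mean_map _ _ hf]

theorem dist_le_of_mem_support_stepLaw {μ : PMF (JointAction A)} {G : AgentPartition n}
    {s : JointState X Y} {x : JointAction A × JointState X Y}
    (hx : x ∈ (M.stepLaw μ G s).support) (i : Fin n) : dist (s i).1 (x.2 i).1 ≤ 1 := by
  rw [stepLaw, PMF.mem_support_bind_iff] at hx
  obtain ⟨a, -, hx⟩ := hx
  obtain ⟨s', hs', rfl⟩ := (PMF.mem_support_map_iff _ _ _).1 hx
  have h := (mem_support_piPMF _ _).1 hs' i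
  by_contra! hd
  exact h (M.speed_limit _ _ _ _ _ hd)

theorem dist_sub_two_le {μ : PMF (JointAction A)} {G : AgentPartition n}
    {s : JointState X Y} {x : JointAction A × JointState X Y}
    (hx : x ∈ (M.stepLaw μ G s).support) (i j : Fin n) :
    dist (s i).1 (s j).1 - 2 ≤ dist (x.2 i).1 (x.2 j).1 := by
  have h1 := dist_le_of_mem_support_stepLaw hx i
  have h2 := dist_le_of_mem_support_stepLaw hx j
  have h3 := dist_triangle4 (s i).1 (x.2 i).1 (x.2 j).1 (s j).1
  rw [dist_comm (x.2 j).1] at h3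
  linarith

theorem move_congr {g g' : Finset (Fin n)} (hg : g = g') {i : Fin n} (hi : i ∈ g) (hi' : i ∈ g')
    {s s' : JointState X Y} {a a' : JointAction A} (hs : ∀ j ∈ g, s j = s' j)
    (ha : ∀ j ∈ g, a j = a' j) :
    M.move g ⟨i, hi⟩ (restr g s) (restr g a) = M.move g' ⟨i, hi'⟩ (restr g' s') (restr g' a') := by
  subst hg
  congr 1
  · exact funext fun j => hs j j.2
  · exact funext fun j => ha j j.2

theorem stepBy_map_restr (z : Finset (Fin n)) (G : AgentPartition n) (s : JointState X Y)
    (a : JointAction A) : (M.stepBy G s a).map (restr z) = piPMF fun i : z =>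
      M.move (G.part i) ⟨i, mem_part_self G i⟩ (restr (G.part i) s) (restr (G.part i) a) := by
  convert piPMF_map_subtype (fun i => M.move (G.part i) ⟨i, mem_part_self G i⟩
    (restr (G.part i) s) (restr (G.part i) a)) (· ∈ z)
  rfl

theorem stepBy_map_restr_congr {z : Finset (Fin n)} {G G' : AgentPartition n}
    {s s' : JointState X Y} {a a' : JointAction A} (hG : ∀ i ∈ z, G.part i = G'.part i)
    (hz : ∀ i ∈ z, G.part i ⊆ z) (hs : ∀ i ∈ z, s i = s' i) (ha : ∀ i ∈ z, a i = a' i) :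
    (M.stepBy G s a).map (restr z) = (M.stepBy G' s' a').map (restr z) := by
  rw [stepBy_map_restr, stepBy_map_restr]
  refine congrArg piPMF (funext fun i => ?_)
  exact move_congr (hG i i.2) _ _ (fun j hj => hs j (hz i i.2 hj)) fun j hj => ha j (hz i i.2 hj)

/-- The restriction of the joint law of action and next state to a group that no dependence class
leaves is determined by the restriction of the action law and by the states of the group. -/
theorem stepLaw_map_restr_congr {z : Finset (Fin n)} {μ μ' : PMF (JointAction A)}
    {G G' : AgentPartition n} {s s' : JointState X Y} (hμ : μ.map (restr z) = μ'.map (restr z))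
    (hG : ∀ i ∈ z, G.part i = G'.part i) (hz : ∀ i ∈ z, G.part i ⊆ z)
    (hs : ∀ i ∈ z, s i = s' i) :
    (M.stepLaw μ G s).map (fun x => (restr z x.1, restr z x.2)) =
      (M.stepLaw μ' G' s').map (fun x => (restr z x.1, restr z x.2)) := by
  classical
  obtain ⟨a₀, -⟩ := μ.support_nonempty
  -- Moves of agents of `z` see only actions in `z`, so the step kernel may be evaluated at any
  -- extension of the action on `z`; `a₀` fills the other coordinates.
  let ext : (∀ i : z, A i) → JointAction A := fun b i => if h : i ∈ z then b ⟨i, h⟩ else a₀ i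
  have hext : ∀ (a : JointAction A), ∀ i ∈ z, a i = ext (restr z a) i := fun a i hi => by
    simp [ext, hi]
  have key : ∀ (ν : PMF (JointAction A)) (H : AgentPartition n) (t : JointState X Y),
      (∀ i ∈ z, H.part i = G.part i) → (∀ i ∈ z, t i = s i) →
      (M.stepLaw ν H t).map (fun x => (restr z x.1, restr z x.2)) =
        (ν.map (restr z)).bind fun b =>
          ((M.stepBy G s (ext b)).map (restr z)).map (Prod.mk b) := by
    intro ν H t hH ht
    rw [stepLaw, PMF.map_bind, PMF.bind_map]
    refine congrArg ν.bind (funext fun a => ?_)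
    simp only [Function.comp]
    rw [← stepBy_map_restr_congr hH (fun i hi => (hH i hi).symm ▸ hz i hi) ht (hext a),
      PMF.map_comp, PMF.map_comp]
    rfl
  rw [key μ G s (fun _ _ => rfl) fun _ _ => rfl,
    key μ' G' s' (fun i hi => (hG i hi).symm) fun i hi => (hs i hi).symm, hμ]

end Steps

end LocallyInterdependentMDP

namespace LocallyInterdependentMDP

open AgentPartition

variable {n : ℕ} {X : Type u} [MetricSpace X] {Y : Fin n → Type v} {A : Fin n → Type w}

/-! ### Values of cutoff policies -/

section Values

variable (M : LocallyInterdependentMDP n X Y A)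

theorem one_sub_discount_pos : 0 < 1 - M.discount := sub_pos.2 M.discount_lt_one

theorem abs_discountedReward_le (g : Finset (Fin n))
    (τ : List ((JointState X Y × AgentPartition n) × JointAction A)) :
    |M.discountedReward g τ| ≤ M.weight g / (1 - M.discount) := by
  have h1 := M.one_sub_discount_pos
  induction τ with
  | nil => simpa [discountedReward] using div_nonneg (M.weight_nonneg g) h1.le
  | cons x τ ih =>
    rw [discountedReward]
    calc _ ≤ |M.cutoffReward g x.1 x.2| + M.discount * |M.discountedReward g τ| :=
          (abs_add_le _ _).trans_eq (by rw [abs_mul, abs_of_nonneg M.discount_nonneg])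
      _ ≤ M.weight g + M.discount * (M.weight g / (1 - M.discount)) :=
          add_le_add (M.abs_cutoffReward_le g _ _) (mul_le_mul_of_nonneg_left ih M.discount_nonneg)
      _ = M.weight g / (1 - M.discount) := by
          field_simp
          ring

theorem bddFun_discountedReward (g : Finset (Fin n)) : BddFun (M.discountedReward g) :=
  ⟨_, M.abs_discountedReward_le g⟩

variable (V : ℝ) (π : ℕ → CutoffPolicy X Y A) (h k : ℕ) (g : Finset (Fin n))
  (s : JointState X Y) (P Q : AgentPartition n)

theorem abs_cutoffValueAs_le :
    |M.cutoffValueAs V π h k g s P Q| ≤ M.weight g / (1 - M.discount) :=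
  PMF.abs_mean_le _ (M.abs_discountedReward_le g)

theorem cutoffValueAs_zero : M.cutoffValueAs V π h 0 g s P Q = 0 :=
  PMF.mean_pure _ _

/-- The expression whose mean is the value of a cutoff policy. -/
def stepValue (x : JointAction A × JointState X Y) : ℝ :=
  M.cutoffReward g (s, P) x.1 + M.discount * M.cutoffValueAs V π (h + 1) k g x.2
    (jointPartition V x.2 ⊓ P) (jointPartition V x.2 ⊓ Q)

theorem bddFun_stepValue : BddFun (M.stepValue V π h k g s P Q) :=
  BddFun.add ⟨M.weight g, fun _ => M.abs_cutoffReward_le g _ _⟩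
    (BddFun.const_mul _ ⟨_, fun _ => M.abs_cutoffValueAs_le V π _ _ g _ _ _⟩)

theorem cutoffValueAs_succ : M.cutoffValueAs V π h (k + 1) g s P Q =
    (M.stepLaw ((π h).act s Q) (refineBy M.radius P s) s).mean (M.stepValue V π h k g s P Q) := by
  have hb := M.bddFun_discountedReward g
  rw [mean_stepLaw (M.bddFun_stepValue V π h k g s P Q), cutoffValueAs, cutoffTraj,
    PMF.mean_bind _ _ hb]
  refine PMF.mean_congr _ fun a _ => ?_
  rw [PMF.mean_bind _ _ hb, cutoffTrans, PMF.mean_map]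
  · refine PMF.mean_congr _ fun s' _ => ?_
    rw [PMF.mean_map _ _ hb]
    simp only [discountedReward]
    rw [PMF.mean_add _ (.const _) (hb.const_mul _), PMF.mean_const, PMF.mean_const_mul]
    rfl
  · exact PMF.bddFun_mean _ (hb.comp fun x : _ × _ => x.2)

variable {M V π h k g s P Q}

/-- The two horizons differ only in the reward of the last step, which is discounted by γ^k. -/
theorem abs_cutoffValueAs_succ_sub_le :
    |M.cutoffValueAs V π h (k + 1) g s P Q - M.cutoffValueAs V π h k g s P Q| ≤
      M.discount ^ k * M.weight g := by
  induction k generalizing h s P Q with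
  | zero =>
    rw [cutoffValueAs_succ, cutoffValueAs_zero, sub_zero, pow_zero, one_mul]
    refine PMF.abs_mean_le _ fun x => ?_
    rw [stepValue, cutoffValueAs_zero, mul_zero, add_zero]
    exact M.abs_cutoffReward_le g _ _
  | succ k ih =>
    rw [cutoffValueAs_succ, cutoffValueAs_succ]
    refine PMF.abs_mean_sub_mean_le _ (M.bddFun_stepValue ..) (M.bddFun_stepValue ..)
      fun x _ => ?_
    rw [stepValue, stepValue, add_sub_add_left_eq_sub, ← mul_sub, abs_mul,
      abs_of_nonneg M.discount_nonneg, pow_succ', mul_assoc]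
    exact mul_le_mul_of_nonneg_left ih M.discount_nonneg

theorem cutoffValueAs_congr_policy {π' : ℕ → CutoffPolicy X Y A}
    (hπ : ∀ t, h ≤ t → t < h + k → π t = π' t) :
    M.cutoffValueAs V π h k g s P Q = M.cutoffValueAs V π' h k g s P Q := by
  induction k generalizing h s P Q with
  | zero => rw [cutoffValueAs_zero, cutoffValueAs_zero]
  | succ k ih =>
    rw [cutoffValueAs_succ, cutoffValueAs_succ, hπ h le_rfl (by omega)]
    refine PMF.mean_congr _ fun x _ => ?_
    rw [stepValue, stepValue, ih fun t ht ht' => hπ t (by omega) (by omega)]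

/-- Rewards are additive over parts of `g` that `P` keeps apart, and partitions only become finer in
time, so the hypothesis survives each step. -/
theorem sum_cutoffValueAs_inter (S : AgentPartition n) (hS : ∀ i ∈ g, P.part i ∩ g ⊆ S.part i) :
    ∑ q ∈ S.parts, M.cutoffValueAs V π h k (g ∩ q) s P Q =
      M.cutoffValueAs V π h k g s P Q := by
  induction k generalizing h s P Q with
  | zero => simp [cutoffValueAs_zero]
  | succ k ih =>
    simp only [cutoffValueAs_succ]
    rw [← PMF.mean_sum _ _ fun q _ => M.bddFun_stepValue ..]
    refine PMF.mean_congr _ fun x _ => ?_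
    simp only [stepValue]
    rw [Finset.sum_add_distrib, M.sum_cutoffReward_inter S hS, ← Finset.mul_sum, ih]
    intro i hi
    rw [part_inf]
    exact (Finset.inter_subset_inter_right Finset.inter_subset_right).trans (hS i hi)

/-- A value for a group `z` is the sum of the values for the blocks of `S` in `z`, if `z` consists
of blocks of `S` and `P` does not join agents of different blocks. -/
theorem cutoffValueAs_eq_sum_parts {z : Finset (Fin n)} (S : AgentPartition n)
    (hz : ∀ i ∈ z, S.part i ⊆ z) (hS : ∀ i ∈ z, P.part i ∩ z ⊆ S.part i) :
    M.cutoffValueAs V π h k z s P Q =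
      ∑ q ∈ S.parts with q ⊆ z, M.cutoffValueAs V π h k q s P Q := by
  rw [← sum_cutoffValueAs_inter S hS, Finset.sum_filter]
  refine Finset.sum_congr rfl fun q hq => ?_
  split_ifs with hqz
  · rw [Finset.inter_eq_right.2 hqz]
  · have : z ∩ q = ∅ := by
      by_contra hne
      obtain ⟨i, hi⟩ := Finset.nonempty_iff_ne_empty.2 hne
      rw [Finset.mem_inter] at hi
      exact hqz (S.part_eq_of_mem hq hi.2 ▸ hz i hi.1)
    have h0 := M.abs_cutoffValueAs_le V π h k ∅ s P Q
    rw [this]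
    have hw : M.weight ∅ = 0 := by simp [weight, pairSum]
    rwa [hw, zero_div, abs_nonpos_iff] at h0

theorem cutoffValueAs_add_compl (z : Finset (Fin n)) (hz : ∀ i ∈ z, P.part i ⊆ z) :
    M.cutoffValueAs V π h k z s P Q + M.cutoffValueAs V π h k zᶜ s P Q =
      M.cutoffValueAs V π h k Finset.univ s P Q := by
  have hc : ∀ i ∈ zᶜ, P.part i ⊆ zᶜ := fun i hi j hj => by
    rw [Finset.mem_compl] at hi ⊢
    exact fun hj' => hi (hz j hj' (mem_part_comm.1 hj))
  rw [cutoffValueAs_eq_sum_parts P hz fun _ _ => Finset.inter_subset_left,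
    cutoffValueAs_eq_sum_parts P hc fun _ _ => Finset.inter_subset_left,
    cutoffValueAs_eq_sum_parts (z := Finset.univ) P (fun _ _ => Finset.subset_univ _)
      fun _ _ => Finset.inter_subset_left,
    Finset.filter_true_of_mem fun p _ => Finset.subset_univ p,
    ← Finset.sum_filter_add_sum_filter_not P.parts (· ⊆ z)]
  congr 1
  refine Finset.sum_congr (Finset.filter_congr fun p hp => ?_) fun _ _ => rfl
  obtain ⟨i, hi, rfl⟩ := exists_part_eq hp
  constructor
  · exact fun hpc hpz => Finset.mem_compl.1 (hpc hi) (hpz hi)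
  · exact fun hpz => hc i (Finset.mem_compl.2 fun hi' => hpz (hz i hi'))

end Values

/-! ### Cutting blocks whose parts are far apart -/

section Comparison

/-- Agents of the same block of `P` in different blocks of `P'` are farther apart than `K`. -/
def FarApart (K : ℝ) (s : JointState X Y) (P P' : AgentPartition n) : Prop :=
  ∀ i j, j ∈ P.part i → j ∉ P'.part i → K < dist (s i).1 (s j).1

/-- The total weight of the pairs of agents of `g` that `P'` separates and `P` does not. -/
def gapWeight (M : LocallyInterdependentMDP n X Y A) (g : Finset (Fin n))
    (P P' : AgentPartition n) : ℝ :=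
  pairSum (fun i j => i ∈ g ∧ j ∈ g ∧ j ∈ P.part i ∧ j ∉ P'.part i) M.pairWeight

variable {M : LocallyInterdependentMDP n X Y A} {V : ℝ} {π : ℕ → CutoffPolicy X Y A} {h k m : ℕ}
  {g : Finset (Fin n)} {s : JointState X Y} {P P' Q : AgentPartition n}

theorem FarApart.mono {K L : ℝ} (hK : K ≤ L) (hs : FarApart L s P P') : FarApart K s P P' :=
  fun i j hj hj' => hK.trans_lt (hs i j hj hj')

/-- Two agents approach each other by at most 2 in a step, 1 for each of them. -/
theorem FarApart.step {K : ℝ} (hs : FarApart K s P P') {μ : PMF (JointAction A)}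
    {G R : AgentPartition n} {x : JointAction A × JointState X Y}
    (hx : x ∈ (M.stepLaw μ G s).support) : FarApart (K - 2) x.2 (R ⊓ P) (R ⊓ P') := by
  intro i j hj hj'
  rw [part_inf, Finset.mem_inter] at hj hj'
  linarith [hs i j hj.2 fun h' => hj' ⟨hj.1, h'⟩, dist_sub_two_le hx i j]

/-- Reward is paid along chains with steps at most the radius, and no such chain crosses the cut. -/
theorem cutoffReward_congr_of_farApart (hP : P' ≤ P) (hs : FarApart M.radius s P P')
    (a : JointAction A) : M.cutoffReward g (s, P) a = M.cutoffReward g (s, P') a := by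
  simp only [cutoffReward_eq_pairSum]
  refine pairSum_congr (fun i j => and_congr_right fun hi => and_congr_right fun hj => ?_)
    fun _ _ _ => rfl
  constructor
  · rintro ⟨-, hc⟩
    have := hc.of_closed (h := P'.part i ∩ g) fun a ha b hb hd => by
      rw [Finset.mem_inter] at ha hb ⊢
      refine ⟨?_, hb.2⟩
      by_contra hb'
      have hPa : P.part a = P.part i := part_eq (le_iff.1 hP i ha.1)
      exact absurd hd (not_le.2 (hs a b (hPa ▸ hb.1) (part_eq ha.1 ▸ hb')))
    have hi' := Finset.mem_inter.2 ⟨mem_part_self P' i, hi⟩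
    exact ⟨Finset.mem_of_mem_inter_left (this.1.1 hi'), this.2 hi'⟩
  · rintro ⟨hj, hc⟩
    exact ⟨le_iff.1 hP i hj, hc.mono le_rfl (Finset.inter_subset_inter_right (le_iff.1 hP i))⟩

/-- The gap shrinks by at most 2 per step, so for `m` steps the dependence classes and the rewards
of the two partitions agree; the policy sees the same `Q` in both, so the laws agree too. After that
only the trivial bound `weight / (1 - γ)` for each value remains, hence the factor 2. For `m = 0`
nothing is required of the distances. -/
theorem abs_cutoffValueAs_sub_le (hP : P' ≤ P)
    (hs : 0 < m → FarApart (M.radius + 2 * (m - 1)) s P P') :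
    |M.cutoffValueAs V π h k g s P Q - M.cutoffValueAs V π h k g s P' Q| ≤
      M.discount ^ m / (1 - M.discount) * (2 * M.weight g) := by
  have h1 := M.one_sub_discount_pos
  have h2 := M.weight_nonneg g
  have h3 := M.discount_nonneg
  induction m generalizing h k s P P' Q with
  | zero =>
    have e1 := M.abs_cutoffValueAs_le V π h k g s P Q
    have e2 := M.abs_cutoffValueAs_le V π h k g s P' Q
    calc _ ≤ _ := abs_sub _ _
      _ ≤ M.weight g / (1 - M.discount) + M.weight g / (1 - M.discount) := add_le_add e1 e2
      _ = _ := by ring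
  | succ m ih =>
    cases k with
    | zero =>
      rw [cutoffValueAs_zero, cutoffValueAs_zero, sub_zero, abs_zero]
      positivity
    | succ k =>
      have hs' : FarApart (M.radius + 2 * m) s P P' := by
        have := hs (Nat.succ_pos m)
        push_cast at this
        simpa using this
      have hs0 : FarApart M.radius s P P' :=
        hs'.mono (le_add_of_nonneg_right (by positivity))
      rw [cutoffValueAs_succ, cutoffValueAs_succ, ← refineBy_congr_of_le hP hs0]
      refine PMF.abs_mean_sub_mean_le _ (M.bddFun_stepValue ..) (M.bddFun_stepValue ..)
        fun x hx => ?_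
      rw [stepValue, stepValue, cutoffReward_congr_of_farApart hP hs0, add_sub_add_left_eq_sub,
        ← mul_sub, abs_mul, abs_of_nonneg h3, pow_succ', mul_div_assoc, mul_assoc]
      refine mul_le_mul_of_nonneg_left (ih (inf_le_inf_left _ hP) fun _ => ?_) h3
      exact (hs'.step hx).mono (by linarith)

theorem stepLaw_congr_of_isStandard (hM : M.IsStandard) (μ : PMF (JointAction A))
    (G G' : AgentPartition n) : M.stepLaw μ G s = M.stepLaw μ G' s := by
  obtain ⟨⟨R, hR⟩, -⟩ := hM
  simp only [stepLaw, stepBy, hR]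

/-- Pairs beyond the radius earn nothing and nearer pairs of a block are linked directly, so the
chain condition can be dropped. -/
theorem cutoffReward_of_isStandard (hM : M.IsStandard) (a : JointAction A) :
    M.cutoffReward g (s, P) a = pairSum (fun i j => i ∈ g ∧ j ∈ g ∧ j ∈ P.part i)
      fun i j => M.pairReward i j (s i) (a i) (s j) (a j) := by
  classical
  rw [cutoffReward_eq_pairSum]
  refine Finset.sum_congr rfl fun i _ => Finset.sum_congr rfl fun j _ => ?_
  by_cases hl : M.Linked g P s i j
  · rw [if_pos hl, if_pos ⟨hl.1, hl.2.1, hl.2.2.1⟩]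
  · rw [if_neg hl]
    split_ifs with hij
    · refine (hM.2 i j _ _ _ _ ?_).symm
      by_contra! hd
      exact hl ⟨hij.1, hij.2.1, hij.2.2, conn_of_dist_le
        (Finset.mem_inter.2 ⟨mem_part_self P i, hij.1⟩)
        (Finset.mem_inter.2 ⟨hij.2.2, hij.2.1⟩) hd⟩
    · rfl

theorem gapWeight_nonneg (M : LocallyInterdependentMDP n X Y A) (g : Finset (Fin n))
    (P P' : AgentPartition n) : 0 ≤ M.gapWeight g P P' := pairSum_nonneg M.pairWeight_nonneg

theorem gapWeight_inf_le (R : AgentPartition n) :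
    M.gapWeight g (R ⊓ P) (R ⊓ P') ≤ M.gapWeight g P P' := by
  refine pairSum_mono (fun i j hij => ?_) M.pairWeight_nonneg
  simp only [part_inf, Finset.mem_inter] at hij
  tauto

theorem abs_cutoffReward_sub_le_gapWeight (hM : M.IsStandard) (hP : P' ≤ P) (a : JointAction A) :
    |M.cutoffReward g (s, P) a - M.cutoffReward g (s, P') a| ≤ M.gapWeight g P P' := by
  rw [cutoffReward_of_isStandard hM, cutoffReward_of_isStandard hM]
  refine abs_pairSum_sub_le (fun i j hij => ⟨hij.1, hij.2.1, le_iff.1 hP i hij.2.2⟩)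
    (fun i j => M.abs_pairReward_le ..) fun i j h1 h2 h3 => ?_
  exact absurd ⟨h1.1, h1.2.1, h1.2.2, fun hj => h2 ⟨h1.1, h1.2.1, hj⟩⟩ h3

/-- In the standard setting the moves ignore the partition, so the positions have the same law for
all time. Only rewards of pairs separated by the cut can differ, and these vanish during the first
`m` steps; this replaces twice the weight of `g` by the weight of the gap. -/
theorem abs_cutoffValueAs_sub_le_of_isStandard (hM : M.IsStandard) (hP : P' ≤ P)
    (hs : 0 < m → FarApart (M.radius + 2 * (m - 1)) s P P') :
    |M.cutoffValueAs V π h k g s P Q - M.cutoffValueAs V π h k g s P' Q| ≤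
      M.discount ^ m / (1 - M.discount) * M.gapWeight g P P' := by
  have h1 := M.one_sub_discount_pos
  have h2 := M.gapWeight_nonneg g P P'
  have h3 := M.discount_nonneg
  induction k generalizing h m s P P' Q with
  | zero =>
    rw [cutoffValueAs_zero, cutoffValueAs_zero, sub_zero, abs_zero]
    positivity
  | succ k ih =>
    rw [cutoffValueAs_succ, cutoffValueAs_succ,
      stepLaw_congr_of_isStandard hM _ (refineBy M.radius P' s) (refineBy M.radius P s)]
    refine PMF.abs_mean_sub_mean_le _ (M.bddFun_stepValue ..) (M.bddFun_stepValue ..)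
      fun x hx => ?_
    have h4 : M.gapWeight g (jointPartition V x.2 ⊓ P) (jointPartition V x.2 ⊓ P') ≤
      M.gapWeight g P P' := gapWeight_inf_le _
    have h5 := M.gapWeight_nonneg g (jointPartition V x.2 ⊓ P) (jointPartition V x.2 ⊓ P')
    rw [stepValue, stepValue]
    cases m with
    | zero =>
      have h6 := ih (h := h + 1) (m := 0) (s := x.2) (P := jointPartition V x.2 ⊓ P)
        (P' := jointPartition V x.2 ⊓ P') (Q := jointPartition V x.2 ⊓ Q)
        (inf_le_inf_left _ hP) (fun h0 => absurd h0 (lt_irrefl 0)) h5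
      rw [add_sub_add_comm, ← mul_sub]
      refine (abs_add_le _ _).trans ?_
      rw [abs_mul, abs_of_nonneg h3]
      calc _ ≤ M.gapWeight g P P' +
            M.discount * (M.discount ^ 0 / (1 - M.discount) * M.gapWeight g P P') := by
            refine add_le_add (abs_cutoffReward_sub_le_gapWeight hM hP _)
              (mul_le_mul_of_nonneg_left (h6.trans ?_) h3)
            exact mul_le_mul_of_nonneg_left h4 (by positivity)
        _ = _ := by
            field_simp
            ring
    | succ m =>
      have hs' : FarApart (M.radius + 2 * m) s P P' := by
        have := hs (Nat.succ_pos m)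
        push_cast at this
        simpa using this
      have hs0 : FarApart M.radius s P P' :=
        hs'.mono (le_add_of_nonneg_right (by positivity))
      have h6 := ih (h := h + 1) (m := m) (s := x.2) (P := jointPartition V x.2 ⊓ P)
        (P' := jointPartition V x.2 ⊓ P') (Q := jointPartition V x.2 ⊓ Q)
        (inf_le_inf_left _ hP) (fun _ => (hs'.step hx).mono (by linarith)) h5
      rw [cutoffReward_congr_of_farApart hP hs0, add_sub_add_left_eq_sub, ← mul_sub, abs_mul,
        abs_of_nonneg h3, pow_succ', mul_div_assoc, mul_assoc]
      refine mul_le_mul_of_nonneg_left (h6.trans ?_) h3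
      exact mul_le_mul_of_nonneg_left h4 (by positivity)

end Comparison

end LocallyInterdependentMDP

namespace LocallyInterdependentMDP

open AgentPartition

/-! ### Marginals of cutoff policies -/

section Marginals

variable {n : ℕ} {X : Type u} {Y : Fin n → Type v} {A : Fin n → Type w}

theorem glue_apply {P : AgentPartition n} {p : Finset (Fin n)} (hp : p ∈ P.parts)
    (f : ∀ p : P.parts, GroupAction A p.1) {i : Fin n} (hi : i ∈ p) :
    glue P f i = f ⟨p, hp⟩ ⟨i, hi⟩ := by
  obtain rfl := P.part_eq_of_mem hp hi
  rfl

theorem blockLaw_map_restr {P : AgentPartition n} (μ : ∀ p : P.parts, PMF (GroupAction A p.1))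
    {p : Finset (Fin n)} (hp : p ∈ P.parts) :
    (blockLaw P μ).map (restr p) = μ ⟨p, hp⟩ := by
  rw [blockLaw, PMF.map_comp, ← piPMF_map_eval μ ⟨p, hp⟩]
  congr 1
  exact funext fun f => funext fun i => glue_apply hp f i.2

theorem act_map_restr (π : CutoffPolicy X Y A) (s : JointState X Y) {P : AgentPartition n}
    {p : Finset (Fin n)} (hp : p ∈ P.parts) :
    (π.act s P).map (restr p) = π p (restr p s) :=
  blockLaw_map_restr _ hp

theorem act_map_restr_of_subset (π : CutoffPolicy X Y A) (s : JointState X Y)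
    {P : AgentPartition n} {p z : Finset (Fin n)} (hp : p ∈ P.parts) (hz : z ⊆ p) :
    (π.act s P).map (restr z) =
      (π p (restr p s)).map fun a (i : z) => a ⟨i.1, hz i.2⟩ := by
  rw [← act_map_restr π s hp, PMF.map_comp]
  rfl

end Marginals

variable {n : ℕ} {X : Type u} [MetricSpace X] {Y : Fin n → Type v} {A : Fin n → Type w}

/-! ### Consequences of consistent performance -/

/-- The value `[V^π_h]_g(s, P)` of a policy with final time `H`. -/
def planValue (M : LocallyInterdependentMDP n X Y A) (V : ℝ) (H : ℕ) (π : ℕ → CutoffPolicy X Y A)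
    (h : ℕ) (g : Finset (Fin n)) (s : JointState X Y) (P : AgentPartition n) : ℝ :=
  M.cutoffValue V π h (H + 1 - h) g s P

/-- Bounds for the errors that occur when the blocks of a partition are cut into parts at distance
more than `K`. -/
structure ErrorBudget (M : LocallyInterdependentMDP n X Y A) (V K : ℝ) (H : ℕ)
    (π : ℕ → CutoffPolicy X Y A) where
  /-- The error of a value for a group if the transitions and rewards follow a finer partition. -/
  cut : Finset (Fin n) → AgentPartition n → AgentPartition n → ℝ
  abs_sub_le_cut : ∀ h k g s P P' Q, P' ≤ P → FarApart K s P P' →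
    |M.cutoffValueAs V π h k g s P Q - M.cutoffValueAs V π h k g s P' Q| ≤ cut g P P'
  /-- The error of a value for a block of a cutoff state due to the states of the other agents. -/
  loc : Finset (Fin n) → ℝ
  -- After one step the values are values from time 1. Returning to time 0 costs γ^H w(q) in each of
  -- the two compared states, or 2γ^(H+1) w(q) after discounting; the share `1 - γ` of `loc q` that
  -- discounting releases must pay for it.
  two_mul_le_loc : ∀ q, q.Nonempty →
    2 * M.discount ^ (H + 1) * M.weight q ≤ (1 - M.discount) * loc q
  -- If `q` splits along `S`, both compared states are cut, at cost `D` each, and every part brings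
  -- its own error; all of this must fit into `loc q`.
  exists_cut_le : ∀ (q : Finset (Fin n)) (S : AgentPartition n),
    (∀ i ∈ q, S.part i ⊆ q) → q ∉ S.parts → ∃ D,
      (∀ P P' : AgentPartition n, (∀ i ∈ q, P'.part i = S.part i) → cut q P P' ≤ D) ∧
      2 * D + ∑ r ∈ S.parts with r ⊆ q, loc r ≤ loc q
  /-- A bound for the decrease of the value of a group that is cut out. -/
  lower : Finset (Fin n) → ℝ
  cut_le_lower : ∀ z P S, cut z P (P ⊓ splitAt S z) ≤ lower z
  /-- A bound for the increase of the value of a group that is cut out. -/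
  upper : Finset (Fin n) → ℝ
  cut_le_upper : ∀ z P S,
    2 * cut Finset.univ P (P ⊓ splitAt S z) + cut z P (P ⊓ splitAt S z) ≤ upper z
  /-- A bound for `loc q`, relative to the weight of `q`. -/
  locRate : ℝ
  locRate_nonneg : 0 ≤ locRate
  loc_le : ∀ q, q.Nonempty → loc q ≤ locRate * M.weight q
  /-- A bound for the sum of the errors `lower z` over the blocks `z` of a partition. -/
  lowerTotal : ℝ
  sum_lower_le : ∀ Q : AgentPartition n, ∑ z ∈ Q.parts, lower z ≤ lowerTotal
  cut_univ_le : ∀ P P', cut Finset.univ P P' ≤ lowerTotal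
  /-- A bound for the sum of the errors `upper z` over the blocks `z` of a partition. -/
  upperTotal : ℝ
  sum_upper_le : ∀ Q : AgentPartition n, ∑ z ∈ Q.parts, upper z ≤ upperTotal
  lowerTotal_le : lowerTotal ≤ upperTotal

section Consistent

variable {M : LocallyInterdependentMDP n X Y A} {V : ℝ} {H : ℕ} {π : ℕ → CutoffPolicy X Y A}
  (hπ : M.IsConsistentPerformance V H π) {h : ℕ} {g : Finset (Fin n)} {s : JointState X Y}
  {P P' : AgentPartition n}

theorem abs_planValue_le : |M.planValue V H π h g s P| ≤ M.weight g / (1 - M.discount) :=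
  M.abs_cutoffValueAs_le ..

theorem planValue_eq_sum_parts {z : Finset (Fin n)} (S : AgentPartition n)
    (hz : ∀ i ∈ z, S.part i ⊆ z) (hS : ∀ i ∈ z, P.part i ∩ z ⊆ S.part i) :
    M.planValue V H π h z s P = ∑ q ∈ S.parts with q ⊆ z, M.planValue V H π h q s P :=
  cutoffValueAs_eq_sum_parts S hz hS

include hπ in
-- Consistency speaks of single blocks of `P`; additivity extends it to unions of blocks of `P`. In
-- `cutoffValueAs_coarser_le` unions of blocks of the finer partition are allowed.
theorem cutoffValueAs_finer_le (hP : IsCutoffState V s P) (hP' : P' ≤ P) (hh : h ≤ 1)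
    (hg : ∀ i ∈ g, P.part i ⊆ g) :
    M.cutoffValueAs V π h (H + 1 - h) g s P P' ≤ M.planValue V H π h g s P := by
  obtain ⟨ρ, hρ⟩ := hπ
  rw [planValue_eq_sum_parts P hg fun _ _ => Finset.inter_subset_left,
    cutoffValueAs_eq_sum_parts P hg fun _ _ => Finset.inter_subset_left]
  exact Finset.sum_le_sum fun p hp =>
    (hρ s P P' hP hP').1 h hh p (Finset.mem_filter.1 hp).1

include hπ in
theorem cutoffValueAs_coarser_le (hP : IsCutoffState V s P) (hP' : P' ≤ P) (hh : h ≤ 1)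
    (hg : ∀ i ∈ g, P'.part i ⊆ g) :
    M.cutoffValueAs V π h (H + 1 - h) g s P' P ≤ M.planValue V H π h g s P' := by
  obtain ⟨ρ, hρ⟩ := hπ
  rw [planValue_eq_sum_parts P' hg fun _ _ => Finset.inter_subset_left,
    cutoffValueAs_eq_sum_parts P' hg fun _ _ => Finset.inter_subset_left]
  exact Finset.sum_le_sum fun p hp =>
    (hρ s P P' hP hP').2.1 h hh p (Finset.mem_filter.1 hp).1

include hπ in
/-- The values at times `0` and `1` almost agree. -/
theorem abs_planValue_one_sub_zero_le (hP : IsCutoffState V s P) (hg : ∀ i ∈ g, P.part i ⊆ g) :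
    |M.planValue V H π 1 g s P - M.planValue V H π 0 g s P| ≤ M.discount ^ H * M.weight g := by
  obtain ⟨ρ, hρ⟩ := hπ
  have e1 : M.cutoffValueAs V (Function.update π (H + 1) ρ) 1 H g s P P =
      M.cutoffValueAs V π 1 H g s P P :=
    cutoffValueAs_congr_policy fun t _ ht => Function.update_of_ne (by omega) _ _
  -- The values from time 0 have `H + 1` steps and those from time 1 have `H`. Lengthening the
  -- second or shortening the first by one step costs γ^H w(g), and the last two consistency
  -- conditions then give one inequality each.
  have e2 := abs_le.1 (abs_cutoffValueAs_succ_sub_le (M := M) (V := V)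
    (π := Function.update π (H + 1) ρ) (h := 1) (k := H) (g := g) (s := s) (P := P) (Q := P))
  have e3 := abs_le.1 (abs_cutoffValueAs_succ_sub_le (M := M) (V := V)
    (π := π) (h := 0) (k := H) (g := g) (s := s) (P := P) (Q := P))
  have e4 : M.cutoffValueAs V (Function.update π (H + 1) ρ) 1 (H + 1) g s P P ≤
      M.cutoffValueAs V π 0 (H + 1) g s P P := by
    rw [cutoffValueAs_eq_sum_parts P hg fun _ _ => Finset.inter_subset_left,
      cutoffValueAs_eq_sum_parts P hg fun _ _ => Finset.inter_subset_left]
    exact Finset.sum_le_sum fun p hp =>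
      (hρ s P P hP le_rfl).2.2.1 p (Finset.mem_filter.1 hp).1
  have e5 : M.cutoffValueAs V π 0 H g s P P ≤ M.cutoffValueAs V π 1 H g s P P := by
    rw [cutoffValueAs_eq_sum_parts P hg fun _ _ => Finset.inter_subset_left,
      cutoffValueAs_eq_sum_parts P hg fun _ _ => Finset.inter_subset_left]
    exact Finset.sum_le_sum fun p hp =>
      (hρ s P P hP le_rfl).2.2.2 p (Finset.mem_filter.1 hp).1
  rw [planValue, planValue, cutoffValue, cutoffValue, Nat.add_sub_cancel, Nat.sub_zero]
  exact abs_le.2 ⟨by linarith, by linarith⟩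

variable {K : ℝ} (B : M.ErrorBudget V K H π)

include hπ in
/-- Cutting blocks into parts that are far apart hardly changes the value of the policy. -/
theorem abs_planValue_sub_le_cut (hP : IsCutoffState V s P) (hP' : P' ≤ P)
    (hs : FarApart K s P P') (hh : h ≤ 1) (hg : ∀ i ∈ g, P.part i ⊆ g) :
    |M.planValue V H π h g s P - M.planValue V H π h g s P'| ≤ B.cut g P P' := by
  have h1 := cutoffValueAs_finer_le hπ hP hP' hh hg
  have h2 := cutoffValueAs_coarser_le hπ hP hP' hh fun i hi => (le_iff.1 hP' i).trans (hg i hi)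
  -- The cut is made once while the policy follows `P` and once while it follows `P'`; combined with
  -- the coarser and the finer condition these give the two directions.
  have h3 := abs_le.1 (B.abs_sub_le_cut h (H + 1 - h) g s P P' P hP' hs)
  have h4 := abs_le.1 (B.abs_sub_le_cut h (H + 1 - h) g s P P' P' hP' hs)
  unfold planValue cutoffValue at *
  exact abs_le.2 ⟨by linarith, by linarith⟩

include hπ in
/-- Cutting a group out of a block, far from the other agents of the block, hardly changes the
value for this group. -/
theorem planValue_sub_mem_Icc_cut (hP : IsCutoffState V s P) (hP' : P' ≤ P)
    (hs : FarApart K s P P') (hh : h ≤ 1) (hg : ∀ i ∈ g, P'.part i ⊆ g) :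
    M.planValue V H π h g s P' - M.planValue V H π h g s P ∈
      Set.Icc (-B.cut g P P') (2 * B.cut Finset.univ P P' + B.cut g P P') := by
  have hc : ∀ i ∈ gᶜ, P'.part i ⊆ gᶜ := fun i hi j hj => by
    rw [Finset.mem_compl] at hi ⊢
    exact fun hj' => hi (hg j hj' (mem_part_comm.1 hj))
  have h1 := cutoffValueAs_finer_le hπ hP hP' hh (g := Finset.univ)
    fun _ _ => Finset.subset_univ _
  have h2 := cutoffValueAs_coarser_le hπ hP hP' hh hg
  have h2' := cutoffValueAs_coarser_le hπ hP hP' hh hc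
  have h3 := abs_le.1 (B.abs_sub_le_cut h (H + 1 - h) g s P P' P hP' hs)
  have h4 := abs_le.1 (B.abs_sub_le_cut h (H + 1 - h) Finset.univ s P P' P hP' hs)
  have h5 := abs_le.1 (B.abs_sub_le_cut h (H + 1 - h) Finset.univ s P P' P' hP' hs)
  -- For the upper bound the finer condition is missing on `g`, which need not be a union of blocks
  -- of `P`. It does hold for all agents: `P'` improves on the policy following `P` by at most two
  -- full cuts in total. On the complement of `g` it loses nothing, by the coarser condition, so the
  -- gain on `g` is at most this total.
  have h6 := cutoffValueAs_add_compl (M := M) (V := V) (π := π) (h := h) (k := H + 1 - h) (s := s)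
    (Q := P) g hg
  have h7 := cutoffValueAs_add_compl (M := M) (V := V) (π := π) (h := h) (k := H + 1 - h) (s := s)
    (Q := P') g hg
  unfold planValue cutoffValue at *
  exact ⟨by linarith, by linarith⟩

theorem ErrorBudget.loc_nonneg {q : Finset (Fin n)} (hq : q.Nonempty) : 0 ≤ B.loc q := by
  have h1 := B.two_mul_le_loc q hq
  have h2 : 0 ≤ 2 * M.discount ^ (H + 1) * M.weight q :=
    mul_nonneg (mul_nonneg two_pos.le (pow_nonneg M.discount_nonneg _)) (M.weight_nonneg q)
  exact nonneg_of_mul_nonneg_right (h2.trans h1) M.one_sub_discount_pos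

include hπ in
-- The two states are run for one step with equal actions and moves on `q`, which is possible
-- because `q` is a block of both partitions. If `q` stays connected, the bound is applied again to
-- `q`; otherwise it is applied to its parts. The last term is the trivial bound, left over after
-- `m` rounds.
theorem planValue_le_add_loc_add (hKV : K ≤ V) (m : ℕ) {q : Finset (Fin n)}
    {s s' : JointState X Y} {P P' : AgentPartition n} (hP : IsCutoffState V s P)
    (hP' : IsCutoffState V s' P') (hq : q ∈ P.parts) (hq' : q ∈ P'.parts)
    (hs : ∀ i ∈ q, s i = s' i) :
    M.planValue V H π 0 q s P ≤ M.planValue V H π 0 q s' P' + B.loc q +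
      M.discount ^ m * (2 * (M.weight q / (1 - M.discount))) := by
  induction m generalizing q s s' P P' with
  | zero =>
    have h1 := abs_le.1 (abs_planValue_le (M := M) (V := V) (H := H) (π := π) (h := 0) (g := q)
      (s := s) (P := P))
    have h2 := abs_le.1 (abs_planValue_le (M := M) (V := V) (H := H) (π := π) (h := 0) (g := q)
      (s := s') (P := P'))
    have h3 := B.loc_nonneg (P.nonempty_of_mem_parts hq)
    rw [pow_zero, one_mul]
    linarith
  | succ m ih =>
    have hqi : ∀ i ∈ q, P.part i = q := fun i hi => P.part_eq_of_mem hq hi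
    have hqi' : ∀ i ∈ q, P'.part i = q := fun i hi => P'.part_eq_of_mem hq' hi
    have hγ := M.discount_nonneg
    set C := B.loc q + M.discount ^ (m + 1) * (2 * (M.weight q / (1 - M.discount))) with hC
    rw [add_assoc, ← hC, planValue, planValue, cutoffValue, cutoffValue, Nat.sub_zero,
      cutoffValueAs_succ, cutoffValueAs_succ, ← PMF.mean_const (M.stepLaw ((π 0).act s' P')
      (refineBy M.radius P' s') s') C, ← PMF.mean_add _ (M.bddFun_stepValue ..) (.const _)]
    refine PMF.mean_le_of_map_eq _ _ _ _ (stepLaw_map_restr_congr (z := q) ?_ ?_ ?_ hs)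
      (M.bddFun_stepValue ..) ((M.bddFun_stepValue ..).add (.const _)) ?_
    · rw [act_map_restr _ _ hq, act_map_restr _ _ hq']
      congr 1
      exact funext fun i => hs i i.2
    · exact fun i hi => part_refineBy_congr ((hqi i hi).trans (hqi' i hi).symm) fun j hj =>
        hs j (hqi i hi ▸ hj)
    · exact fun i hi => (le_iff.1 (refineBy_le P) i).trans (hqi i hi).subset
    rintro ⟨a, t⟩ - ⟨a', t'⟩ - hr
    have hra : ∀ i ∈ q, a i = a' i := fun i hi => congrFun (Prod.ext_iff.1 hr).1 ⟨i, hi⟩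
    have hrt : ∀ i ∈ q, t i = t' i := fun i hi => congrFun (Prod.ext_iff.1 hr).2 ⟨i, hi⟩
    have key : M.planValue V H π 1 q t (jointPartition V t ⊓ P) ≤
        M.planValue V H π 1 q t' (jointPartition V t' ⊓ P') + 2 * (M.discount ^ H * M.weight q) +
          (B.loc q + M.discount ^ m * (2 * (M.weight q / (1 - M.discount)))) := by
      have hu : ∀ i ∈ q, (jointPartition V t ⊓ P).part i ⊆ q := fun i hi =>
        (le_iff.1 inf_le_right i).trans (hqi i hi).subset
      have hu' : ∀ i ∈ q, (jointPartition V t' ⊓ P').part i ⊆ q := fun i hi =>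
        (le_iff.1 inf_le_right i).trans (hqi' i hi).subset
      have hc : IsCutoffState V t (jointPartition V t ⊓ P) := inf_le_left
      have hc' : IsCutoffState V t' (jointPartition V t' ⊓ P') := inf_le_left
      have h1 := abs_le.1 (abs_planValue_one_sub_zero_le hπ hc hu)
      have h2 := abs_le.1 (abs_planValue_one_sub_zero_le hπ hc' hu')
      -- The new partitions may split `q` differently in the two runs, because visibility chains can
      -- pass through agents outside `q`. The classes of chains inside `q` agree in both runs and
      -- refine both partitions, with gaps larger than `V`.
      have hle : refineBy V P t ≤ jointPartition V t ⊓ P :=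
        le_inf (refineBy_le_jointPartition le_rfl P) (refineBy_le P)
      have hle' : refineBy V P' t' ≤ jointPartition V t' ⊓ P' :=
        le_inf (refineBy_le_jointPartition le_rfl P') (refineBy_le P')
      have hpart : ∀ i ∈ q, (refineBy V P' t').part i = (refineBy V P t).part i := fun i hi =>
        part_refineBy_congr ((hqi' i hi).trans (hqi i hi).symm) fun j hj =>
          (hrt j (hqi' i hi ▸ hj)).symm
      have hS : ∀ i ∈ q, (refineBy V P t).part i ⊆ q := fun i hi =>
        (le_iff.1 (refineBy_le P) i).trans (hqi i hi).subset
      have hS' : ∀ i ∈ q, (refineBy V P' t').part i ⊆ q := fun i hi => hpart i hi ▸ hS i hi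
      suffices h0 : M.planValue V H π 0 q t (jointPartition V t ⊓ P) ≤
          M.planValue V H π 0 q t' (jointPartition V t' ⊓ P') +
            (B.loc q + M.discount ^ m * (2 * (M.weight q / (1 - M.discount)))) by linarith
      -- If `q` is a single class, it is still a block on both sides and nothing has to be cut.
      by_cases hsplit : q ∈ (refineBy V P t).parts
      · obtain ⟨i, hi, hii⟩ := exists_part_eq hsplit
        have e1 : (jointPartition V t ⊓ P).part i = q :=
          (hu i hi).antisymm (hii.symm.subset.trans (le_iff.1 hle i))
        have e2 : (jointPartition V t' ⊓ P').part i = q :=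
          (hu' i hi).antisymm
            ((hii.symm.trans (hpart i hi).symm).subset.trans (le_iff.1 hle' i))
        rw [← add_assoc]
        exact ih hc hc' (e1 ▸ part_mem _ i) (e2 ▸ part_mem _ i) hrt
      · obtain ⟨D, hD, hD'⟩ := B.exists_cut_le q (refineBy V P t) hS hsplit
        have hfar : FarApart K t (jointPartition V t ⊓ P) (refineBy V P t) := fun i j hj hj' =>
          hKV.trans_lt (lt_dist_of_notMem_refineBy (le_iff.1 inf_le_right i hj) hj')
        have hfar' : FarApart K t' (jointPartition V t' ⊓ P') (refineBy V P' t') :=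
          fun i j hj hj' =>
            hKV.trans_lt (lt_dist_of_notMem_refineBy (le_iff.1 inf_le_right i hj) hj')
        have h3 := abs_le.1 (abs_planValue_sub_le_cut hπ B hc hle hfar zero_le_one hu)
        have h4 := abs_le.1 (abs_planValue_sub_le_cut hπ B hc' hle' hfar' zero_le_one hu')
        have h5 := hD (jointPartition V t ⊓ P) (refineBy V P t) fun _ _ => rfl
        have h6 := hD (jointPartition V t' ⊓ P') (refineBy V P' t') hpart
        have h7 : M.planValue V H π 0 q t (refineBy V P t) ≤
            M.planValue V H π 0 q t' (refineBy V P' t') +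
              ∑ r ∈ (refineBy V P t).parts with r ⊆ q, B.loc r +
              M.discount ^ m * (2 * (M.weight q / (1 - M.discount))) := by
          rw [planValue_eq_sum_parts (refineBy V P t) hS fun _ _ => Finset.inter_subset_left,
            planValue_eq_sum_parts (P := refineBy V P' t') (refineBy V P t) hS fun i hi =>
              Finset.inter_subset_left.trans (hpart i hi).subset]
          have hw := M.sum_weight_filter_le (refineBy V P t) q
          calc _ ≤ ∑ r ∈ (refineBy V P t).parts with r ⊆ q,
                (M.planValue V H π 0 r t' (refineBy V P' t') + B.loc r +
                  M.discount ^ m * (2 * (M.weight r / (1 - M.discount)))) := by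
                refine Finset.sum_le_sum fun r hr => ?_
                rw [Finset.mem_filter] at hr
                obtain ⟨i, hi, rfl⟩ := exists_part_eq hr.1
                have hiq := hr.2 hi
                exact ih (refineBy_le_jointPartition le_rfl P)
                  (refineBy_le_jointPartition le_rfl P') (part_mem _ i)
                  (hpart i hiq ▸ part_mem _ i) fun j hj => hrt j (hr.2 hj)
            _ ≤ _ := by
                rw [Finset.sum_add_distrib, Finset.sum_add_distrib, ← Finset.mul_sum,
                  ← Finset.mul_sum, ← Finset.sum_div]
                have := M.one_sub_discount_pos
                gcongr
        linarith
    have hrew : M.cutoffReward q (s, P) a = M.cutoffReward q (s', P') a' :=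
      M.cutoffReward_congr (fun i hi => by rw [hqi i hi, hqi' i hi]) hs hra
    have h8 := mul_le_mul_of_nonneg_left key hγ
    have h9 := B.two_mul_le_loc q (P.nonempty_of_mem_parts hq)
    simp only [stepValue]
    rw [planValue, planValue, cutoffValue, cutoffValue, Nat.add_sub_cancel] at h8
    rw [hrew, hC]
    rw [pow_succ'] at h9 ⊢
    linarith

include hπ in
/-- The value for a block of a cutoff state hardly depends on the states of the other agents. -/
theorem planValue_le_add_loc (hKV : K ≤ V) {q : Finset (Fin n)}
    {s s' : JointState X Y} {P P' : AgentPartition n} (hP : IsCutoffState V s P)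
    (hP' : IsCutoffState V s' P') (hq : q ∈ P.parts) (hq' : q ∈ P'.parts)
    (hs : ∀ i ∈ q, s i = s' i) :
    M.planValue V H π 0 q s P ≤ M.planValue V H π 0 q s' P' + B.loc q := by
  have ht := ((tendsto_pow_atTop_nhds_zero_of_lt_one M.discount_nonneg
    M.discount_lt_one).mul_const (2 * (M.weight q / (1 - M.discount)))).const_add
    (M.planValue V H π 0 q s' P' + B.loc q)
  rw [zero_mul, add_zero] at ht
  exact ge_of_tendsto' ht fun m => planValue_le_add_loc_add hπ B hKV m hP hP' hq hq' hs

end Consistent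

/-! ### Local values -/

section LocalValue

/-- The largest value for the group `q` with the states `s_q`, as a block of a cutoff state. -/
def localValue (M : LocallyInterdependentMDP n X Y A) (V : ℝ) (H : ℕ) (π : ℕ → CutoffPolicy X Y A)
    (q : Finset (Fin n)) (s : JointState X Y) : ℝ :=
  ⨆ x : {x : JointState X Y × AgentPartition n //
    IsCutoffState V x.1 x.2 ∧ q ∈ x.2.parts ∧ ∀ i ∈ q, x.1 i = s i},
    M.planValue V H π 0 q x.1.1 x.1.2

variable {M : LocallyInterdependentMDP n X Y A} {V : ℝ} {H : ℕ} {π : ℕ → CutoffPolicy X Y A}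
  {q z : Finset (Fin n)} {s s' : JointState X Y} {P : AgentPartition n}

theorem planValue_le_localValue (hP : IsCutoffState V s P) (hq : q ∈ P.parts)
    (hs : ∀ i ∈ q, s i = s' i) : M.planValue V H π 0 q s P ≤ M.localValue V H π q s' :=
  le_ciSup (f := fun x : {x : JointState X Y × AgentPartition n //
    IsCutoffState V x.1 x.2 ∧ q ∈ x.2.parts ∧ ∀ i ∈ q, x.1 i = s' i} =>
    M.planValue V H π 0 q x.1.1 x.1.2) ⟨M.weight q / (1 - M.discount), by
      rintro _ ⟨y, rfl⟩
      exact (abs_le.1 abs_planValue_le).2⟩ ⟨(s, P), hP, hq, hs⟩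

theorem abs_localValue_le : |M.localValue V H π q s| ≤ M.weight q / (1 - M.discount) := by
  rcases isEmpty_or_nonempty {x : JointState X Y × AgentPartition n //
    IsCutoffState V x.1 x.2 ∧ q ∈ x.2.parts ∧ ∀ i ∈ q, x.1 i = s i} with h0 | h0
  · rw [localValue, Real.iSup_of_isEmpty, abs_zero]
    exact div_nonneg (M.weight_nonneg q) M.one_sub_discount_pos.le
  · obtain ⟨x, h1, h2, h3⟩ := id h0
    exact abs_le.2 ⟨(abs_le.1 abs_planValue_le).1.trans (planValue_le_localValue h1 h2 h3),
      ciSup_le fun y => (abs_le.1 abs_planValue_le).2⟩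

variable {K : ℝ} (B : M.ErrorBudget V K H π) (hπ : M.IsConsistentPerformance V H π)

include hπ in
theorem localValue_le_planValue_add (hKV : K ≤ V) (hP : IsCutoffState V s P) (hq : q ∈ P.parts)
    (hs : ∀ i ∈ q, s i = s' i) :
    M.localValue V H π q s' ≤ M.planValue V H π 0 q s P + B.loc q := by
  have : Nonempty {x : JointState X Y × AgentPartition n //
      IsCutoffState V x.1 x.2 ∧ q ∈ x.2.parts ∧ ∀ i ∈ q, x.1 i = s' i} := ⟨(s, P), hP, hq, hs⟩
  exact ciSup_le fun x => planValue_le_add_loc hπ B hKV x.2.1 hP x.2.2.1 hq fun i hi =>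
    (x.2.2.2 i hi).trans (hs i hi).symm

include hπ in
/-- The value for a group is close to the sum of the local values of its parts, if these parts are
far apart from each other and from the other agents of the block. -/
theorem planValue_mem_Icc_sum_localValue (hKV : K ≤ V) (S : AgentPartition n)
    (hP : IsCutoffState V s P) (hz : ∀ i ∈ z, S.part i ⊆ z) (hSP : ∀ i ∈ z, S.part i ⊆ P.part i)
    (hfar : ∀ i ∈ z, ∀ j ∈ P.part i, j ∉ S.part i → K < dist (s i).1 (s j).1)
    (hs : ∀ i ∈ z, s i = s' i) {h : ℕ} (hh : h ≤ 1) :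
    M.planValue V H π h z s P ∈ Set.Icc
      (∑ q ∈ S.parts with q ⊆ z, M.localValue V H π q s' - ∑ q ∈ S.parts with q ⊆ z, B.loc q -
        B.upper z - h * (M.discount ^ H * M.weight z))
      (∑ q ∈ S.parts with q ⊆ z, M.localValue V H π q s' + B.lower z +
        h * (M.discount ^ H * M.weight z)) := by
  -- The cut frees `z` from the rest of its blocks and splits it along `S`, but does not split the
  -- other agents further. Every separated pair therefore meets `z`, which matters for the size of
  -- `upper z`.
  have hle : P ⊓ splitAt S z ≤ P := inf_le_left
  have hpart : ∀ i ∈ z, (P ⊓ splitAt S z).part i = S.part i := fun i hi => by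
    ext j
    rw [part_inf, Finset.mem_inter, mem_part_splitAt]
    constructor
    · rintro ⟨-, ⟨-, -, hij⟩ | hij⟩
      · exact hij ▸ mem_part_self S j
      · exact absurd hi hij.1
    · exact fun hj => ⟨hSP i hi hj, Or.inl ⟨hi, hz i hi hj, (part_eq hj).symm⟩⟩
  have hu : ∀ i ∈ z, (P ⊓ splitAt S z).part i ⊆ z := fun i hi => hpart i hi ▸ hz i hi
  have hfar' : FarApart K s P (P ⊓ splitAt S z) := by
    intro i j hj hj'
    by_cases hi : i ∈ z
    · exact hfar i hi j hj (hpart i hi ▸ hj')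
    · have hjz : j ∈ z := by
        by_contra hjz
        exact hj' (by
          rw [part_inf, Finset.mem_inter, mem_part_splitAt]
          exact ⟨hj, Or.inr ⟨hi, hjz⟩⟩)
      rw [dist_comm]
      exact hfar j hjz i (mem_part_comm.1 hj) fun h => hi (hz j hjz h)
  have hP' : IsCutoffState V s (P ⊓ splitAt S z) := hle.trans hP
  have h1 := planValue_sub_mem_Icc_cut hπ B hP hle hfar' hh hu
  have h2 := B.cut_le_lower z P S
  have h3 := B.cut_le_upper z P S
  have h4 : |M.planValue V H π h z s (P ⊓ splitAt S z) -
      M.planValue V H π 0 z s (P ⊓ splitAt S z)| ≤ h * (M.discount ^ H * M.weight z) := by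
    interval_cases h
    · simp
    · simpa using abs_planValue_one_sub_zero_le hπ hP' hu
  have h5 := planValue_eq_sum_parts (M := M) (V := V) (H := H) (π := π) (h := 0) (s := s)
    (P := P ⊓ splitAt S z) S hz fun i hi => Finset.inter_subset_left.trans (hpart i hi).subset
  have hmem : ∀ q ∈ S.parts.filter (· ⊆ z), q ∈ (P ⊓ splitAt S z).parts := fun q hq => by
    rw [Finset.mem_filter] at hq
    obtain ⟨i, hi, rfl⟩ := exists_part_eq hq.1
    exact hpart i (hq.2 hi) ▸ part_mem _ i
  have h6 : ∑ q ∈ S.parts with q ⊆ z, M.planValue V H π 0 q s (P ⊓ splitAt S z) ≤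
      ∑ q ∈ S.parts with q ⊆ z, M.localValue V H π q s' :=
    Finset.sum_le_sum fun q hq => planValue_le_localValue hP' (hmem q hq) fun i hi =>
      hs i ((Finset.mem_filter.1 hq).2 hi)
  have h7 : ∑ q ∈ S.parts with q ⊆ z, M.localValue V H π q s' ≤
      ∑ q ∈ S.parts with q ⊆ z, M.planValue V H π 0 q s (P ⊓ splitAt S z) +
        ∑ q ∈ S.parts with q ⊆ z, B.loc q := by
    rw [← Finset.sum_add_distrib]
    exact Finset.sum_le_sum fun q hq => localValue_le_planValue_add B hπ hKV hP' (hmem q hq)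
      fun i hi => hs i ((Finset.mem_filter.1 hq).2 hi)
  have h8 := abs_le.1 h4
  -- A gain of the cut partition lowers the value of `P` relative to it, so `upper z` enters the
  -- lower bound and `lower z` the upper one.
  exact ⟨by linarith [h1.2], by linarith [h1.1]⟩

end LocalValue

end LocallyInterdependentMDP

theorem PMF.bind_congr {α β : Type*} (μ : PMF α) {f g : α → PMF β}
    (h : ∀ x ∈ μ.support, f x = g x) : μ.bind f = μ.bind g := by
  ext y
  rw [PMF.bind_apply, PMF.bind_apply]
  refine tsum_congr fun x => ?_
  by_cases hx : x ∈ μ.support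
  · rw [h x hx]
  · rw [(μ.apply_eq_zero_iff x).2 hx, zero_mul, zero_mul]

namespace LocallyInterdependentMDP

open AgentPartition

variable {n : ℕ} {X : Type u} [MetricSpace X] {Y : Fin n → Type v} {A : Fin n → Type w}

/-! ### Groups that are isolated by a visibility larger than the dependence radius -/

section Isolated

variable {M : LocallyInterdependentMDP n X Y A} {W : ℝ} {g z : Finset (Fin n)}
  {s : JointState X Y} {i j : Fin n}

theorem lt_dist_of_notMem_block (hz : z ∈ (distPartition W g (restr g s)).parts) (hi : i ∈ z)
    (hj : j ∈ g) (hjz : j ∉ z) : W < dist (s i).1 (s j).1 := by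
  by_contra! hd
  have hpart := (distPartition W g (restr g s)).part_eq_of_mem hz hi
  have hig := (distPartition W g (restr g s)).le hz hi
  exact hjz (hpart ▸ mem_part_distPartition.2 ⟨hig, hj, conn_of_dist_le hig hj hd⟩)

/-- A visibility group is more than `W` away from the other agents of `g`, so chains with steps at
most the radius cannot leave it. -/
theorem conn_iff_of_mem_block (hW : M.radius ≤ W)
    (hz : z ∈ (distPartition W g (restr g s)).parts) (hi : i ∈ z) :
    Conn M.radius g s i j ↔ j ∈ z ∧ Conn M.radius z s i j := by
  constructor
  · intro hc
    have h := hc.of_closed (h := z) fun a ha b hb hd => by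
      by_contra hbz
      exact absurd (hd.trans hW) (not_le.2 (lt_dist_of_notMem_block hz ha hb hbz))
    exact ⟨h.1.1 hi, h.2 hi⟩
  · exact fun h => h.2.mono le_rfl ((distPartition W g (restr g s)).le hz)

theorem mem_part_jointPartition_radius (hW : M.radius ≤ W)
    (hz : z ∈ (jointPartition W s).parts) (hi : i ∈ z) :
    j ∈ (jointPartition M.radius s).part i ↔ j ∈ z ∧ Conn M.radius z s i j := by
  rw [mem_part_jointPartition]
  exact conn_iff_of_mem_block hW hz hi

theorem mem_part_refineBy_radius (hW : M.radius ≤ W) {P : AgentPartition n} (hg : g ∈ P.parts)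
    (hz : z ∈ (distPartition W g (restr g s)).parts) (hi : i ∈ z) :
    j ∈ (refineBy M.radius P s).part i ↔ j ∈ z ∧ Conn M.radius z s i j := by
  have hPi : P.part i = g := P.part_eq_of_mem hg ((distPartition W g (restr g s)).le hz hi)
  rw [mem_part_refineBy, hPi, conn_iff_of_mem_block hW hz hi, and_iff_right_iff_imp]
  exact fun h => (distPartition W g (restr g s)).le hz h.1

theorem reward_eq_sum_groupReward (hW : M.radius ≤ W) (s : JointState X Y) (a : JointAction A) :
    M.reward s a = ∑ z ∈ (jointPartition W s).parts, M.groupReward z s a := by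
  rw [reward_eq_groupReward]
  simp only [groupReward_eq_pairSum]
  refine (sum_pairSum_parts (jointPartition W s) (fun i _ => i)
    (fun z i j => i ∈ z ∧ j ∈ z ∧ Conn M.radius z s i j) (fun z _ i j h => h.1) fun i j => ?_).symm
  simp only [Finset.mem_univ, true_and, mem_part_self]
  exact conn_iff_of_mem_block hW (part_mem (jointPartition W s) i) (mem_part_self _ i)

theorem groupReward_eq_cutoffReward {P : AgentPartition n} (hz : ∀ i ∈ z, z ⊆ P.part i)
    (a : JointAction A) : M.groupReward z s a = M.cutoffReward z (s, P) a := by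
  rw [groupReward_eq_pairSum, cutoffReward_eq_pairSum]
  refine pairSum_congr (fun i j => ?_) fun _ _ _ => rfl
  refine and_congr_right fun hi => and_congr_right fun hj => ?_
  rw [Finset.inter_eq_right.2 (hz i hi), and_iff_right (hz i hi hj)]

end Isolated

/-! ### The values of the beliefs -/

section Beliefs

variable (M : LocallyInterdependentMDP n X Y A) (V : ℝ) (H : ℕ) (π : ℕ → CutoffPolicy X Y A)

/-- The value for the group `z` at the belief `b`. -/
def beliefValue (z : Finset (Fin n)) (b : Belief X Y) : ℝ := by
  classical
  -- Any cutoff state that extends the belief would serve: the estimates below compare its value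
  -- with local values of parts of `z`, which see only the states of `z`.
  exact if hb : b ∈ compStates V then
    M.planValue V H π 0 z hb.choose hb.choose_spec.choose else 0

variable {M V H π}

theorem exists_beliefValue_eq (z : Finset (Fin n)) {b : Belief X Y} (hb : b ∈ compStates V) :
    ∃ (x : JointState X Y) (P : AgentPartition n), IsCutoffState V x P ∧ b.1 ∈ P.parts ∧
      restr b.1 x = b.2 ∧ M.beliefValue V H π z b = M.planValue V H π 0 z x P :=
  ⟨hb.choose, hb.choose_spec.choose, hb.choose_spec.choose_spec.1,
    hb.choose_spec.choose_spec.2.1, hb.choose_spec.choose_spec.2.2, dif_pos hb⟩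

theorem abs_beliefValue_le (z : Finset (Fin n)) (b : Belief X Y) :
    |M.beliefValue V H π z b| ≤ M.weight z / (1 - M.discount) := by
  rw [beliefValue]
  split_ifs
  · exact abs_planValue_le
  · rw [abs_zero]
    exact div_nonneg (M.weight_nonneg z) M.one_sub_discount_pos.le

variable {W : ℝ} (ρ : ValidExtraction X Y W V) {t : ℕ} (τ : Fin (t + 1) → JointState X Y)

/-- A cutoff state that represents a possible belief of the group `z` with true state `s_z`. -/
structure Represents (W V : ℝ) (s : JointState X Y) (z : Finset (Fin n)) (b : Belief X Y)
    (x : JointState X Y) (P : AgentPartition n) : Prop where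
  isCutoffState : IsCutoffState V x P
  mem_parts : b.1 ∈ P.parts
  restr_eq : restr b.1 x = b.2
  mem_block : z ∈ (distPartition W b.1 (restr b.1 x)).parts
  agrees : ∀ i ∈ z, x i = s i

theorem Represents.subset {s : JointState X Y} {z : Finset (Fin n)} {b : Belief X Y}
    {x : JointState X Y} {P : AgentPartition n} (h : Represents W V s z b x P) : z ⊆ b.1 :=
  Finpartition.le _ h.mem_block

theorem Represents.part_eq {s : JointState X Y} {z : Finset (Fin n)} {b : Belief X Y}
    {x : JointState X Y} {P : AgentPartition n} (h : Represents W V s z b x P) {i : Fin n}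
    (hi : i ∈ z) : P.part i = b.1 := P.part_eq_of_mem h.mem_parts (h.subset hi)

theorem exists_represents {z : Finset (Fin n)}
    (hz : z ∈ (jointPartition W (τ (Fin.last t))).parts) {b : Belief X Y}
    (hb : b ∈ (ρ.rho (information W τ z)).support) :
    ∃ (x : JointState X Y) (P : AgentPartition n), Represents W V (τ (Fin.last t)) z b x P ∧
      M.beliefValue V H π z b = M.planValue V H π 0 z x P := by
  obtain ⟨x, P, h1, h2, h3, h4⟩ := exists_beliefValue_eq (M := M) (H := H) (π := π) z
    (ρ.mem_compStates τ z hz b hb)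
  have h5 := ρ.mem_parts τ z hz b hb
  have h6 : ∀ i ∈ z, x i = τ (Fin.last t) i := fun i hi => by
    have hib : i ∈ b.1 := Finpartition.le _ h5 hi
    rw [← ρ.agrees τ z hz b hb i hi hib, ← h3]
  exact ⟨x, P, ⟨h1, h2, h3, h3.symm ▸ h5, h6⟩, h4⟩

variable (M H π)

/-- The expected sum of the values of the beliefs of all visibility groups. -/
def potential : ℝ :=
  ∑ z ∈ (jointPartition W (τ (Fin.last t))).parts,
    (ρ.rho (information W τ z)).mean (M.beliefValue V H π z)

theorem abs_potential_le : |M.potential H π ρ τ| ≤ M.rewardBound / (1 - M.discount) := by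
  refine (Finset.abs_sum_le_sum_abs _ _).trans ?_
  refine (Finset.sum_le_sum fun z _ => PMF.abs_mean_le _ (abs_beliefValue_le z)).trans ?_
  rw [← Finset.sum_div]
  exact div_le_div_of_nonneg_right (M.sum_weight_le _) M.one_sub_discount_pos.le

variable {M H π}

theorem bddFun_beliefValue (z : Finset (Fin n)) : BddFun (M.beliefValue V H π z) :=
  ⟨_, abs_beliefValue_le z⟩

variable {K : ℝ} (B : M.ErrorBudget V K H π) (hπ : M.IsConsistentPerformance V H π)

theorem ErrorBudget.sum_loc_filter_le (S : AgentPartition n) (z : Finset (Fin n)) :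
    ∑ q ∈ S.parts with q ⊆ z, B.loc q ≤ B.locRate * M.weight z := by
  calc _ ≤ ∑ q ∈ S.parts with q ⊆ z, B.locRate * M.weight q :=
        Finset.sum_le_sum fun q hq =>
          B.loc_le q (S.nonempty_of_mem_parts (Finset.mem_filter.1 hq).1)
    _ ≤ _ := by
        rw [← Finset.mul_sum]
        exact mul_le_mul_of_nonneg_left (M.sum_weight_filter_le S z) B.locRate_nonneg

theorem ErrorBudget.sum_rate_le (Q : AgentPartition n) :
    ∑ z ∈ Q.parts, B.locRate * M.weight z ≤ B.locRate * M.rewardBound := by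
  rw [← Finset.mul_sum]
  exact mul_le_mul_of_nonneg_left (M.sum_weight_le Q) B.locRate_nonneg

include hπ in
/-- The potential is close to the sum of the local values of the parts of the visibility groups,
if these parts are far apart. -/
theorem potential_mem_Icc (hKW : K ≤ W) (hWV : W ≤ V) (S : AgentPartition n)
    (hS : S ≤ jointPartition W (τ (Fin.last t)))
    (hfar : FarApart K (τ (Fin.last t)) (jointPartition W (τ (Fin.last t))) S) :
    M.potential H π ρ τ ∈ Set.Icc
      (∑ q ∈ S.parts, M.localValue V H π q (τ (Fin.last t)) - B.locRate * M.rewardBound -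
        B.upperTotal)
      (∑ q ∈ S.parts, M.localValue V H π q (τ (Fin.last t)) + B.lowerTotal) := by
  have key : ∀ z ∈ (jointPartition W (τ (Fin.last t))).parts,
      (ρ.rho (information W τ z)).mean (M.beliefValue V H π z) ∈ Set.Icc
        (∑ q ∈ S.parts with q ⊆ z, M.localValue V H π q (τ (Fin.last t)) -
          B.locRate * M.weight z - B.upper z)
        (∑ q ∈ S.parts with q ⊆ z, M.localValue V H π q (τ (Fin.last t)) + B.lower z) := by
    intro z hz
    have hpt : ∀ b ∈ (ρ.rho (information W τ z)).support, M.beliefValue V H π z b ∈ Set.Icc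
        (∑ q ∈ S.parts with q ⊆ z, M.localValue V H π q (τ (Fin.last t)) -
          B.locRate * M.weight z - B.upper z)
        (∑ q ∈ S.parts with q ⊆ z, M.localValue V H π q (τ (Fin.last t)) + B.lower z) := by
      intro b hb
      obtain ⟨x, P, hx, hval⟩ := exists_represents (M := M) (H := H) (π := π) ρ τ hz hb
      have hZ : ∀ i ∈ z, (jointPartition W (τ (Fin.last t))).part i = z := fun i hi =>
        Finpartition.part_eq_of_mem _ hz hi
      have hSz : ∀ i ∈ z, S.part i ⊆ z := fun i hi => (le_iff.1 hS i).trans (hZ i hi).subset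
      -- Distances inside `z` are the true ones, as the belief agrees with the truth on `z`. The
      -- other agents of the belief block may be imagined, but they are farther than `W` away
      -- because `z` is a visibility group of the belief.
      have h := planValue_mem_Icc_sum_localValue B hπ (hKW.trans hWV) S hx.isCutoffState hSz
        (fun i hi => (hSz i hi).trans (hx.subset.trans (hx.part_eq hi).superset))
        (fun i hi j hj hj' => by
          by_cases hjz : j ∈ z
          · rw [hx.agrees i hi, hx.agrees j hjz]
            exact hfar i j ((hZ i hi).symm ▸ hjz) hj'
          · exact hKW.trans_lt (lt_dist_of_notMem_block hx.mem_block hi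
              (hx.part_eq hi ▸ hj) hjz)) hx.agrees zero_le_one
      have h' := B.sum_loc_filter_le S z
      rw [Nat.cast_zero, zero_mul, sub_zero, add_zero] at h
      rw [hval]
      exact ⟨by linarith [h.1], h.2⟩
    exact ⟨PMF.le_mean _ (bddFun_beliefValue z) fun b hb => (hpt b hb).1,
      PMF.mean_le _ (bddFun_beliefValue z) fun b hb => (hpt b hb).2⟩
  have h1 := Finset.sum_le_sum fun z hz => (key z hz).1
  have h2 := Finset.sum_le_sum fun z hz => (key z hz).2
  rw [Finset.sum_sub_distrib, Finset.sum_sub_distrib, sum_parts_of_le hS] at h1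
  rw [Finset.sum_add_distrib, sum_parts_of_le hS] at h2
  have h3 := B.sum_rate_le (jointPartition W (τ (Fin.last t)))
  have h4 := B.sum_lower_le (jointPartition W (τ (Fin.last t)))
  have h5 := B.sum_upper_le (jointPartition W (τ (Fin.last t)))
  exact ⟨by unfold potential; linarith, by unfold potential; linarith⟩

/-! ### One step of the execution -/

/-- The reward of the group `z` plus the discounted local values of its parts after one step. -/
def groupStep (M : LocallyInterdependentMDP n X Y A) (V W : ℝ) (H : ℕ) (π : ℕ → CutoffPolicy X Y A)
    (s : JointState X Y) (z : Finset (Fin n)) (x : JointAction A × JointState X Y) : ℝ :=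
  M.groupReward z s x.1 + M.discount *
    ∑ q ∈ (refineBy W (jointPartition W s) x.2).parts with q ⊆ z, M.localValue V H π q x.2

theorem abs_groupReward_le (z : Finset (Fin n)) (s : JointState X Y) (a : JointAction A) :
    |M.groupReward z s a| ≤ M.weight z := by
  rw [groupReward_eq_pairSum]
  exact abs_pairSum_le (fun i j h => ⟨h.1, h.2.1⟩) fun i j => M.abs_pairReward_le i j _ _ _ _

theorem bddFun_groupStep (s : JointState X Y) (z : Finset (Fin n)) :
    BddFun (M.groupStep V W H π s z) := by
  refine BddFun.add ⟨M.weight z, fun x => abs_groupReward_le z s x.1⟩ (BddFun.const_mul _ ?_)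
  refine ⟨M.weight z / (1 - M.discount), fun x => (Finset.abs_sum_le_sum_abs _ _).trans
    ((Finset.sum_le_sum fun q _ => abs_localValue_le).trans ?_)⟩
  rw [← Finset.sum_div]
  exact div_le_div_of_nonneg_right (M.sum_weight_filter_le _ z) M.one_sub_discount_pos.le

include hπ in
/-- Under the extracted policy, a group acts and moves as in its belief, and the value of the
belief is almost the reward plus the discounted local values after one step. -/
theorem mean_groupStep_mem_Icc (hR : M.radius ≤ W) (hKW : K + 2 ≤ W) (hWV : W ≤ V)
    {z : Finset (Fin n)} (hz : z ∈ (jointPartition W (τ (Fin.last t))).parts) :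
    (M.stepLaw (execAct ρ (π 0) τ) (jointPartition M.radius (τ (Fin.last t)))
      (τ (Fin.last t))).mean (M.groupStep V W H π (τ (Fin.last t)) z) ∈ Set.Icc
        ((ρ.rho (information W τ z)).mean (M.beliefValue V H π z) -
          M.discount * (B.lower z + M.discount ^ H * M.weight z))
        ((ρ.rho (information W τ z)).mean (M.beliefValue V H π z) +
          M.discount * (B.locRate * M.weight z + B.upper z + M.discount ^ H * M.weight z)) := by
  set s := τ (Fin.last t) with hs
  set β := ρ.rho (information W τ z) with hβ
  have hne : Nonempty (JointState X Y) := ⟨s⟩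
  have hrep : ∀ b : Belief X Y, b ∈ β.support → ∃ (x : JointState X Y) (P : AgentPartition n),
      Represents W V s z b x P ∧ M.beliefValue V H π z b = M.planValue V H π 0 z x P :=
    fun b hb => exists_represents ρ τ hz hb
  choose! x P hx hval using hrep
  let r : JointAction A × JointState X Y → (∀ i : z, A i) × (∀ i : z, X × Y i) :=
    fun y => (restr z y.1, restr z y.2)
  let law : Belief X Y → PMF (JointAction A × JointState X Y) := fun b =>
    M.stepLaw ((π 0).act (x b) (P b)) (refineBy M.radius (P b) (x b)) (x b)
  have hZ : ∀ i ∈ z, (jointPartition W s).part i = z := fun i hi =>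
    Finpartition.part_eq_of_mem _ hz hi
  -- Restricted to `z`, executing is the same as drawing a belief, letting the plan act on the whole
  -- cutoff state that represents it, and keeping the actions of `z`.
  have hact : (execAct ρ (π 0) τ).map (restr z) =
      (β.bind fun b => (π 0).act (x b) (P b)).map (restr z) := by
    rw [execAct, blockLaw_map_restr _ hz, PMF.map_bind]
    obtain ⟨ν, hν, hν'⟩ := PMF.exists_bindOnSupport_eq_bind β fun b hb =>
      ((π 0 b.1 b.2).map fun a i =>
        a ⟨i.1, (distPartition W b.1 b.2).le (ρ.mem_parts τ z hz b hb) i.2⟩ :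
          PMF (GroupAction A z))
    refine hν'.trans (PMF.bind_congr _ fun b hb => ?_)
    rw [hν b hb, act_map_restr_of_subset _ _ (hx b hb).mem_parts (hx b hb).subset,
      (hx b hb).restr_eq]
  -- The true and the believed step agree on `z`, since `z` contains the dependence classes of its
  -- agents and these are the same in truth and in the belief. The second law remembers `b`, which
  -- is needed to evaluate the value of the belief.
  have hmap : (M.stepLaw (execAct ρ (π 0) τ) (jointPartition M.radius s) s).map r =
      (β.bind fun b => (law b).map (Prod.mk b)).map (fun y => r y.2) := by
    have e1 : (M.stepLaw (execAct ρ (π 0) τ) (jointPartition M.radius s) s).map r =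
        (M.stepLaw (β.bind fun b => (π 0).act (x b) (P b)) (jointPartition M.radius s) s).map r :=
      stepLaw_map_restr_congr hact (fun _ _ => rfl)
        (fun i hi j hj => ((mem_part_jointPartition_radius hR hz hi).1 hj).1) fun _ _ => rfl
    rw [e1, stepLaw, PMF.bind_bind, PMF.map_bind, PMF.map_bind]
    refine PMF.bind_congr _ fun b hb => ?_
    rw [PMF.map_comp]
    refine stepLaw_map_restr_congr (M := M) (z := z) rfl (fun i hi => ?_)
      (fun i hi j hj => ((mem_part_jointPartition_radius hR hz hi).1 hj).1)
      fun i hi => ((hx b hb).agrees i hi).symm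
    ext j
    rw [mem_part_jointPartition_radius hR hz hi,
      mem_part_refineBy_radius hR (hx b hb).mem_parts (hx b hb).mem_block hi,
      conn_congr fun k hk => ((hx b hb).agrees k hk).symm]
  have hb1 : BddFun fun y : Belief X Y × (JointAction A × JointState X Y) =>
      M.stepValue V π 0 H z (x y.1) (P y.1) (P y.1) y.2 := by
    refine BddFun.add ⟨M.weight z, fun _ => M.abs_cutoffReward_le z _ _⟩
      (BddFun.const_mul _ ⟨_, fun _ => M.abs_cutoffValueAs_le V π _ _ z _ _ _⟩)
  have hmean : (β.bind fun b => (law b).map (Prod.mk b)).mean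
      (fun y => M.stepValue V π 0 H z (x y.1) (P y.1) (P y.1) y.2) =
      β.mean (M.beliefValue V H π z) := by
    rw [PMF.mean_bind _ _ hb1]
    refine PMF.mean_congr _ fun b hb => ?_
    rw [PMF.mean_map _ _ hb1, hval b hb, planValue, cutoffValue, Nat.sub_zero, cutoffValueAs_succ]
  have key : ∀ y ∈ (M.stepLaw (execAct ρ (π 0) τ) (jointPartition M.radius s) s).support,
      ∀ y' ∈ (β.bind fun b => (law b).map (Prod.mk b)).support, r y = r y'.2 →
      M.groupStep V W H π s z y ∈ Set.Icc
        (M.stepValue V π 0 H z (x y'.1) (P y'.1) (P y'.1) y'.2 -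
          M.discount * (B.lower z + M.discount ^ H * M.weight z))
        (M.stepValue V π 0 H z (x y'.1) (P y'.1) (P y'.1) y'.2 +
          M.discount * (B.locRate * M.weight z + B.upper z + M.discount ^ H * M.weight z)) := by
    rintro ⟨a, u⟩ - y' hy' hr
    obtain ⟨b, hb, hy'⟩ := (PMF.mem_support_bind_iff _ _ _).1 hy'
    obtain ⟨⟨a', u'⟩, hau, rfl⟩ := (PMF.mem_support_map_iff _ _ _).1 hy'
    have hra : ∀ i ∈ z, a i = a' i := fun i hi => congrFun (Prod.ext_iff.1 hr).1 ⟨i, hi⟩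
    have hru : ∀ i ∈ z, u i = u' i := fun i hi => congrFun (Prod.ext_iff.1 hr).2 ⟨i, hi⟩
    have hxb := hx b hb
    have hSz : ∀ i ∈ z, (refineBy W (jointPartition W s) u).part i ⊆ z := fun i hi =>
      (le_iff.1 (refineBy_le _) i).trans (hZ i hi).subset
    have h1 : M.groupReward z s a = M.cutoffReward z (x b, P b) a' := by
      rw [groupReward_eq_cutoffReward (P := P b) fun i hi =>
        hxb.subset.trans (hxb.part_eq hi).superset]
      exact M.cutoffReward_congr (fun _ _ => rfl) (fun i hi => (hxb.agrees i hi).symm) hra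
    -- The continuation of the belief, a value from time 1, is compared with the local values in the
    -- true next state. The two next states agree on `z`, so the parts of `z` under chains inside
    -- `z` are common to both.
    have h2 := planValue_mem_Icc_sum_localValue (h := 1) (s := u') (s' := u) (z := z)
      (P := jointPartition V u' ⊓ P b) B hπ ((by linarith : K ≤ W).trans hWV)
      (refineBy W (jointPartition W s) u) inf_le_left hSz
      (fun i hi j hj => by
        have hjz := hSz i hi hj
        rw [part_inf, Finset.mem_inter, mem_part_jointPartition, hxb.part_eq hi]
        have hc := (mem_part_refineBy.1 hj).2
        rw [hZ i hi, conn_congr hru] at hc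
        exact ⟨hc.mono hWV (Finset.subset_univ _), hxb.subset hjz⟩)
      (fun i hi j hj hj' => by
        rw [part_inf, Finset.mem_inter, hxb.part_eq hi] at hj
        by_cases hjz : j ∈ z
        · have := lt_dist_of_notMem_refineBy ((hZ i hi).symm ▸ hjz) hj'
          rw [← hru i hi, ← hru j hjz]
          linarith
        · have h3 := lt_dist_of_notMem_block hxb.mem_block hi hj.2 hjz
          have h4 := dist_sub_two_le hau i j
          simp only at h4
          linarith)
      (fun i hi => (hru i hi).symm) le_rfl
    have h3 := B.sum_loc_filter_le (refineBy W (jointPartition W s) u) z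
    have hγ := M.discount_nonneg
    rw [Nat.cast_one, one_mul, planValue, cutoffValue, Nat.add_sub_cancel] at h2
    simp only [groupStep, stepValue, h1]
    constructor
    · have := mul_le_mul_of_nonneg_left h2.2 hγ
      simp only [mul_add] at this ⊢
      linarith
    · have h5 := h2.1
      have := mul_le_mul_of_nonneg_left (by linarith : ∑ q ∈
        (refineBy W (jointPartition W s) u).parts with q ⊆ z, M.localValue V H π q u ≤
        M.cutoffValueAs V π (0 + 1) H z u' (jointPartition V u' ⊓ P b) (jointPartition V u' ⊓ P b) +
        (B.locRate * M.weight z + B.upper z + M.discount ^ H * M.weight z)) hγ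
      rw [mul_add] at this
      linarith
  rw [← hmean]
  constructor
  · have h := PMF.mean_le_of_map_eq _ _ _ _ hmap.symm hb1 ((bddFun_groupStep s z).add
      (.const (M.discount * (B.lower z + M.discount ^ H * M.weight z)))) fun y' hy' y hy hr => by
        linarith [(key y hy y' hy' hr.symm).1]
    rw [PMF.mean_add _ (bddFun_groupStep s z) (.const _), PMF.mean_const] at h
    linarith
  · have h := PMF.mean_le_of_map_eq _ _ _ _ hmap (bddFun_groupStep s z) (hb1.add
      (.const (M.discount * (B.locRate * M.weight z + B.upper z + M.discount ^ H * M.weight z))))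
      fun y hy y' hy' hr => (key y hy y' hy' hr).2
    rw [PMF.mean_add _ hb1 (.const _), PMF.mean_const] at h
    exact h

end Beliefs

end LocallyInterdependentMDP

/-- Discounted sums telescope up to a bounded error in each step. -/
theorem abs_tsum_discounted_sub_le {γ δ C D : ℝ} (h0 : 0 ≤ γ) (h1 : γ < 1) {r E : ℕ → ℝ}
    (hr : ∀ t, |r t| ≤ C) (hE : ∀ t, |E t| ≤ D) (h : ∀ t, |r t + γ * E (t + 1) - E t| ≤ δ) :
    |∑' t, γ ^ t * r t - E 0| ≤ δ / (1 - γ) := by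
  have hg := summable_geometric_of_lt_one h0 h1
  have habs : ∀ {f : ℕ → ℝ} {c : ℝ}, (∀ t, |f t| ≤ c) → Summable fun t => γ ^ t * f t := by
    intro f c hf
    refine Summable.of_norm_bounded (hg.mul_right c) fun t => ?_
    rw [Real.norm_eq_abs, abs_mul, abs_of_nonneg (pow_nonneg h0 t)]
    exact mul_le_mul_of_nonneg_left (hf t) (pow_nonneg h0 t)
  have hsE := habs hE
  have hsr := habs hr
  have hsE' : Summable fun t => γ ^ (t + 1) * E (t + 1) := (summable_nat_add_iff 1).2 hsE
  have hsd := habs h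
  have e1 : ∑' t, γ ^ t * r t - E 0 = ∑' t, γ ^ t * (r t + γ * E (t + 1) - E t) := by
    have e2 := hsE.tsum_eq_zero_add
    have e3 : ∀ t, γ ^ t * (r t + γ * E (t + 1) - E t) =
        γ ^ t * r t + γ ^ (t + 1) * E (t + 1) - γ ^ t * E t := fun t => by ring
    simp_rw [e3]
    rw [(hsr.add hsE').tsum_sub hsE, hsr.tsum_add hsE', e2, pow_zero, one_mul]
    ring
  rw [e1, div_eq_mul_inv, mul_comm, ← tsum_geometric_of_lt_one h0 h1, ← tsum_mul_right,
    ← Real.norm_eq_abs]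
  refine tsum_of_norm_bounded (hg.mul_right δ).hasSum fun t => ?_
  rw [Real.norm_eq_abs, abs_mul, abs_of_nonneg (pow_nonneg h0 t)]
  exact mul_le_mul_of_nonneg_left (h t) (pow_nonneg h0 t)

namespace LocallyInterdependentMDP

open AgentPartition

variable {n : ℕ} {X : Type u} [MetricSpace X] {Y : Fin n → Type v} {A : Fin n → Type w}

/-! ### The value of the extracted policy -/

section Execution

variable {M : LocallyInterdependentMDP n X Y A} {V W K : ℝ} {H : ℕ} {π : ℕ → CutoffPolicy X Y A}
  (B : M.ErrorBudget V K H π) (hπ : M.IsConsistentPerformance V H π)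
  (ρ : ValidExtraction X Y W V)

theorem abs_reward_le (s : JointState X Y) (a : JointAction A) :
    |M.reward s a| ≤ M.rewardBound := by
  rw [reward_eq_groupReward, ← weight_univ]
  exact abs_groupReward_le _ s a

/-- The reward of a step plus the discounted potential after this step. -/
def potentialStep (M : LocallyInterdependentMDP n X Y A) (H : ℕ) (π : ℕ → CutoffPolicy X Y A)
    (ρ : ValidExtraction X Y W V) {t : ℕ} (τ : Fin (t + 1) → JointState X Y)
    (x : JointAction A × JointState X Y) : ℝ :=
  M.reward (τ (Fin.last t)) x.1 + M.discount *
    M.potential H π ρ (Fin.snoc (α := fun _ : Fin (t + 2) => JointState X Y) τ x.2)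

theorem bddFun_potentialStep {t : ℕ} (τ : Fin (t + 1) → JointState X Y) :
    BddFun (M.potentialStep H π ρ τ) :=
  BddFun.add ⟨_, fun _ => abs_reward_le _ _⟩
    (BddFun.const_mul _ ⟨_, fun _ => abs_potential_le M H π ρ _⟩)

/-- The error of the potential in one step of the execution. -/
def ErrorBudget.stepError : ℝ :=
  M.discount * (B.lowerTotal + B.upperTotal + B.locRate * M.rewardBound +
    M.discount ^ H * M.rewardBound)

include hπ in
theorem abs_mean_potentialStep_sub_le (hR : M.radius ≤ W) (hKW : K + 2 ≤ W) (hWV : W ≤ V)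
    {t : ℕ} (τ : Fin (t + 1) → JointState X Y) :
    |(M.stepLaw (execAct ρ (π 0) τ) (jointPartition M.radius (τ (Fin.last t)))
      (τ (Fin.last t))).mean (M.potentialStep H π ρ τ) - M.potential H π ρ τ| ≤ B.stepError := by
  set s := τ (Fin.last t) with hs
  set μ := M.stepLaw (execAct ρ (π 0) τ) (jointPartition M.radius s) s with hμ
  have hγ := M.discount_nonneg
  have hbG : BddFun fun x => ∑ z ∈ (jointPartition W s).parts, M.groupStep V W H π s z x :=
    BddFun.sum _ fun z _ => bddFun_groupStep s z
  have hbP := bddFun_potentialStep (M := M) (H := H) (π := π) ρ τ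
  have key : ∀ x ∈ μ.support, M.potentialStep H π ρ τ x ∈ Set.Icc
      ((∑ z ∈ (jointPartition W s).parts, M.groupStep V W H π s z x) +
        -(M.discount * (B.locRate * M.rewardBound + B.upperTotal)))
      ((∑ z ∈ (jointPartition W s).parts, M.groupStep V W H π s z x) +
        M.discount * B.lowerTotal) := by
    intro x hx
    have hlast : (Fin.snoc (α := fun _ : Fin (t + 2) => JointState X Y) τ x.2) (Fin.last (t + 1)) =
        x.2 := Fin.snoc_last ..
    have h := potential_mem_Icc ρ (Fin.snoc (α := fun _ : Fin (t + 2) => JointState X Y) τ x.2) B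
      hπ (by linarith) hWV (refineBy W (jointPartition W s) x.2)
      (by rw [hlast]; exact refineBy_le_jointPartition le_rfl _)
      (by
        rw [hlast]
        -- Agents of one old group in different parts are farther than `W` apart now; agents of
        -- different old groups were so before the step and have approached by at most 2.
        intro i j _ hj'
        by_cases hij : j ∈ (jointPartition W s).part i
        · linarith [lt_dist_of_notMem_refineBy hij hj']
        · linarith [lt_dist_of_notMem_jointPartition hij, dist_sub_two_le hx i j])
    rw [hlast] at h
    have hsum : ∑ z ∈ (jointPartition W s).parts, M.groupStep V W H π s z x =
        M.reward s x.1 + M.discount * ∑ q ∈ (refineBy W (jointPartition W s) x.2).parts,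
          M.localValue V H π q x.2 := by
      simp only [groupStep]
      rw [Finset.sum_add_distrib, ← reward_eq_sum_groupReward hR, ← Finset.mul_sum,
        sum_parts_of_le (refineBy_le _)]
    have h1 := mul_le_mul_of_nonneg_left h.1 hγ
    have h2 := mul_le_mul_of_nonneg_left h.2 hγ
    rw [hsum, potentialStep]
    constructor
    · linarith
    · linarith
  have h1 := PMF.mean_mono μ (hbG.add (.const _)) hbP fun x hx => (key x hx).1
  have h2 := PMF.mean_mono μ hbP (hbG.add (.const _)) fun x hx => (key x hx).2
  rw [PMF.mean_add _ hbG (.const _), PMF.mean_const,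
    PMF.mean_sum _ _ fun z _ => bddFun_groupStep s z] at h1 h2
  have h3 := Finset.sum_le_sum fun z hz =>
    (mean_groupStep_mem_Icc ρ τ B hπ hR hKW hWV (z := z) hz).1
  have h4 := Finset.sum_le_sum fun z hz =>
    (mean_groupStep_mem_Icc ρ τ B hπ hR hKW hWV (z := z) hz).2
  rw [Finset.sum_sub_distrib, ← Finset.mul_sum, Finset.sum_add_distrib, ← Finset.mul_sum] at h3
  rw [Finset.sum_add_distrib, ← Finset.mul_sum, Finset.sum_add_distrib, Finset.sum_add_distrib,
    ← Finset.mul_sum (f := M.weight) (a := M.discount ^ H)] at h4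
  have h5 := mul_le_mul_of_nonneg_left (B.sum_lower_le (jointPartition W s)) hγ
  have h6 := mul_le_mul_of_nonneg_left (B.sum_upper_le (jointPartition W s)) hγ
  have h7 := mul_le_mul_of_nonneg_left (B.sum_rate_le (jointPartition W s)) hγ
  have h8 := mul_le_mul_of_nonneg_left (mul_le_mul_of_nonneg_left
    (M.sum_weight_le (jointPartition W s)) (pow_nonneg hγ H)) hγ
  rw [ErrorBudget.stepError]
  unfold potential at *
  simp only [mul_add] at *
  exact abs_le.2 ⟨by linarith, by linarith⟩

variable (M H π) in
/-- The expected potential at time `t`. -/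
def meanPotential (s : JointState X Y) (t : ℕ) : ℝ :=
  (M.execHistory ρ (π 0) s t).mean (M.potential H π ρ)

include hπ in
theorem abs_execReward_add_sub_le (hR : M.radius ≤ W) (hKW : K + 2 ≤ W) (hWV : W ≤ V)
    (s : JointState X Y) (t : ℕ) :
    |M.execReward ρ (π 0) s t + M.discount * M.meanPotential H π ρ s (t + 1) -
      M.meanPotential H π ρ s t| ≤ B.stepError := by
  have hbΦ : ∀ t, BddFun (M.potential H π ρ (t := t)) := fun t =>
    ⟨_, abs_potential_le M H π ρ⟩
  let law : (Fin (t + 1) → JointState X Y) → PMF (JointAction A × JointState X Y) := fun τ =>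
    M.stepLaw (execAct ρ (π 0) τ) (jointPartition M.radius (τ (Fin.last t))) (τ (Fin.last t))
  have hbr : ∀ τ : Fin (t + 1) → JointState X Y,
      BddFun fun x : JointAction A × JointState X Y => M.reward (τ (Fin.last t)) x.1 :=
    fun τ => ⟨_, fun x => abs_reward_le _ _⟩
  have hbs : ∀ τ : Fin (t + 1) → JointState X Y,
      BddFun fun x : JointAction A × JointState X Y =>
        M.potential H π ρ (Fin.snoc (α := fun _ : Fin (t + 2) => JointState X Y) τ x.2) :=
    fun τ => ⟨_, fun x => abs_potential_le M H π ρ _⟩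
  have e1 : M.execReward ρ (π 0) s t = (M.execHistory ρ (π 0) s t).mean fun τ =>
      (law τ).mean fun x => M.reward (τ (Fin.last t)) x.1 := by
    refine PMF.mean_congr _ fun τ _ => ?_
    rw [mean_stepLaw (hbr τ)]
    simp only [PMF.mean_const]
  have e2 : M.meanPotential H π ρ s (t + 1) = (M.execHistory ρ (π 0) s t).mean fun τ =>
      (law τ).mean fun x =>
        M.potential H π ρ (Fin.snoc (α := fun _ : Fin (t + 2) => JointState X Y) τ x.2) := by
    rw [meanPotential, execHistory, PMF.mean_bind _ _ (hbΦ (t + 1))]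
    refine PMF.mean_congr _ fun τ _ => ?_
    rw [PMF.mean_bind _ _ (hbΦ (t + 1)), mean_stepLaw (hbs τ)]
    refine PMF.mean_congr _ fun a _ => ?_
    rw [PMF.mean_map _ _ (hbΦ (t + 1)), trans]
  have hb1 : BddFun fun τ : Fin (t + 1) → JointState X Y =>
      (law τ).mean fun x => M.reward (τ (Fin.last t)) x.1 :=
    PMF.bddFun_mean law ⟨M.rewardBound, fun x => abs_reward_le _ _⟩
  have hb2 : BddFun fun τ : Fin (t + 1) → JointState X Y => (law τ).mean fun x =>
        M.potential H π ρ (Fin.snoc (α := fun _ : Fin (t + 2) => JointState X Y) τ x.2) :=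
    PMF.bddFun_mean law ⟨_, fun x => abs_potential_le M H π ρ _⟩
  rw [e1, e2, ← PMF.mean_const_mul, ← PMF.mean_add _ hb1 (hb2.const_mul _), meanPotential]
  refine PMF.abs_mean_sub_mean_le _ (hb1.add (hb2.const_mul _)) (hbΦ t) fun τ _ => ?_
  rw [← PMF.mean_const_mul, ← PMF.mean_add _ (hbr τ) ((hbs τ).const_mul _)]
  exact abs_mean_potentialStep_sub_le B hπ ρ hR hKW hWV τ

include hπ in
theorem abs_meanPotential_zero_sub_execValue_le (hR : M.radius ≤ W) (hKW : K + 2 ≤ W)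
    (hWV : W ≤ V) (s : JointState X Y) :
    |M.meanPotential H π ρ s 0 - M.execValue ρ (π 0) s| ≤
      B.stepError / (1 - M.discount) := by
  rw [abs_sub_comm]
  exact abs_tsum_discounted_sub_le M.discount_nonneg M.discount_lt_one
    (fun t => PMF.abs_mean_le _ fun τ => PMF.abs_mean_le _ fun a => abs_reward_le _ _)
    (fun t => PMF.abs_mean_le _ (abs_potential_le M H π ρ))
    (abs_execReward_add_sub_le B hπ ρ hR hKW hWV s)

include hπ in
-- Both quantities are compared with the sum of the local values of the initial visibility groups:
-- the plan by cutting its partition for visibility `V` down to the one for `W`, the potential by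
-- `potential_mem_Icc`.
theorem abs_planValue_sub_meanPotential_zero_le (hKW : K ≤ W) (hWV : W ≤ V)
    (s : JointState X Y) :
    |M.planValue V H π 0 Finset.univ s (jointPartition V s) - M.meanPotential H π ρ s 0| ≤
      B.lowerTotal + B.upperTotal + B.locRate * M.rewardBound := by
  have hle : jointPartition W s ≤ jointPartition V s := jointPartition_mono hWV
  have h1 := abs_le.1 (abs_planValue_sub_le_cut hπ B (P := jointPartition V s) le_rfl hle
    (fun i j _ hj => hKW.trans_lt (lt_dist_of_notMem_jointPartition hj)) zero_le_one
    (g := Finset.univ) fun _ _ => Finset.subset_univ _)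
  have h2 := potential_mem_Icc ρ (fun _ : Fin 1 => s) B hπ hKW hWV (jointPartition W s) le_rfl
    fun i j hj hj' => absurd hj hj'
  have h3 := planValue_eq_sum_parts (M := M) (V := V) (H := H) (π := π) (h := 0) (s := s)
    (P := jointPartition W s) (z := Finset.univ) (jointPartition W s)
    (fun _ _ => Finset.subset_univ _) fun _ _ => Finset.inter_subset_left
  rw [Finset.filter_true_of_mem fun p _ => Finset.subset_univ p] at h3
  have h4 : ∑ q ∈ (jointPartition W s).parts, M.planValue V H π 0 q s (jointPartition W s) ≤
      ∑ q ∈ (jointPartition W s).parts, M.localValue V H π q s :=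
    Finset.sum_le_sum fun q hq => planValue_le_localValue hle hq fun _ _ => rfl
  have h5 : ∑ q ∈ (jointPartition W s).parts, M.localValue V H π q s ≤
      ∑ q ∈ (jointPartition W s).parts, M.planValue V H π 0 q s (jointPartition W s) +
        B.locRate * M.rewardBound := by
    refine le_trans ?_ (add_le_add_right (B.sum_rate_le (jointPartition W s)) _)
    rw [← Finset.sum_add_distrib]
    exact Finset.sum_le_sum fun q hq =>
      (localValue_le_planValue_add B hπ (hKW.trans hWV) hle hq fun _ _ => rfl).trans
        (add_le_add_right (B.loc_le q (Finpartition.nonempty_of_mem_parts _ hq)) _)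
  have h6 := B.cut_univ_le (jointPartition V s) (jointPartition W s)
  have h7 := B.lowerTotal_le
  have h8 : M.meanPotential H π ρ s 0 = M.potential H π ρ (fun _ : Fin 1 => s) :=
    PMF.mean_pure _ _
  rw [h8]
  exact abs_le.2 ⟨by linarith [h2.2], by linarith [h2.1]⟩

include hπ in
/-- The extracted policy loses little compared with the plan. -/
theorem abs_planValue_sub_execValue_le (hR : M.radius ≤ W) (hKW : K + 2 ≤ W) (hWV : W ≤ V)
    (s : JointState X Y) :
    |M.planValue V H π 0 Finset.univ s (jointPartition V s) - M.execValue ρ (π 0) s| ≤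
      (B.lowerTotal + B.upperTotal + B.locRate * M.rewardBound +
        M.discount ^ (H + 1) * M.rewardBound) / (1 - M.discount) := by
  have h1 := abs_planValue_sub_meanPotential_zero_le B hπ ρ (by linarith) hWV s
  have h2 := abs_meanPotential_zero_sub_execValue_le B hπ ρ hR hKW hWV s
  have h3 := M.one_sub_discount_pos
  refine (abs_sub_le _ (M.meanPotential H π ρ s 0) _).trans ((add_le_add h1 h2).trans_eq ?_)
  -- With X the initial error, the step error is γ(X + γ^H r̃), and X + γ(X + γ^H r̃) / (1 - γ) = (X
  -- + γ^(H+1) r̃) / (1 - γ).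
  rw [ErrorBudget.stepError]
  field_simp
  ring

end Execution

/-! ### Error budgets -/

section Budgets

variable (M : LocallyInterdependentMDP n X Y A) (V : ℝ) {K : ℝ} {c H : ℕ}
  (π : ℕ → CutoffPolicy X Y A)

/-- The discounted weight `∑_{t ≥ c} γ^t` of the time steps after which far apart groups can
interact. -/
def tailWeight (c : ℕ) : ℝ := M.discount ^ c / (1 - M.discount)

theorem tailWeight_nonneg (c : ℕ) : 0 ≤ M.tailWeight c :=
  div_nonneg (pow_nonneg M.discount_nonneg c) M.one_sub_discount_pos.le

theorem one_sub_discount_mul_tailWeight (c : ℕ) :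
    (1 - M.discount) * M.tailWeight c = M.discount ^ c :=
  mul_div_cancel₀ _ M.one_sub_discount_pos.ne'

theorem discount_pow_le (hcH : c ≤ H) : M.discount ^ (H + 1) ≤ M.discount ^ c :=
  pow_le_pow_of_le_one M.discount_nonneg M.discount_lt_one.le (by omega)

/-- The error budget of the generalized setting. -/
def generalBudget (hcH : c ≤ H) (hK : M.radius + 2 * (c - 1) ≤ K) : M.ErrorBudget V K H π where
  cut g _ _ := M.tailWeight c * (2 * M.weight g)
  abs_sub_le_cut _ _ _ _ _ _ _ hP hs := abs_cutoffValueAs_sub_le hP fun _ => hs.mono hK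
  -- Two cuts cost 4 units of `tailWeight c * weight q`, and every proper part has at least one
  -- agent less, so the coefficient grows by 4 per agent. A single agent never splits and needs only
  -- 2.
  loc q := (4 * q.card - 2) * M.tailWeight c * M.weight q
  two_mul_le_loc q hq := by
    have h1 : (1 : ℝ) ≤ q.card := mod_cast hq.card_pos
    have h2 := M.one_sub_discount_mul_tailWeight c
    have h3 := M.weight_nonneg q
    have h4 := M.discount_pow_le hcH
    have h5 : 0 ≤ M.discount ^ c := pow_nonneg M.discount_nonneg c
    calc 2 * M.discount ^ (H + 1) * M.weight q
        ≤ (4 * q.card - 2) * M.discount ^ c * M.weight q := by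
          refine mul_le_mul_of_nonneg_right ?_ h3
          nlinarith
      _ = _ := by
          rw [← h2]
          ring
  exists_cut_le q S hS hq := by
    refine ⟨M.tailWeight c * (2 * M.weight q), fun _ _ _ => le_rfl, ?_⟩
    have h0 := M.tailWeight_nonneg c
    rcases q.eq_empty_or_nonempty with rfl | hne
    · have hw : M.weight ∅ = 0 := by simp [weight, pairSum]
      have hf : S.parts.filter (· ⊆ ∅) = ∅ := Finset.filter_eq_empty_iff.2 fun r hr hr' =>
        S.ne_empty hr (Finset.subset_empty.1 hr')
      rw [hf, Finset.sum_empty, hw]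
      simp
    have h1 : ∀ r ∈ S.parts.filter (· ⊆ q), (4 * (r.card : ℝ) - 2) * M.tailWeight c * M.weight r ≤
        (4 * (q.card : ℝ) - 6) * M.tailWeight c * M.weight r := by
      intro r hr
      rw [Finset.mem_filter] at hr
      have hlt : r.card < q.card := Finset.card_lt_card
        (hr.2.ssubset_of_ne fun h => hq (h ▸ hr.1))
      have hlt' : (r.card : ℝ) + 1 ≤ q.card := mod_cast hlt
      refine mul_le_mul_of_nonneg_right (mul_le_mul_of_nonneg_right ?_ h0) (M.weight_nonneg r)
      linarith
    have h2 : (0 : ℝ) ≤ 4 * q.card - 6 := by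
      obtain ⟨i, hi⟩ := hne
      have hlt : (S.part i).card < q.card := Finset.card_lt_card
        ((hS i hi).ssubset_of_ne fun h => hq (h ▸ part_mem S i))
      have hpos : 0 < (S.part i).card := Finset.card_pos.2 ⟨i, mem_part_self S i⟩
      have : (2 : ℝ) ≤ q.card := mod_cast (by omega : 2 ≤ q.card)
      linarith
    have h3 := Finset.sum_le_sum h1
    rw [← Finset.mul_sum] at h3
    have h4 := mul_le_mul_of_nonneg_left (M.sum_weight_filter_le S q) (mul_nonneg h2 h0)
    linarith
  lower z := M.tailWeight c * (2 * M.weight z)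
  cut_le_lower _ _ _ := le_rfl
  -- The two full cuts are charged to every group anew; with at most `n` groups this is the source
  -- of one of the terms linear in `n`.
  upper z := M.tailWeight c * (4 * M.rewardBound + 2 * M.weight z)
  cut_le_upper z _ _ := by
    rw [weight_univ]
    linarith
  -- The truncated subtraction keeps the rate nonnegative for `n = 0`.
  locRate := ((4 * n - 2 : ℕ) : ℝ) * M.tailWeight c
  locRate_nonneg := mul_nonneg (Nat.cast_nonneg _) (M.tailWeight_nonneg c)
  loc_le q hq := by
    have h1 : q.card ≤ n := by simpa using q.card_le_univ
    have h2 := hq.card_pos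
    have h3 : (4 * (q.card : ℝ) - 2) ≤ ((4 * n - 2 : ℕ) : ℝ) := by
      rw [Nat.cast_sub (by omega)]
      push_cast
      have : (q.card : ℝ) ≤ n := mod_cast h1
      linarith
    exact mul_le_mul_of_nonneg_right (mul_le_mul_of_nonneg_right h3 (M.tailWeight_nonneg c))
      (M.weight_nonneg q)
  lowerTotal := M.tailWeight c * (2 * M.rewardBound)
  sum_lower_le Q := by
    rw [← Finset.mul_sum, ← Finset.mul_sum]
    exact mul_le_mul_of_nonneg_left (by linarith [M.sum_weight_le Q]) (M.tailWeight_nonneg c)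
  cut_univ_le _ _ := by rw [weight_univ]
  upperTotal := M.tailWeight c * ((4 * n + 2) * M.rewardBound)
  sum_upper_le Q := by
    rw [← Finset.mul_sum, Finset.sum_add_distrib, Finset.sum_const, nsmul_eq_mul, ← Finset.mul_sum]
    refine mul_le_mul_of_nonneg_left ?_ (M.tailWeight_nonneg c)
    have h1 : (Q.parts.card : ℝ) ≤ n := by
      have := Q.card_parts_le_card
      rw [Finset.card_univ, Fintype.card_fin] at this
      exact_mod_cast this
    have h2 : 0 ≤ M.rewardBound := M.weight_univ ▸ M.weight_nonneg _
    nlinarith [M.sum_weight_le Q]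
  lowerTotal_le := by
    have h2 : 0 ≤ M.rewardBound := M.weight_univ ▸ M.weight_nonneg _
    refine mul_le_mul_of_nonneg_left ?_ (M.tailWeight_nonneg c)
    nlinarith [mul_nonneg (Nat.cast_nonneg (α := ℝ) n) h2]

/-- The error budget of the standard setting. -/
def standardBudget (hM : M.IsStandard) (hcH : c ≤ H) (hK : M.radius + 2 * (c - 1) ≤ K) :
    M.ErrorBudget V K H π where
  cut g P P' := M.tailWeight c * M.gapWeight g P P'
  abs_sub_le_cut _ _ _ _ _ _ _ hP hs :=
    abs_cutoffValueAs_sub_le_of_isStandard hM hP fun _ => hs.mono hK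
  -- No dependence on the size of `q`: the cuts pay for the pairs that a split separates, the parts
  -- for the pairs that stay together, so each pair is charged once.
  loc q := 2 * M.tailWeight c * M.weight q
  two_mul_le_loc q _ := by
    have h2 := M.one_sub_discount_mul_tailWeight c
    calc 2 * M.discount ^ (H + 1) * M.weight q ≤ 2 * M.discount ^ c * M.weight q := by
          refine mul_le_mul_of_nonneg_right ?_ (M.weight_nonneg q)
          linarith [M.discount_pow_le hcH]
      _ = _ := by
          rw [← h2]
          ring
  exists_cut_le q S hS _ := by
    have h0 := M.tailWeight_nonneg c
    refine ⟨M.tailWeight c * pairSum (fun i j => i ∈ q ∧ j ∈ q ∧ j ∉ S.part i) M.pairWeight,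
      fun P P' hP => mul_le_mul_of_nonneg_left (pairSum_mono (fun i j h => ?_)
        M.pairWeight_nonneg) h0, ?_⟩
    · exact ⟨h.1, h.2.1, hP i h.1 ▸ h.2.2.2⟩
    · have h1 := M.sum_weight_filter_le_sum S q
      have h2 : ∑ r ∈ S.parts, M.weight (q ∩ r) =
          pairSum (fun i j => i ∈ q ∧ j ∈ q ∧ j ∈ S.part i) M.pairWeight :=
        sum_pairSum_parts S (fun i _ => i) (fun r i j => i ∈ q ∩ r ∧ j ∈ q ∩ r)
          (fun r _ i j h => Finset.mem_of_mem_inter_right h.1) fun i j => by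
            simp only [Finset.mem_inter, mem_part_self, and_true]
      have h3 : pairSum (fun i j => i ∈ q ∧ j ∈ q ∧ j ∉ S.part i) M.pairWeight +
          pairSum (fun i j => i ∈ q ∧ j ∈ q ∧ j ∈ S.part i) M.pairWeight ≤ M.weight q :=
        pairSum_add_le M.pairWeight_nonneg (fun i j h h' => h.2.2 h'.2.2)
          (fun i j h => ⟨h.1, h.2.1⟩) fun i j h => ⟨h.1, h.2.1⟩
      rw [← Finset.mul_sum]
      have h4 := mul_le_mul_of_nonneg_left (h1.trans h2.le) h0
      have h5 := mul_le_mul_of_nonneg_left h3 h0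
      linarith
  lower z := M.tailWeight c * M.weight z
  cut_le_lower _ _ _ := mul_le_mul_of_nonneg_left
    (pairSum_mono (fun _ _ h => ⟨h.1, h.2.1⟩) M.pairWeight_nonneg) (M.tailWeight_nonneg c)
  -- A pair with both agents in `z` is counted in both sums, which absorbs the extra cut for `z`.
  -- Summed over all groups, each of the two sums gives the full weight once.
  upper z := M.tailWeight c * (2 * (pairSum (fun i _ => i ∈ z) M.pairWeight +
    pairSum (fun _ j => j ∈ z) M.pairWeight))
  cut_le_upper z P S := by
    have h1 : M.gapWeight Finset.univ P (P ⊓ splitAt S z) ≤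
        pairSum (fun i j => i ∈ z ∨ j ∈ z) M.pairWeight := by
      refine pairSum_mono (fun i j h => ?_) M.pairWeight_nonneg
      by_contra hij
      rw [not_or] at hij
      refine h.2.2.2 ?_
      rw [part_inf, Finset.mem_inter, mem_part_splitAt]
      exact ⟨h.2.2.1, Or.inr hij⟩
    have h2 : M.gapWeight z P (P ⊓ splitAt S z) ≤
        pairSum (fun i j => i ∈ z ∧ j ∈ z) M.pairWeight :=
      pairSum_mono (fun _ _ h => ⟨h.1, h.2.1⟩) M.pairWeight_nonneg
    have h3 := pairSum_or_add_and (fun i _ => i ∈ z) (fun _ j => j ∈ z) M.pairWeight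
    have h4 : 0 ≤ pairSum (fun i j => i ∈ z ∧ j ∈ z) M.pairWeight :=
      pairSum_nonneg M.pairWeight_nonneg
    calc _ = M.tailWeight c * (2 * M.gapWeight Finset.univ P (P ⊓ splitAt S z) +
          M.gapWeight z P (P ⊓ splitAt S z)) := by ring
      _ ≤ _ := mul_le_mul_of_nonneg_left (by linarith) (M.tailWeight_nonneg c)
  locRate := 2 * M.tailWeight c
  locRate_nonneg := mul_nonneg two_pos.le (M.tailWeight_nonneg c)
  loc_le _ _ := le_rfl
  lowerTotal := M.tailWeight c * M.rewardBound
  sum_lower_le Q := by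
    rw [← Finset.mul_sum]
    exact mul_le_mul_of_nonneg_left (M.sum_weight_le Q) (M.tailWeight_nonneg c)
  cut_univ_le P P' := by
    rw [← weight_univ]
    exact mul_le_mul_of_nonneg_left
      (pairSum_mono (fun _ _ h => ⟨h.1, h.2.1⟩) M.pairWeight_nonneg) (M.tailWeight_nonneg c)
  upperTotal := M.tailWeight c * (4 * M.rewardBound)
  sum_upper_le Q := by
    have h1 : ∑ z ∈ Q.parts, pairSum (fun i _ => i ∈ z) M.pairWeight = M.rewardBound := by
      rw [← weight_univ]
      exact sum_pairSum_parts Q (fun i _ => i) (fun z i _ => i ∈ z) (fun _ _ _ _ h => h)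
        fun i j => by simp
    have h2 : ∑ z ∈ Q.parts, pairSum (fun _ j => j ∈ z) M.pairWeight = M.rewardBound := by
      rw [← weight_univ]
      exact sum_pairSum_parts Q (fun _ j => j) (fun z _ j => j ∈ z) (fun _ _ _ _ h => h)
        fun i j => by simp
    rw [← Finset.mul_sum, ← Finset.mul_sum, Finset.sum_add_distrib, h1, h2]
    exact (congrArg _ (by ring)).le
  lowerTotal_le := by
    have h2 : 0 ≤ M.rewardBound := M.weight_univ ▸ M.weight_nonneg _
    exact mul_le_mul_of_nonneg_left (by linarith) (M.tailWeight_nonneg c)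

end Budgets

end LocallyInterdependentMDP

end

/-! ### The theorem: choice of constants -/

theorem mainTheorem2 {n : ℕ} {X : Type u} [MetricSpace X] {Y : Fin n → Type v}
    {A : Fin n → Type w} (M : LocallyInterdependentMDP n X Y A)
    (Vexec ξ : ℝ) (hV : M.radius < Vexec) (hξ : 0 ≤ ξ) (c η : ℕ) (hc : c = M.cutoffTime Vexec)
    (hγ : M.discount = 0 → 1 ≤ c)
    (π : ℕ → CutoffPolicy X Y A) (hπ : M.IsConsistentPerformance (Vexec + ξ) (c + η) π)
    (ρ : ValidExtraction X Y Vexec (Vexec + ξ)) (s : JointState X Y) :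
    (M.IsStandard →
      |M.cutoffValue (Vexec + ξ) π 0 (c + η + 1) Finset.univ s (jointPartition (Vexec + ξ) s) -
          M.execValue ρ (π 0) s| ≤
        (M.discount ^ 2 + M.discount ^ (η + 1) +
            (4 + M.discount + 5 * M.discount ^ 2) / (1 - M.discount)) *
          (M.discount ^ ((c : ℤ) - 1) / (1 - M.discount)) * M.rewardBound) ∧
    |M.cutoffValue (Vexec + ξ) π 0 (c + η + 1) Finset.univ s (jointPartition (Vexec + ξ) s) -
        M.execValue ρ (π 0) s| ≤
      (2 * M.discount ^ 2 + M.discount ^ (η + 1) +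
          (2 * M.discount * (1 + M.discount) + 4 * n * (1 + M.discount ^ 2)) / (1 - M.discount)) *
        (M.discount ^ ((c : ℤ) - 1) / (1 - M.discount)) * M.rewardBound := by
  have h1 := M.one_sub_discount_pos
  have hr : 0 ≤ M.rewardBound := M.weight_univ ▸ M.weight_nonneg _
  have h0 := M.discount_nonneg
  have hlt := M.discount_lt_one
  have hcle : (c : ℝ) ≤ (Vexec - M.radius) / 2 :=
    hc ▸ Nat.floor_le (div_nonneg (sub_nonneg.2 hV.le) two_pos.le)
  -- The scale of far-apart groups is `Vexec - 2`: one step may use up 2 of the visibility, and the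
  -- rest lasts for `c` steps by the choice of `c`.
  have hK : M.radius + 2 * ((c : ℝ) - 1) ≤ Vexec - 2 := by linarith
  have hWV : Vexec ≤ Vexec + ξ := by linarith
  set u := M.discount ^ ((c : ℤ) - 1) with hu
  have hu0 : 0 ≤ u := zpow_nonneg h0 _
  -- The only delicate case is γ = 0, where `c ≥ 1` makes both sides 0; for `c = 0` the left side
  -- would be 1.
  have hcu : M.discount ^ c = M.discount * u := by
    rcases eq_or_ne M.discount 0 with hd | hd
    · rw [hd, zero_mul, zero_pow (by have := hγ hd; omega)]
    · rw [hu, ← zpow_natCast, ← zpow_one_add₀ hd]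
      congr 1
      ring
  have hHu : M.discount ^ (c + η + 1) ≤ M.discount ^ (η + 1) * u := by
    rw [add_assoc, pow_add, hcu]
    have : 0 ≤ u * M.discount ^ (η + 1) := mul_nonneg hu0 (pow_nonneg h0 _)
    nlinarith
  -- Here `a` is the total error in units of γ^c / (1 - γ), and one factor γ of it is moved into
  -- `e`. The bound obtained is slightly stronger than the claimed one: `d` is pure slack.
  have main : ∀ {x a d e : ℝ}, x ≤ (a * (M.discount ^ c / (1 - M.discount)) * M.rewardBound +
      M.discount ^ (c + η + 1) * M.rewardBound) / (1 - M.discount) → 0 ≤ d →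
      a * M.discount * M.rewardBound ≤ e * M.rewardBound →
      x ≤ (d + M.discount ^ (η + 1) + e / (1 - M.discount)) * (u / (1 - M.discount)) *
        M.rewardBound := by
    intro x a d e hx hd hae
    refine hx.trans ?_
    rw [hcu]
    have e1 : 0 ≤ (e * M.rewardBound - a * M.discount * M.rewardBound) * u / (1 - M.discount) :=
      div_nonneg (mul_nonneg (by linarith) hu0) h1.le
    have e2 : 0 ≤ d * u * M.rewardBound := by positivity
    have e3 : 0 ≤ (M.discount ^ (η + 1) * u - M.discount ^ (c + η + 1)) * M.rewardBound :=
      mul_nonneg (by linarith) hr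
    rw [div_le_iff₀ h1]
    calc _ ≤ a * (M.discount * u / (1 - M.discount)) * M.rewardBound +
          M.discount ^ (c + η + 1) * M.rewardBound +
          ((e * M.rewardBound - a * M.discount * M.rewardBound) * u / (1 - M.discount) +
            d * u * M.rewardBound +
            (M.discount ^ (η + 1) * u - M.discount ^ (c + η + 1)) * M.rewardBound) := by linarith
      _ = _ := by
          field_simp
          ring
  constructor
  · intro hM
    have h := LocallyInterdependentMDP.abs_planValue_sub_execValue_le
      (M.standardBudget (Vexec + ξ) π hM (Nat.le_add_right c η) hK) hπ ρ hV.le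
      (by linarith) hWV s
    -- 7 = 1 + 4 + 2, from `lowerTotal`, `upperTotal` and `locRate`. What remains is 5γ² - 6γ + 4 ≥
    -- 0, and five times this is (5γ - 3)² + 11.
    refine main (a := 7) (h.trans_eq ?_) (by positivity) ?_
    · simp only [LocallyInterdependentMDP.standardBudget,
        LocallyInterdependentMDP.tailWeight]
      ring
    · refine mul_le_mul_of_nonneg_right ?_ hr
      nlinarith [sq_nonneg (5 * M.discount - 3)]
  · have h := LocallyInterdependentMDP.abs_planValue_sub_execValue_le
      (M.generalBudget (Vexec + ξ) π (Nat.le_add_right c η) hK) hπ ρ hV.le (by linarith) hWV s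
    -- The constants are 2, 4n + 2 and 4n - 2, with sum 8n + 2 for `n ≥ 1`. What remains is 4n(1 -
    -- γ)² + 2γ² ≥ 0. For `n = 0` the subtraction is truncated, but then the reward bound is 0.
    refine main (a := 4 * n + 4 + ((4 * n - 2 : ℕ) : ℝ)) (h.trans_eq ?_) (by positivity) ?_
    · simp only [LocallyInterdependentMDP.generalBudget,
        LocallyInterdependentMDP.tailWeight]
      ring
    · rcases Nat.eq_zero_or_pos n with rfl | hn
      · have : M.rewardBound = 0 := by simp [LocallyInterdependentMDP.rewardBound]
        rw [this, mul_zero, mul_zero]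
      · refine mul_le_mul_of_nonneg_right ?_ hr
        rw [Nat.cast_sub (by omega)]
        push_cast
        have hn' : (0 : ℝ) ≤ n := Nat.cast_nonneg n
        nlinarith [mul_nonneg hn' (sq_nonneg (1 - M.discount)), sq_nonneg M.discount]
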